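/- **Setting.** Consider $\min_{x\in\mathbb R^n}F(x):=g_0(x)+\delta_{\mathbb R^m_-}(g(x))+\phi(x)$ with $g=(g_1,\dots,g_m)$, $\Gamma:=\{x: g(x)\in\mathbb R^m_-\}\neq\emptyset$, where $g_0:\mathbb R^n\to(-\infty,\infty]$ is locally Lipschitz and upper-$\mathcal C^2$ at every point of an open convex set $\mathcal O\supset\Gamma$, $g_1,\dots,g_m:\mathbb R^n\to\mathbb R$ are locally Lipschitz and upper-$\mathcal C^2$ at every point of $\mathbb R^n$, $\phi:\mathbb R^n\to\mathbb R$ is convex, and $F$ is bounded below on $\Gamma$. (Here $h$ is upper-$\mathcal C^2$ at $\bar x$ if near $\bar x$ it equals $\min_{s\in\Delta}\{\frac\rho2\|x\|^2-\langle b(s),x\rangle-c(s)\}$ for some $\rho\ge0$, compact $\Delta\subset\mathbb R^p$ and continuous $b,c$.) Here $\partial$ is the limiting subdifferential and $\mathcal N$ the normal cone. For $s,\xi,x\in\mathbb R^n$, $V=[V_1\cdots V_m]\in\mathbb R^{n\times m}$, $L\in\mathbb R^m_+$ and a linear operator $\mathcal Q$ put $G(x,s,V,L):=g(s)+V^\top(x-s)+\frac12\|x-s\|^2L$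 and $\vartheta_{s,\xi,\mathcal Q}(x):=g_0(s)+\langle\xi,x-s\rangle+\frac12\langle x-s,\mathcal Q(x-s)\rangle$. **Algorithm.** Given $0<\mu_{\min}\le\mu_{\max}$, $0<L_{\min}\le L_{\max}$, $M,\beta_C,\beta_S,\alpha>0$, $\tau>1$ and $x^0\in\Gamma$, an infinite run is as follows. For $k=0,1,2,\dots$ choose $\xi^k\in\partial g_0(x^k)$, $V^k$ with $V^k_i\in\partial g_i(x^k)$, $\mu_{k,0}\in[\mu_{\min},\mu_{\max}]$, $L^{k,0}\in[L_{\min},L_{\max}]^m$. For $j=0,1,\dots$ choose $\mathcal Q_{k,j}$ with $\mu_{k,j}\mathcal I\preceq\mathcal Q_{k,j}\preceq(\mu_{k,j}+M)\mathcal I$ and, with $\vartheta_{k,j}:=\vartheta_{x^k,\xi^k,\mathcal Q_{k,j}}$, $G_{k,j}:=G(\cdot,x^k,V^k,L^{k,j})$, $F_{k,j}:=\vartheta_{k,j}+\phi$, find $y=y^{k,j}$, $v\in\partial\phi(y)$, $\lambda\in\mathbb R^m_+$ with $$F_{k,j}(y)\le F_{k,j}(x^k),\quad(-\langle\lambda,G_{k,j}(y)\rangle)_++\|[G_{k,j}(y)]_+\|_\infty\le\tfrac{\beta_C}2\|y-x^k\|^2,\quad\|\nabla\vartheta_{k,j}(y)+v+\nabla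 G_{k,j}(y)\lambda\|\le\beta_S\|y-x^k\|.$$ If $y\in\Gamma$ and $F(y)\le F(x^k)-\frac\alpha2\|y-x^k\|^2$, stop the inner loop, set $j_k:=j$, $x^{k+1}:=y$, $L^k:=L^{k,j}$, $\mathcal Q_k:=\mathcal Q_{k,j}$. Otherwise, if $y\notin\Gamma$, set $L^{k,j+1}=\tau L^{k,j}$, $\mu_{k,j+1}=\mu_{k,j}$; if $y\in\Gamma$, set $L^{k,j+1}=L^{k,j}$, $\mu_{k,j+1}=\tau\mu_{k,j}$. Let $\bar x^{k,j}$ be the minimizer of $F_{k,j}$ over $\{x: G_{k,j}(x)\in\mathbb R^m_-\}$ and $\bar x^k:=\bar x^{k,j_k}$. **Assumptions.** (2) For all $k$ and all $j\le j_k$, the multifunction $G_{k,j}(\cdot)-\mathbb R^m_-$ is metrically subregular at $(\bar x^{k,j},0)$. (3) $\{x^k\}$ is bounded. (4) Let $\mathbb U:=\mathbb R^n\times\mathbb R^m_+\times\mathbb R^{n\times m}\times\mathbb R^n\times\mathbb S_+$, with $\mathbb S_+$ the positive semidefinite operators on $\mathbb R^n$; for $u=(s,L,V,\xi,\mathcal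 Q)\in\mathbb U$ let $H(u,x):=G(x,s,V,L)$, $\mathcal S(u):=\{x: H(u,x)\in\mathbb R^m_-\}$, and let $u^k:=(x^k,L^k,V^k,\xi^k,\mathcal Q_k)$. At every cluster point $(u^*,x^*)$ of $\{(u^k,\bar x^k)\}$ the partial bounded multiplier property holds: there are $\kappa>0$ and a neighborhood of $(u^*,x^*)$ such that for all $(u,x)$ in it with $u\in\mathbb U$, $x\in\mathcal S(u)$ and all $y\in\mathcal N_{\mathcal S(u)}(x)$ there is $\lambda\in\mathcal N_{\mathbb R^m_-}(H(u,x))$ with $\nabla_xH(u,x)\lambda=y$ and $\|\lambda\|\le\kappa\|y\|$. **Potential function.** Let $D\subset\mathcal O$ be a compact convex set whose interior contains all $x^k$, and let $g_i=f_i-h_i$ on $D$ ($i=0,\dots,m$) with $f_i:\mathbb R^n\to\mathbb R$ strongly convex quadratic and $h_i:\mathbb R^n\to\mathbb R$ strongly convex, with conjugate $h_i^*$. For $z=(x,s,V,L,\xi)\in\mathbb R^n\times\mathbb R^n\times\mathbb R^{n\times m}\times\mathbb R^m_+\times\mathbb R^n$ define $$T_0(x,s,\xi):=\langle\xi,x\rangle+f_0(s)-\langle\nabla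 f_0(s),s\rangle+h_0^*(-\xi+\nabla f_0(s)),$$ $$T_i(x,s,V,L):=\langle V_i,x\rangle+f_i(s)-\langle\nabla f_i(s),s\rangle+h_i^*(-V_i+\nabla f_i(s))+\tfrac12\|x-s\|^2L_i\quad(1\le i\le m),$$ $$\Phi(z):=\phi(x)+T_0(x,s,\xi)+\delta_{\mathbb R^m_-}(T(x,s,V,L)),$$ and $\Phi:=\infty$ if $L\notin\mathbb R^m_+$. Let $\mathcal Z^*$ be the set of cluster points of $z^k:=(\bar x^k,x^k,V^k,L^k,\xi^k)$. $\Phi$ has the KL property of exponent $q$ at $\bar z$ if $\partial\Phi(\bar z)\ne\emptyset$ and there are $\delta,c>0$, $\eta\in(0,\infty]$ with $\varphi'(\Phi(z)-\Phi(\bar z))\,\mathrm{dist}(0,\partial\Phi(z))\ge1$, $\varphi(t)=ct^{1-q}$, for all $z$ with $\|z-\bar z\|\le\delta$ and $\Phi(\bar z)<\Phi(z)<\Phi(\bar z)+\eta$. **Theorem.** Under these assumptions, if $\Phi$ has the KL property of exponent $q\in[1/2,1)$ at every point of $\mathcal Z^*$, then $F(x^k)$ converges to some $\varpi^*\in\mathbb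 R$, $x^k$ converges to some $x^*\in\mathbb R^n$, and: (i) if $q=\frac12$, there are $\widehat a_1>0$ and $\varrho,\widehat\varrho\in(0,1)$ such that for all $k$ large enough $F(x^{k+1})-\varpi^*\le\varrho\,(F(x^k)-\varpi^*)$ and $\|x^k-x^*\|\le\widehat a_1\widehat\varrho^{\,k}$; (ii) if $q\in(\frac12,1)$, there are $\widehat a_2,\widehat a_3>0$ such that for all $k$ large enough $F(x^k)-\varpi^*\le\widehat a_2k^{-\frac1{2q-1}}$ and $\|x^k-x^*\|\le\widehat a_3k^{-\frac{1-q}{2q-1}}$. -/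

import Mathlib

open Set Filter Topology
open scoped RealInnerProductSpace

noncomputable section

namespace MBA

/-! ### Spaces -/

/-- `ℝⁿ` with the Euclidean norm. -/
abbrev Vec (n : ℕ) := EuclideanSpace ℝ (Fin n)

/-- Real `n × m` matrices, given by their `m` columns, with the Frobenius inner product. -/
abbrev Mat (n m : ℕ) := PiLp 2 (fun _ : Fin m => Vec n)

/-- The nonpositive orthant of `ℝᵐ`. -/
def nonposOrthant (m : ℕ) : Set (Vec m) := {w | ∀ i, w i ≤ 0}

/-- The transposed Jacobian `∇H(x)` of a mapping `H`. -/
def nabla {n m : ℕ} (H : Vec n → Vec m) (x : Vec n) : Vec m →L[ℝ] Vec n :=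
  ContinuousLinearMap.adjoint (fderiv ℝ H x)

/-! ### Variational analysis -/

section Variational

variable {X : Type*} [NormedAddCommGroup X] [InnerProductSpace ℝ X]

/-- The regular (Fréchet) subdifferential of an extended real valued function:
`h x' ≥ h x + ⟪v, x' - x⟫ + o(‖x' - x‖)`, at points where `h` is finite. -/
def regSubdiff (h : X → EReal) (x : X) : Set X :=
  {v | h x ≠ ⊤ ∧ h x ≠ ⊥ ∧ ∀ ε : ℝ, 0 < ε →
    ∀ᶠ x' in 𝓝 x, h x + ((⟪v, x' - x⟫ - ε * ‖x' - x‖ : ℝ) : EReal) ≤ h x'}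

/-- The basic (limiting, Mordukhovich) subdifferential. -/
def limSubdiff (h : X → EReal) (x : X) : Set X :=
  {v | h x ≠ ⊤ ∧ h x ≠ ⊥ ∧ ∃ (a : ℕ → X) (w : ℕ → X),
    Tendsto a atTop (𝓝 x) ∧ Tendsto (fun l => h (a l)) atTop (𝓝 (h x)) ∧
    (∀ l, w l ∈ regSubdiff h (a l)) ∧ Tendsto w atTop (𝓝 v)}

/-- The normal cone to a convex set (it is used for convex sets only). -/
def normalCone (C : Set X) (x : X) : Set X :=
  {v | x ∈ C ∧ ∀ z ∈ C, ⟪v, z - x⟫ ≤ 0}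

/-- The conjugate `s ↦ sup_x (⟪x, s⟫ - h x)`. It is used for finite strongly convex functions on
`ℝⁿ` only, for which the supremum is finite for every `s`. -/
def conj (h : X → ℝ) (s : X) : ℝ := ⨆ x : X, (⟪x, s⟫ - h x)

/-- `h` is finite and Lipschitz continuous near `x`. -/
def LocLipschitzAt (h : X → EReal) (x : X) : Prop :=
  ∃ δ > 0, ∃ (K : NNReal) (r : X → ℝ),
    (∀ x' ∈ Metric.ball x δ, h x' = r x') ∧ LipschitzOnWith K r (Metric.ball x δ)

/-- The desingularizing inequality `φ'(h(x) - h(x̄)) dist(0, ∂h(x)) ≥ 1` for all `x` in the closed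
`δ`-ball around `x̄` with `h(x̄) < h(x) < h(x̄) + η`. The distance to the empty set is `∞`. -/
def KLInequality (h : X → EReal) (xb : X) (φ : ℝ → ℝ) (δ : ℝ) (η : EReal) : Prop :=
  ∀ x ∈ Metric.closedBall xb δ, h xb < h x → h x < h xb + η →
    1 ≤ ENNReal.ofReal (deriv φ (h x - h xb).toReal) * Metric.infEDist 0 (limSubdiff h x)

/-- `h` has the Kurdyka–Łojasiewicz property of exponent `q ∈ [0,1)` at `xb`, a point of the
domain of the limiting subdifferential. -/
def HasKLExponent (h : X → EReal) (q : ℝ) (xb : X) : Prop :=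
  (limSubdiff h xb).Nonempty ∧ ∃ (δ : ℝ) (η : EReal) (c : ℝ), 0 < δ ∧ 0 < η ∧ 0 < c ∧
    KLInequality h xb (fun t => c * t ^ (1 - q)) δ η

/-- Metric subregularity of a multifunction at a point `(xb, yb)` of its graph. -/
def Subregular {Y : Type*} [PseudoEMetricSpace Y] (Fm : X → Set Y) (xb : X) (yb : Y) : Prop :=
  yb ∈ Fm xb ∧ ∃ δ > 0, ∃ κ : ℝ, 0 < κ ∧ ∀ x ∈ Metric.closedBall xb δ,
    Metric.infEDist x {z | yb ∈ Fm z} ≤ ENNReal.ofReal κ * Metric.infEDist yb (Fm x)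

end Variational

/-- `h` is upper-`C²` at `x`: near `x` it is the minimum, over a compact set of parameters, of
quadratics `(ρ/2)‖·‖² - ⟪b(s), ·⟫ - c(s)` with coefficients depending continuously on `s`. -/
def UpperC2At {n : ℕ} (h : Vec n → EReal) (x : Vec n) : Prop :=
  ∃ ρ : ℝ, 0 ≤ ρ ∧ ∃ δ > 0, ∃ (p : ℕ) (Δ : Set (Vec p)) (b : Vec p → Vec n) (c : Vec p → ℝ),
    IsCompact Δ ∧ ContinuousOn b Δ ∧ ContinuousOn c Δ ∧
    ∀ x' ∈ Metric.ball x δ, ∃ r : ℝ, h x' = r ∧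
      IsLeast ((fun s => ρ / 2 * ‖x'‖ ^ 2 - ⟪b s, x'⟫ - c s) '' Δ) r

/-- A strongly convex quadratic function on `ℝⁿ`. -/
def IsStronglyConvexQuadratic {n : ℕ} (f : Vec n → ℝ) : Prop :=
  (∃ (A : Vec n →L[ℝ] Vec n) (b : Vec n) (c : ℝ), ∀ x, f x = 1 / 2 * ⟪x, A x⟫ + ⟪b, x⟫ + c) ∧
  ∃ σ : ℝ, 0 < σ ∧ StrongConvexOn univ σ f

/-! ### The optimization problem -/

/-- Data of the problem `min g₀(x) + δ(g(x)) + φ(x)`, where `δ` is the indicator function of the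
nonpositive orthant; `O` is the open convex set on which `g₀` is well behaved. -/
structure Problem (n m : ℕ) where
  O : Set (Vec n)
  g0 : Vec n → EReal
  g : Fin m → Vec n → ℝ
  φ : Vec n → ℝ

namespace Problem

variable {n m : ℕ} (P : Problem n m)

/-- The feasible set `Γ`. -/
def feasible : Set (Vec n) := {x | ∀ i, P.g i x ≤ 0}

open Classical in
/-- The objective function `F = g₀ + δ(g(·)) + φ`. -/
def F (x : Vec n) : EReal :=
  P.g0 x + (if x ∈ P.feasible then 0 else ⊤) + (P.φ x : EReal)

/-- The standing assumptions on the problem data. -/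
structure Standing : Prop where
  isOpen_O : IsOpen P.O
  convex_O : Convex ℝ P.O
  nonempty : P.feasible.Nonempty
  feasible_subset : P.feasible ⊆ P.O
  g0_ne_bot : ∀ x, P.g0 x ≠ ⊥
  g0_lipschitz : ∀ x ∈ P.O, LocLipschitzAt P.g0 x
  g0_upperC2 : ∀ x ∈ P.O, UpperC2At P.g0 x
  g_lipschitz : ∀ i x, LocLipschitzAt (fun x' => (P.g i x' : EReal)) x
  g_upperC2 : ∀ i x, UpperC2At (fun x' => (P.g i x' : EReal)) x
  φ_convex : ConvexOn ℝ univ P.φ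
  bddBelow : ∃ c : ℝ, ∀ x ∈ P.feasible, (c : EReal) ≤ P.F x

/-- `G(x,s,V,L) = g(s) + Vᵀ(x - s) + ½‖x - s‖² L`. -/
def G (x s : Vec n) (V : Mat n m) (L : Vec m) : Vec m :=
  WithLp.toLp 2 fun i => P.g i s + ⟪V i, x - s⟫ + 1 / 2 * ‖x - s‖ ^ 2 * L i

/-- The quadratic model `ϑ(x) = g₀(s) + ⟪ξ, x - s⟫ + ½⟪x - s, Q (x - s)⟫` of `g₀` at `s`
(where `g₀` is finite at the feasible points `s` at which it is used). -/
def model (s ξ : Vec n) (Q : Vec n →L[ℝ] Vec n) (x : Vec n) : ℝ :=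
  (P.g0 s).toReal + ⟪ξ, x - s⟫ + 1 / 2 * ⟪x - s, Q (x - s)⟫

/-- The objective function `ϑ + φ` of a subproblem. -/
def subObj (s ξ : Vec n) (Q : Vec n →L[ℝ] Vec n) (x : Vec n) : ℝ :=
  P.model s ξ Q x + P.φ x

/-- The feasible set `{x | G(x,s,V,L) ≤ 0}` of a subproblem. -/
def subFeasible (s : Vec n) (V : Mat n m) (L : Vec m) : Set (Vec n) :=
  {x | P.G x s V L ∈ nonposOrthant m}

/-- The multifunction `x ↦ G(x,s,V,L) - ℝᵐ₋`. -/
def subMultifunction (s : Vec n) (V : Mat n m) (L : Vec m) (x : Vec n) : Set (Vec m) :=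
  (fun w => P.G x s V L - w) '' nonposOrthant m

/-- The stationarity residual `‖∇ϑ(x) + v + ∇ₓG(x,s,V,L) lam‖`. -/
def residS (s ξ : Vec n) (V : Mat n m) (Q : Vec n →L[ℝ] Vec n) (L : Vec m)
    (x v : Vec n) (lam : Vec m) : ℝ :=
  ‖gradient (P.model s ξ Q) x + v + nabla (fun x' => P.G x' s V L) x lam‖

/-- The complementarity and feasibility violation
`(-⟪lam, G(x,s,V,L)⟫)₊ + ‖[G(x,s,V,L)]₊‖_∞`. -/
def residC (s : Vec n) (V : Mat n m) (L : Vec m) (x : Vec n) (lam : Vec m) : ℝ :=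
  max 0 (-⟪lam, P.G x s V L⟫) + ‖(fun i => max 0 (P.G x s V L i) : Fin m → ℝ)‖

end Problem

/-! ### The inexact moving balls approximation method -/

/-- Input parameters of the method. -/
structure Params where
  μmin : ℝ
  μmax : ℝ
  Lmin : ℝ
  Lmax : ℝ
  M : ℝ
  βC : ℝ
  βS : ℝ
  α : ℝ
  τ : ℝ

/-- The ranges of the input parameters. -/
structure Params.Valid (p : Params) : Prop where
  μmin_pos : 0 < p.μmin
  μmin_le : p.μmin ≤ p.μmax
  Lmin_pos : 0 < p.Lmin
  Lmin_le : p.Lmin ≤ p.Lmax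
  M_pos : 0 < p.M
  βC_pos : 0 < p.βC
  βS_pos : 0 < p.βS
  α_pos : 0 < p.α
  τ_gt : 1 < p.τ

/-- The quantities produced by the method: `k` counts outer iterations and `j` inner ones, the
inner loop of the outer iteration `k` stops at `j = J k`. Values at `j > J k` are meaningless. -/
structure Run (n m : ℕ) where
  x : ℕ → Vec n
  ξ : ℕ → Vec n
  V : ℕ → Mat n m
  J : ℕ → ℕ
  μ : ℕ → ℕ → ℝ
  L : ℕ → ℕ → Vec m
  Q : ℕ → ℕ → (Vec n →L[ℝ] Vec n)
  y : ℕ → ℕ → Vec n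
  v : ℕ → ℕ → Vec n
  lam : ℕ → ℕ → Vec m

namespace Run

variable {n m : ℕ} (R : Run n m) (P : Problem n m) (p : Params)

/-- The test that stops the inner loop: `y` is feasible and `F` decreases sufficiently. -/
def Accept (k j : ℕ) : Prop :=
  R.y k j ∈ P.feasible ∧
    P.F (R.y k j) ≤ P.F (R.x k) - ((p.α / 2 * ‖R.y k j - R.x k‖ ^ 2 : ℝ) : EReal)

/-- `R` is an (infinite) run of the inexact moving balls approximation method. -/
structure IsGenerated : Prop where
  start : R.x 0 ∈ P.feasible
  ξ_mem : ∀ k, R.ξ k ∈ limSubdiff P.g0 (R.x k)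
  V_mem : ∀ k i, R.V k i ∈ limSubdiff (fun x => (P.g i x : EReal)) (R.x k)
  μ_init : ∀ k, R.μ k 0 ∈ Icc p.μmin p.μmax
  L_init : ∀ k i, R.L k 0 i ∈ Icc p.Lmin p.Lmax
  Q_lower : ∀ k, ∀ j ≤ R.J k,
    (R.Q k j - R.μ k j • ContinuousLinearMap.id ℝ (Vec n)).IsPositive
  Q_upper : ∀ k, ∀ j ≤ R.J k,
    ((R.μ k j + p.M) • ContinuousLinearMap.id ℝ (Vec n) - R.Q k j).IsPositive
  v_mem : ∀ k, ∀ j ≤ R.J k, R.v k j ∈ limSubdiff (fun x => (P.φ x : EReal)) (R.y k j)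
  lam_nonneg : ∀ k, ∀ j ≤ R.J k, ∀ i, 0 ≤ R.lam k j i
  inexact_obj : ∀ k, ∀ j ≤ R.J k,
    P.subObj (R.x k) (R.ξ k) (R.Q k j) (R.y k j) ≤ P.subObj (R.x k) (R.ξ k) (R.Q k j) (R.x k)
  inexact_C : ∀ k, ∀ j ≤ R.J k,
    P.residC (R.x k) (R.V k) (R.L k j) (R.y k j) (R.lam k j)
      ≤ p.βC / 2 * ‖R.y k j - R.x k‖ ^ 2
  inexact_S : ∀ k, ∀ j ≤ R.J k,
    P.residS (R.x k) (R.ξ k) (R.V k) (R.Q k j) (R.L k j) (R.y k j) (R.v k j) (R.lam k j)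
      ≤ p.βS * ‖R.y k j - R.x k‖
  not_accept : ∀ k, ∀ j < R.J k, ¬ R.Accept P p k j
  update_L : ∀ k, ∀ j < R.J k, R.y k j ∉ P.feasible →
    R.L k (j + 1) = p.τ • R.L k j ∧ R.μ k (j + 1) = R.μ k j
  update_μ : ∀ k, ∀ j < R.J k, R.y k j ∈ P.feasible →
    R.L k (j + 1) = R.L k j ∧ R.μ k (j + 1) = p.τ * R.μ k j
  accept : ∀ k, R.Accept P p k (R.J k)
  next : ∀ k, R.x (k + 1) = R.y k (R.J k)

/-- `xb k j` is the optimal solution of the subproblem solved at inner iteration `j` of outer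
iteration `k`. -/
def IsExactSolution (xb : ℕ → ℕ → Vec n) : Prop :=
  ∀ k, ∀ j ≤ R.J k, xb k j ∈ P.subFeasible (R.x k) (R.V k) (R.L k j) ∧
    IsMinOn (P.subObj (R.x k) (R.ξ k) (R.Q k j)) (P.subFeasible (R.x k) (R.V k) (R.L k j)) (xb k j)

/-- The constraint multifunctions of all subproblems are subregular at `(xb k j, 0)`. -/
def SubproblemsSubregular (xb : ℕ → ℕ → Vec n) : Prop :=
  ∀ k, ∀ j ≤ R.J k, Subregular (P.subMultifunction (R.x k) (R.V k) (R.L k j)) (xb k j) 0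

end Run

/-! ### The partial bounded multiplier property -/

/-- The ambient space of the parameters `u = (s, L, V, ξ, Q)`. -/
abbrev ParamSpace (n m : ℕ) := Vec n × Vec m × Mat n m × Vec n × (Vec n →L[ℝ] Vec n)

/-- The parameter set `ℝⁿ × ℝᵐ₊ × ℝⁿˣᵐ × ℝⁿ × 𝕊₊`. -/
def paramSet (n m : ℕ) : Set (ParamSpace n m) :=
  {u | (∀ i, 0 ≤ u.2.1 i) ∧ u.2.2.2.2.IsPositive}

namespace Problem

variable {n m : ℕ} (P : Problem n m)

/-- `H(u,x) = G(x,s,V,L)` for `u = (s,L,V,ξ,Q)`. -/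
def H (u : ParamSpace n m) (x : Vec n) : Vec m := P.G x u.1 u.2.2.1 u.2.1

/-- The solution set `𝒮(u)` of the system `H(u,x) ≤ 0`. It is convex for `u` in the parameter
set. -/
def S (u : ParamSpace n m) : Set (Vec n) := {x | P.H u x ∈ nonposOrthant m}

/-- `Λ(u,x,y)`: the multipliers `lam` in the normal cone to the nonpositive orthant at `H(u,x)`
with `∇ₓH(u,x) lam = y`. -/
def multipliers (u : ParamSpace n m) (x y : Vec n) : Set (Vec m) :=
  {lam | lam ∈ normalCone (nonposOrthant m) (P.H u x) ∧ nabla (P.H u) x lam = y}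

/-- The partial bounded multiplier property with respect to `x` at `(us, xs)`. -/
def PartialBMP (us : ParamSpace n m) (xs : Vec n) : Prop :=
  us ∈ paramSet n m ∧ xs ∈ P.S us ∧
  ∃ κ : ℝ, 0 < κ ∧ ∃ U ∈ 𝓝 us, ∃ W ∈ 𝓝 xs,
    ∀ u ∈ U ∩ paramSet n m, ∀ x ∈ W ∩ P.S u, ∀ y ∈ normalCone (P.S u) x,
      (P.multipliers u x y ∩ Metric.closedBall 0 (κ * ‖y‖)).Nonempty

end Problem

namespace Run

variable {n m : ℕ} (R : Run n m)

/-- `uᵏ = (xᵏ, Lᵏ, Vᵏ, ξᵏ, Qₖ)`, with `Lᵏ`, `Qₖ` the final values of the inner loop. -/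
def u (k : ℕ) : ParamSpace n m :=
  (R.x k, R.L k (R.J k), R.V k, R.ξ k, R.Q k (R.J k))

/-- The partial bounded multiplier property at all cluster points of `(uᵏ, x̄ᵏ)`. -/
def BMPAtClusterPoints (P : Problem n m) (xb : ℕ → ℕ → Vec n) : Prop :=
  ∀ (us : ParamSpace n m) (xs : Vec n),
    MapClusterPt (us, xs) atTop (fun k => (R.u k, xb k (R.J k))) → P.PartialBMP us xs

end Run

/-! ### The potential function -/

/-- `ℝⁿ × ℝⁿ × ℝⁿˣᵐ × ℝᵐ × ℝⁿ` with its Euclidean structure; elements are written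
`z = (x, s, V, L, ξ)`. -/
abbrev ZSpace (n m : ℕ) :=
  WithLp 2 (Vec n × WithLp 2 (Vec n × WithLp 2 (Mat n m × WithLp 2 (Vec m × Vec n))))

/-- The point `(x, s, V, L, ξ)`. -/
def mkZ {n m : ℕ} (x s : Vec n) (V : Mat n m) (L : Vec m) (ξ : Vec n) : ZSpace n m :=
  WithLp.toLp 2 (x, WithLp.toLp 2 (s, WithLp.toLp 2 (V, WithLp.toLp 2 (L, ξ))))

/-- The functions of a representation `gᵢ = fᵢ - hᵢ`, `i = 0, …, m`. -/
structure Decomposition (n m : ℕ) where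
  f0 : Vec n → ℝ
  h0 : Vec n → ℝ
  f : Fin m → Vec n → ℝ
  h : Fin m → Vec n → ℝ

namespace Decomposition

variable {n m : ℕ} (d : Decomposition n m)

/-- `gᵢ = fᵢ - hᵢ` on `D`, with strongly convex quadratics `fᵢ` and strongly convex `hᵢ`. -/
structure IsDecompositionOn (P : Problem n m) (D : Set (Vec n)) : Prop where
  f0_quad : IsStronglyConvexQuadratic d.f0
  f_quad : ∀ i, IsStronglyConvexQuadratic (d.f i)
  h0_strong : ∃ σ : ℝ, 0 < σ ∧ StrongConvexOn univ σ d.h0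
  h_strong : ∀ i, ∃ σ : ℝ, 0 < σ ∧ StrongConvexOn univ σ (d.h i)
  g0_eq : ∀ x ∈ D, P.g0 x = ((d.f0 x - d.h0 x : ℝ) : EReal)
  g_eq : ∀ i, ∀ x ∈ D, P.g i x = d.f i x - d.h i x

/-- `T₀(x,s,ξ) = ⟪ξ,x⟫ + f₀(s) - ⟪∇f₀(s),s⟫ + h₀*(-ξ + ∇f₀(s))`. -/
def T0 (x s ξ : Vec n) : ℝ :=
  ⟪ξ, x⟫ + d.f0 s - ⟪gradient d.f0 s, s⟫ + conj d.h0 (-ξ + gradient d.f0 s)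

/-- `T(x,s,V,L) = Vᵀx + f(s) - f'(s)s + h*(-V + ∇f(s)) + ½‖x - s‖² L`. -/
def T (x s : Vec n) (V : Mat n m) (L : Vec m) : Vec m :=
  WithLp.toLp 2 fun i => ⟪V i, x⟫ + d.f i s - ⟪gradient (d.f i) s, s⟫
    + conj (d.h i) (-V i + gradient (d.f i) s) + 1 / 2 * ‖x - s‖ ^ 2 * L i

open Classical in
/-- The potential function `Φ(z) = φ(x) + T₀(x,s,ξ) + δ(T(x,s,V,L))` on the set of all
`z = (x,s,V,L,ξ)` with `L ≥ 0`, extended by `∞` to the whole space. -/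
def Phi (φ : Vec n → ℝ) (z : ZSpace n m) : EReal :=
  let x := z.fst
  let s := z.snd.fst
  let V := z.snd.snd.fst
  let L := z.snd.snd.snd.fst
  let ξ := z.snd.snd.snd.snd
  if (∀ i, 0 ≤ L i) ∧ d.T x s V L ∈ nonposOrthant m then
    ((φ x + d.T0 x s ξ : ℝ) : EReal)
  else ⊤

end Decomposition

/-- `zᵏ = (x̄ᵏ, xᵏ, Vᵏ, Lᵏ, ξᵏ)`. -/
def Run.z {n m : ℕ} (R : Run n m) (xb : ℕ → ℕ → Vec n) (k : ℕ) : ZSpace n m :=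
  mkZ (xb k (R.J k)) (R.x k) (R.V k) (R.L k (R.J k)) (R.ξ k)

end MBA

end

/-!
# Convergence rates of the inexact moving balls approximation method

Every outer iteration produces, besides the new iterate `xᵏ⁺¹`, the exact solution `x̄ᵏ` of the
final subproblem, and the potential function takes at `zᵏ = (x̄ᵏ, xᵏ, Vᵏ, Lᵏ, ξᵏ)` the value
`Φₖ = φ(x̄ᵏ) + g₀(xᵏ) + ⟪ξᵏ, x̄ᵏ - xᵏ⟫`. Write `Δₖ = ‖xᵏ⁺¹ - xᵏ‖`. The proof rests on the
inequalities

* `F(xᵏ⁺¹) ≤ F(xᵏ) - (α/2) Δₖ²`,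
* `F(xᵏ⁺¹) ≤ Φₖ + C Δₖ²` and `Φₖ ≤ F(xᵏ)`,
* `dist(0, ∂Φ(zᵏ)) ≤ C Δₖ`.

With `ϖ = lim F(xᵏ)`, which is the value of `Φ` on all cluster points of `zᵏ`
(`Run.IsGenerated.Phi_clusterPt`), the KL inequality gives `(Φₖ - ϖ)₊ ^ q ≤ C Δₖ`, hence
`(F(xᵏ⁺¹) - ϖ) ^ q ≤ C Δₖ` because `2q ≥ 1` (`Run.IsGenerated.exists_kl_recursion`). Together with
the sufficient decrease this is a scalar recursion, from which finite length and both rates follow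
(`rates_of_decrease`).

The constants are uniform in `k` for the following reasons. An upper-`C²` function satisfies the
descent inequality with one constant on a compact set (`exists_descent_constant`). This bounds the
parameters `L` and `μ` along the inner loops, so that all data of the subproblems stay bounded. The
exact solutions satisfy optimality conditions in terms of normal cones by a separation argument
(`exists_subgradient_of_minimizer`), and the partial bounded multiplier property at cluster points
turns these into multipliers `lamᵏ` that are eventually bounded
(`Run.IsGenerated.exists_multipliers`). Strong convexity of the Lagrangian then gives
`‖x̄ᵏ - xᵏ⁺¹‖ ≤ C Δₖ` and the bound of `F(xᵏ⁺¹)` by `Φₖ`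
(`Problem.IsKKT.inexact_estimates`, `Run.IsGenerated.exists_step_estimates`).

The small subgradient of `Φ` at `zᵏ` needs no calculus rule for composite functions: on its domain
`Φ` dominates the Lagrangian `φ + T₀ + ⟪lamᵏ, T⟫`, with equality at `zᵏ` by complementarity, and
the Fenchel–Young inequality bounds the conjugates `hᵢ*` below by affine functions that are exact at
`zᵏ`. The gradient at `zᵏ` of the resulting minorant is a regular subgradient of `Φ` and is linear
in `x̄ᵏ - xᵏ` up to bounded factors (`Decomposition.IsDecompositionOn.mem_regSubdiff_Phi`).
-/

namespace MBA

/-! ### Subgradients -/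

section Subgradients

variable {X : Type*} [NormedAddCommGroup X] [InnerProductSpace ℝ X]

/-- `v` is a subgradient of the real valued function `h` at `a` in the sense of convex analysis. -/
def IsSubgradientAt (h : X → ℝ) (a v : X) : Prop := ∀ z, h a + ⟪v, z - a⟫ ≤ h z

/-- The inequality defining a regular subgradient `v` at `a`, for a real valued function. -/
def HasLowerSlope (h : X → ℝ) (a v : X) : Prop :=
  ∀ ε : ℝ, 0 < ε → ∀ᶠ x in 𝓝 a, h a + (⟪v, x - a⟫ - ε * ‖x - a‖) ≤ h x

theorem regSubdiff_subset_limSubdiff (h : X → EReal) (x : X) :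
    regSubdiff h x ⊆ limSubdiff h x := fun v hv =>
  ⟨hv.1, hv.2.1, fun _ => x, fun _ => v, tendsto_const_nhds, tendsto_const_nhds, fun _ => hv,
    tendsto_const_nhds⟩

theorem hasLowerSlope_of_mem_regSubdiff {h : X → EReal} {r : X → ℝ} {a v : X}
    (hr : ∀ᶠ x in 𝓝 a, h x = r x) (hv : v ∈ regSubdiff h a) : HasLowerSlope r a v := by
  intro ε hε
  filter_upwards [hr, hv.2.2 ε hε] with x hx hx'
  rw [hx, hr.self_of_nhds] at hx'
  exact_mod_cast hx'

/-- An inequality that depends continuously on a point, a subgradient and a value passes from the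
regular to the limiting subdifferential. -/
theorem limSubdiff_le {g : X → EReal} {r : X → ℝ} {x v : X} (hr : ∀ᶠ a in 𝓝 x, g a = r a)
    (hv : v ∈ limSubdiff g x) {Ψ : X × X × ℝ → ℝ} (hΨ : Continuous Ψ) {c : ℝ}
    (h : ∀ᶠ a in 𝓝 x, ∀ w ∈ regSubdiff g a, Ψ (a, w, r a) ≤ c) : Ψ (x, v, r x) ≤ c := by
  obtain ⟨-, -, a, w, ha, hga, hw, hwv⟩ := hv
  have hra : Tendsto (fun l => r (a l)) atTop (𝓝 (r x)) := by
    rw [hr.self_of_nhds] at hga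
    rw [← EReal.tendsto_coe]
    exact hga.congr' (ha.eventually hr)
  have := (hΨ.tendsto (x, v, r x)).comp (ha.prodMk_nhds (hwv.prodMk_nhds hra))
  refine le_of_tendsto this ?_
  filter_upwards [ha.eventually h] with l hl
  exact hl _ (hw l)

theorem exists_ray_of_eventually {p : X → Prop} {a : X} (h : ∀ᶠ x in 𝓝 a, p x) (d : X) :
    ∃ t : ℝ, 0 < t ∧ t < 1 ∧ p (a + t • d) := by
  have h1 : Tendsto (fun t : ℝ => a + t • d) (𝓝[>] 0) (𝓝 a) := by
    have : Tendsto (fun t : ℝ => a + t • d) (𝓝 0) (𝓝 (a + (0 : ℝ) • d)) :=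
      Continuous.tendsto (by fun_prop) 0
    simpa using this.mono_left nhdsWithin_le_nhds
  obtain ⟨t, h2, h3⟩ :=
    ((h1.eventually h).and (Ioo_mem_nhdsGT (zero_lt_one (α := ℝ)))).exists
  exact ⟨t, h3.1, h3.2, h2⟩

theorem HasLowerSlope.isSubgradientAt {h : X → ℝ} (hh : ConvexOn ℝ univ h) {a v : X}
    (hv : HasLowerSlope h a v) : IsSubgradientAt h a v := by
  intro z
  refine le_of_forall_pos_le_add fun ε hε => ?_
  have hn : 0 < ‖z - a‖ + 1 := by positivity
  obtain ⟨t, ht0, ht1, ht⟩ := exists_ray_of_eventually (hv (ε / (‖z - a‖ + 1)) (by positivity))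
    (z - a)
  have h1 := hh.2 (mem_univ a) (mem_univ z) (sub_nonneg.2 ht1.le) ht0.le (by ring)
  have h2 : (1 - t) • a + t • z = a + t • (z - a) := by module
  rw [h2] at h1
  simp only [add_sub_cancel_left, inner_smul_right, norm_smul, Real.norm_eq_abs, abs_of_pos ht0,
    smul_eq_mul] at ht h1
  have h3 : ε / (‖z - a‖ + 1) * ‖z - a‖ ≤ ε := by
    rw [div_mul_eq_mul_div, div_le_iff₀ hn]
    nlinarith
  have h4 : t * (h a + ⟪v, z - a⟫) ≤ t * (h z + ε) := by nlinarith
  exact le_of_mul_le_mul_left h4 ht0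

theorem isSubgradientAt_of_mem_limSubdiff {h : X → ℝ} (hh : ConvexOn ℝ univ h) {a v : X}
    (hv : v ∈ limSubdiff (fun x => (h x : EReal)) a) : IsSubgradientAt h a v := by
  intro z
  refine limSubdiff_le (r := h) (Ψ := fun q => q.2.2 + ⟪q.2.1, z - q.1⟫)
    (Eventually.of_forall fun _ => rfl) hv (by fun_prop) (Eventually.of_forall fun b w hw => ?_)
  exact (hasLowerSlope_of_mem_regSubdiff (Eventually.of_forall fun _ => rfl) hw).isSubgradientAt
    hh z

/-- The Euler inequality for the sum of a smooth and a convex function, with the smooth part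
replaced by its linearization. -/
theorem le_add_inner_of_isMinOn {f φ : X → ℝ} {C : Set X} {x a : X} (hφ : ConvexOn ℝ univ φ)
    (hC : Convex ℝ C) (hx : x ∈ C) {c : ℝ}
    (hf : ∀ d, f (x + d) ≤ f x + ⟪a, d⟫ + c * ‖d‖ ^ 2)
    (hmin : ∀ z ∈ C, f x + φ x ≤ f z + φ z) (z : X) (hz : z ∈ C) :
    φ x ≤ φ z + ⟪a, z - x⟫ := by
  refine le_of_forall_pos_le_add fun ε hε => ?_
  have hε' : ∀ᶠ t : ℝ in 𝓝 0, t * (c * ‖z - x‖ ^ 2) < ε := by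
    have : Tendsto (fun t : ℝ => t * (c * ‖z - x‖ ^ 2)) (𝓝 0) (𝓝 (0 * (c * ‖z - x‖ ^ 2))) :=
      Continuous.tendsto (by fun_prop) 0
    rw [zero_mul] at this
    exact this.eventually (gt_mem_nhds hε)
  obtain ⟨t, ht0, ht1, ht⟩ := exists_ray_of_eventually hε' (1 : ℝ)
  simp only [smul_eq_mul, mul_one, zero_add] at ht
  have h2 : (1 - t) • x + t • z = x + t • (z - x) := by module
  have h1 := hφ.2 (mem_univ x) (mem_univ z) (sub_nonneg.2 ht1.le) ht0.le (by ring)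
  have h3 := hmin _ (hC hx hz (sub_nonneg.2 ht1.le) ht0.le (by ring))
  have h4 := hf (t • (z - x))
  rw [h2] at h1 h3
  simp only [inner_smul_right, norm_smul, Real.norm_eq_abs, abs_of_pos ht0, smul_eq_mul,
    mul_pow] at h1 h4
  have h5 : t * φ x ≤ t * (φ z + ⟪a, z - x⟫ + ε) := by nlinarith
  exact le_of_mul_le_mul_left h5 ht0

end Subgradients

section FiniteDimensional

variable {n : ℕ}

theorem continuous_of_convexOn {h : Vec n → ℝ} (hh : ConvexOn ℝ univ h) : Continuous h :=
  hh.locallyLipschitz.continuous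

/-- Sum rule for a finite convex function and the indicator function of a convex set, at a
minimizer; a consequence of the separation theorem. -/
theorem exists_subgradient_of_minimizer {φ : Vec n → ℝ} (hφ : ConvexOn ℝ univ φ)
    {C : Set (Vec n)} (hC : Convex ℝ C) {x a : Vec n} (hx : x ∈ C)
    (hmin : ∀ z ∈ C, φ x ≤ φ z + ⟪a, z - x⟫) :
    ∃ v, IsSubgradientAt φ x v ∧ ∀ z ∈ C, 0 ≤ ⟪a + v, z - x⟫ := by
  have hc : Continuous φ := continuous_of_convexOn hφ
  let s : Set (Vec n × ℝ) := {y | φ y.1 < y.2}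
  let t : Set (Vec n × ℝ) := {y | y.1 ∈ C ∧ y.2 ≤ φ x - ⟪a, y.1 - x⟫}
  have hs : Convex ℝ s := by
    simpa [s] using hφ.convex_strict_epigraph
  have hs' : IsOpen s := isOpen_lt (hc.comp continuous_fst) continuous_snd
  have ht : Convex ℝ t := by
    intro y hy z hz b c hb hc hbc
    refine ⟨hC hy.1 hz.1 hb hc hbc, ?_⟩
    have e : b • y.1 + c • z.1 - x = b • (y.1 - x) + c • (z.1 - x) := by
      rw [smul_sub, smul_sub, sub_add_sub_comm, ← add_smul, hbc, one_smul]
    have h1 := mul_le_mul_of_nonneg_left hy.2 hb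
    have h2 := mul_le_mul_of_nonneg_left hz.2 hc
    simp only [Prod.snd_add, Prod.smul_snd, Prod.fst_add, Prod.smul_fst, smul_eq_mul, e,
      inner_add_right, inner_smul_right]
    have h3 : φ x = b * φ x + c * φ x := by rw [← add_mul, hbc, one_mul]
    linarith
  have hd : Disjoint s t := by
    rw [Set.disjoint_left]
    intro y hy hy'
    have h1 := hmin _ hy'.1
    have h2 := hy'.2
    have h3 : φ y.1 < y.2 := hy
    linarith
  obtain ⟨f, u, hfs, hft⟩ := geometric_hahn_banach_open hs hs' ht hd
  set f1 : Vec n →L[ℝ] ℝ := f.comp (ContinuousLinearMap.inl ℝ (Vec n) ℝ) with hf1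
  set c : ℝ := f (0, 1) with hcdef
  have hf : ∀ y r, f (y, r) = f1 y + c * r := by
    intro y r
    have : ((y, r) : Vec n × ℝ) = (y, 0) + r • (0, 1) := by simp
    rw [this, map_add, map_smul, hf1, smul_eq_mul, mul_comm]
    simp [hcdef]
  have hux : u ≤ f1 x + c * φ x := by
    rw [← hf]
    exact hft _ ⟨hx, by simp⟩
  have hc0 : c < 0 := by
    have := hfs (x, φ x + 1) (by simp [s])
    rw [hf] at this
    nlinarith
  have hle : ∀ y, f1 y + c * φ y ≤ u := by
    intro y
    refine le_of_forall_pos_le_add fun ε hε => ?_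
    have := hfs (y, φ y + ε / (-c)) (by
      have : 0 < ε / (-c) := div_pos hε (by linarith)
      simpa [s] using this)
    rw [hf, mul_add] at this
    have e : c * (ε / (-c)) = -ε := by
      rw [div_neg, mul_neg, mul_div_cancel₀ _ hc0.ne]
    linarith
  have hueq : u = f1 x + c * φ x := le_antisymm hux (hle x)
  let v : Vec n := (InnerProductSpace.toDual ℝ (Vec n)).symm ((-c)⁻¹ • f1)
  have hv : ∀ y, ⟪v, y⟫ = (-c)⁻¹ * f1 y := fun y => by
    simp only [v, InnerProductSpace.toDual_symm_apply, _root_.smul_apply, smul_eq_mul]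
  have hcpos : 0 < (-c)⁻¹ := inv_pos.2 (by linarith)
  have hcc : (-c)⁻¹ * c = -1 := by
    have : c ≠ 0 := hc0.ne
    field_simp
  refine ⟨v, fun z => ?_, fun z hz => ?_⟩
  · rw [hv, map_sub]
    have := mul_le_mul_of_nonneg_left (hle z) hcpos.le
    rw [hueq] at this
    have e1 : (-c)⁻¹ * (f1 z + c * φ z) = (-c)⁻¹ * f1 z - φ z := by
      linear_combination φ z * hcc
    have e2 : (-c)⁻¹ * (f1 x + c * φ x) = (-c)⁻¹ * f1 x - φ x := by
      linear_combination φ x * hcc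
    linarith
  · have h1 := hft (z, φ x - ⟪a, z - x⟫) ⟨hz, le_rfl⟩
    rw [hueq, hf] at h1
    rw [inner_add_left, hv, map_sub]
    have := mul_le_mul_of_nonneg_left h1 hcpos.le
    have e1 : (-c)⁻¹ * (f1 z + c * (φ x - ⟪a, z - x⟫)) =
        (-c)⁻¹ * f1 z - (φ x - ⟪a, z - x⟫) := by
      linear_combination (φ x - ⟪a, z - x⟫) * hcc
    have e2 : (-c)⁻¹ * (f1 x + c * φ x) = (-c)⁻¹ * f1 x - φ x := by
      linear_combination φ x * hcc
    linarith

theorem exists_isSubgradientAt {φ : Vec n → ℝ} (hφ : ConvexOn ℝ univ φ) (x : Vec n) :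
    ∃ v, IsSubgradientAt φ x v := by
  obtain ⟨v, hv, -⟩ := exists_subgradient_of_minimizer hφ (convex_singleton x) (a := 0)
    (mem_singleton x) (by simp)
  exact ⟨v, hv⟩

/-- Subgradients of a finite convex function are bounded on bounded sets. -/
theorem exists_bound_isSubgradientAt {φ : Vec n → ℝ} (hφ : ConvexOn ℝ univ φ) (B : ℝ) :
    ∃ C : ℝ, 0 ≤ C ∧ ∀ x v, ‖x‖ ≤ B → IsSubgradientAt φ x v → ‖v‖ ≤ C := by
  have hc : Continuous φ := continuous_of_convexOn hφ
  obtain ⟨C, hC⟩ := (isCompact_closedBall (0 : Vec n) (B + 1)).exists_bound_of_continuousOn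
    hc.continuousOn
  refine ⟨max (2 * C) 0, le_max_right _ _, fun x v hx hv => ?_⟩
  by_cases hv0 : v = 0
  · simp [hv0]
  have hvn : 0 < ‖v‖ := norm_pos_iff.2 hv0
  have h1 := hv (x + ‖v‖⁻¹ • v)
  have hu : ‖‖v‖⁻¹ • v‖ = 1 := by
    rw [norm_smul, norm_inv, norm_norm, inv_mul_cancel₀ hvn.ne']
  have h2 : ‖x + ‖v‖⁻¹ • v‖ ≤ B + 1 := (norm_add_le _ _).trans (by rw [hu]; linarith)
  have h3 := hC x (by simp; linarith)
  have h4 := hC (x + ‖v‖⁻¹ • v) (by simpa using h2)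
  rw [add_sub_cancel_left, inner_smul_right, real_inner_self_eq_norm_sq] at h1
  have h5 : ‖v‖⁻¹ * ‖v‖ ^ 2 = ‖v‖ := by field_simp
  rw [h5] at h1
  have h6 := (abs_le.1 h3).1
  have h7 := (abs_le.1 h4).2
  exact le_max_of_le_left (by linarith)

theorem bddAbove_conj {h : Vec n → ℝ} {σ : ℝ} (hσ : 0 < σ) (hh : StrongConvexOn univ σ h)
    (s : Vec n) : BddAbove (range fun x : Vec n => ⟪x, s⟫ - h x) := by
  rw [strongConvexOn_iff_convex] at hh
  obtain ⟨v, hv⟩ := exists_isSubgradientAt hh 0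
  refine ⟨‖s - v‖ ^ 2 / (2 * σ) - h 0, ?_⟩
  rintro _ ⟨x, rfl⟩
  have h1 := hv x
  have h2 : ⟪x, s⟫ - ⟪v, x⟫ ≤ ‖x‖ * ‖s - v‖ := by
    rw [real_inner_comm x v, ← inner_sub_right]
    exact real_inner_le_norm x (s - v)
  simp only [norm_zero, sub_zero] at h1
  have h3 : ‖x‖ * ‖s - v‖ - σ / 2 * ‖x‖ ^ 2 ≤ ‖s - v‖ ^ 2 / (2 * σ) := by
    rw [le_div_iff₀ (by positivity)]
    nlinarith [sq_nonneg (σ * ‖x‖ - ‖s - v‖)]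
  simp only
  nlinarith

/-- The Fenchel–Young inequality. -/
theorem inner_sub_le_conj {h : Vec n → ℝ} {σ : ℝ} (hσ : 0 < σ) (hh : StrongConvexOn univ σ h)
    (x s : Vec n) : ⟪x, s⟫ - h x ≤ conj h s :=
  le_ciSup (bddAbove_conj hσ hh s) x

/-- Equality in the Fenchel–Young inequality at subgradients. -/
theorem conj_eq_of_isSubgradientAt {h : Vec n → ℝ} {x s : Vec n} (hs : IsSubgradientAt h x s) :
    conj h s = ⟪x, s⟫ - h x := by
  refine IsLUB.ciSup_eq (IsGreatest.isLUB ⟨⟨x, rfl⟩, ?_⟩)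
  rintro _ ⟨z, rfl⟩
  have := hs z
  rw [inner_sub_right] at this
  simp only [real_inner_comm s] at *
  linarith

end FiniteDimensional

/-! ### Upper-`C²` functions -/

section UpperC2

variable {n : ℕ}

/-- A function that lies below a quadratic with curvature `ρ` touching it at `a` has at most one
regular subgradient at `a`, the gradient of the quadratic. -/
theorem eq_of_quadratic_majorant {r : Vec n → ℝ} {a w p : Vec n} {ρ : ℝ}
    (hw : HasLowerSlope r a w)
    (hr : ∀ᶠ z in 𝓝 a, r z ≤ r a + ⟪p, z - a⟫ + ρ / 2 * ‖z - a‖ ^ 2) : w = p := by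
  rw [← sub_eq_zero, ← norm_eq_zero]
  set d := w - p with hd
  by_contra hne
  have hpos : 0 < ‖d‖ := lt_of_le_of_ne (norm_nonneg _) (Ne.symm hne)
  have hsmall : ∀ᶠ z in 𝓝 a, ρ / 2 * ‖z - a‖ < ‖d‖ / 2 := by
    have : Tendsto (fun z : Vec n => ρ / 2 * ‖z - a‖) (𝓝 a) (𝓝 (ρ / 2 * ‖a - a‖)) :=
      Continuous.tendsto (by fun_prop) a
    rw [sub_self, norm_zero, mul_zero] at this
    exact this.eventually (gt_mem_nhds (by positivity))
  obtain ⟨t, ht0, -, ⟨h1, h2⟩, h3⟩ := exists_ray_of_eventually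
    (((hw (‖d‖ / 2) (by positivity)).and hr).and hsmall) d
  simp only [add_sub_cancel_left, inner_smul_right, norm_smul, Real.norm_eq_abs,
    abs_of_pos ht0] at h1 h2 h3
  have h4 : ⟪w, d⟫ - ⟪p, d⟫ = ‖d‖ ^ 2 := by
    rw [← inner_sub_left, ← hd, real_inner_self_eq_norm_sq]
  have h5 : t * ‖d‖ * (ρ / 2 * (t * ‖d‖)) < t * ‖d‖ * (‖d‖ / 2) :=
    mul_lt_mul_of_pos_left h3 (by positivity)
  have h6 : t * (⟪w, d⟫ - ⟪p, d⟫) = t * ‖d‖ ^ 2 := by rw [h4]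
  nlinarith

/-- Near a point of upper-`C²` regularity the limiting subgradients are bounded and satisfy the
descent inequality. -/
theorem UpperC2At.exists_ball {h : Vec n → EReal} {x : Vec n} (hx : UpperC2At h x) :
    ∃ ρ B δ : ℝ, 0 ≤ ρ ∧ 0 < δ ∧ ∀ a ∈ Metric.ball x δ, ∀ v ∈ limSubdiff h a, ‖v‖ ≤ B ∧
      ∀ z ∈ Metric.ball x δ,
        (h z).toReal ≤ (h a).toReal + ⟪v, z - a⟫ + ρ / 2 * ‖z - a‖ ^ 2 := by
  obtain ⟨ρ, hρ, δ, hδ, N, Δ, b, c, hΔ, hb, -, hmin⟩ := hx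
  obtain ⟨B, hB⟩ := hΔ.exists_bound_of_continuousOn hb
  have hreal : ∀ a ∈ Metric.ball x δ, h a = ((h a).toReal : EReal) := fun a ha => by
    obtain ⟨r, hr, -⟩ := hmin a ha
    rw [hr, EReal.toReal_coe]
  have hleast : ∀ a ∈ Metric.ball x δ,
      IsLeast ((fun s => ρ / 2 * ‖a‖ ^ 2 - ⟪b s, a⟫ - c s) '' Δ) (h a).toReal := fun a ha => by
    obtain ⟨r, hr, hr'⟩ := hmin a ha
    rwa [hr, EReal.toReal_coe]
  have hnhds : ∀ a ∈ Metric.ball x δ, Metric.ball x δ ∈ 𝓝 a := fun a ha =>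
    Metric.isOpen_ball.mem_nhds ha
  -- A quadratic of the family that is active at `a` majorizes `h`, so its gradient is the only
  -- regular subgradient at `a`.
  have key : ∀ a ∈ Metric.ball x δ, ∀ w ∈ regSubdiff h a, ‖w‖ ≤ ρ * (‖x‖ + δ) + B ∧
      ∀ z ∈ Metric.ball x δ,
        (h z).toReal ≤ (h a).toReal + ⟪w, z - a⟫ + ρ / 2 * ‖z - a‖ ^ 2 := by
    intro a ha w hw
    obtain ⟨s, hs, hsa⟩ := (hleast a ha).1
    have hmaj : ∀ z ∈ Metric.ball x δ,
        (h z).toReal ≤ (h a).toReal + ⟪ρ • a - b s, z - a⟫ + ρ / 2 * ‖z - a‖ ^ 2 := by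
      intro z hz
      refine ((hleast z hz).2 ⟨s, hs, rfl⟩).trans (le_of_eq ?_)
      rw [← hsa, norm_sub_sq_real, inner_sub_left, inner_sub_right, inner_sub_right,
        inner_smul_left, inner_smul_left, real_inner_self_eq_norm_sq, real_inner_comm z a]
      simp only [conj_trivial]
      ring
    have hwe : w = ρ • a - b s := eq_of_quadratic_majorant
      (hasLowerSlope_of_mem_regSubdiff (eventually_of_mem (hnhds a ha) hreal) hw)
      (eventually_of_mem (hnhds a ha) hmaj)
    refine ⟨?_, hwe ▸ hmaj⟩
    rw [hwe]
    have h1 : ‖a‖ ≤ ‖x‖ + δ := by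
      have h2 : ‖a - x‖ < δ := by simpa [dist_eq_norm] using ha
      have h3 := norm_add_le x (a - x)
      rw [add_sub_cancel] at h3
      linarith
    calc ‖ρ • a - b s‖ ≤ ‖ρ • a‖ + ‖b s‖ := norm_sub_le _ _
      _ ≤ ρ * (‖x‖ + δ) + B := by
        rw [norm_smul, Real.norm_of_nonneg hρ]
        exact add_le_add (mul_le_mul_of_nonneg_left h1 hρ) (hB s hs)
  refine ⟨ρ, ρ * (‖x‖ + δ) + B, δ, hρ, hδ, fun a ha v hv => ⟨?_, fun z hz => ?_⟩⟩
  · exact limSubdiff_le (r := fun y => (h y).toReal) (eventually_of_mem (hnhds a ha) hreal) hv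
      (Ψ := fun q => ‖q.2.1‖) (by fun_prop)
      (eventually_of_mem (hnhds a ha) fun a' ha' w hw => (key a' ha' w hw).1)
  · have := limSubdiff_le (r := fun y => (h y).toReal) (eventually_of_mem (hnhds a ha) hreal) hv
      (Ψ := fun q => -(q.2.2 + ⟪q.2.1, z - q.1⟫ + ρ / 2 * ‖z - q.1‖ ^ 2)) (c := -(h z).toReal)
      (by fun_prop)
      (eventually_of_mem (hnhds a ha) fun a' ha' w hw => neg_le_neg ((key a' ha' w hw).2 z hz))
    exact neg_le_neg_iff.1 this

theorem exists_bound_limSubdiff {h : Vec n → EReal} {K : Set (Vec n)} (hK : IsCompact K)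
    (hh : ∀ x ∈ K, UpperC2At h x) :
    ∃ B : ℝ, 0 ≤ B ∧ ∀ a ∈ K, ∀ v ∈ limSubdiff h a, ‖v‖ ≤ B := by
  refine hK.induction_on (p := fun s => ∃ B : ℝ, 0 ≤ B ∧ ∀ a ∈ s, ∀ v ∈ limSubdiff h a, ‖v‖ ≤ B)
    ⟨0, le_rfl, by simp⟩ ?_ ?_ ?_
  · rintro s t hst ⟨B, hB, H⟩
    exact ⟨B, hB, fun a ha => H a (hst ha)⟩
  · rintro s t ⟨B, hB, H⟩ ⟨B', hB', H'⟩
    refine ⟨max B B', le_max_of_le_left hB, ?_⟩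
    rintro a (ha | ha) v hv
    · exact le_max_of_le_left (H a ha v hv)
    · exact le_max_of_le_right (H' a ha v hv)
  · intro x hx
    obtain ⟨ρ, B, δ, -, hδ, H⟩ := (hh x hx).exists_ball
    exact ⟨Metric.ball x δ, mem_nhdsWithin_of_mem_nhds (Metric.ball_mem_nhds x hδ), max B 0,
      le_max_right _ _, fun a ha v hv => le_max_of_le_left (H a ha v hv).1⟩

/-- The descent inequality holds with one constant for all pairs of points of a compact set, which
need not be convex: pairs of distant points are covered by boundedness. -/
theorem exists_descent_constant {h : Vec n → EReal} {K : Set (Vec n)} (hK : IsCompact K)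
    (hh : ∀ x ∈ K, UpperC2At h x) (hcont : ContinuousOn (fun x => (h x).toReal) K) :
    ∃ ρ : ℝ, 0 ≤ ρ ∧ ∀ a ∈ K, ∀ z ∈ K, ∀ v ∈ limSubdiff h a,
      (h z).toReal ≤ (h a).toReal + ⟪v, z - a⟫ + ρ / 2 * ‖z - a‖ ^ 2 := by
  obtain ⟨B, hB, hBv⟩ := exists_bound_limSubdiff hK hh
  obtain ⟨C, hC⟩ := hK.exists_bound_of_continuousOn hcont
  obtain ⟨E, hE⟩ := hK.isBounded.exists_norm_le
  refine hK.induction_on (p := fun s => ∃ ρ : ℝ, 0 ≤ ρ ∧ ∀ a ∈ s, ∀ z ∈ K,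
    ∀ v ∈ limSubdiff h a, (h z).toReal ≤ (h a).toReal + ⟪v, z - a⟫ + ρ / 2 * ‖z - a‖ ^ 2)
    ⟨0, le_rfl, by simp⟩ ?_ ?_ ?_
  · rintro s t hst ⟨ρ, hρ, H⟩
    exact ⟨ρ, hρ, fun a ha => H a (hst ha)⟩
  · rintro s t ⟨ρ, hρ, H⟩ ⟨ρ', hρ', H'⟩
    refine ⟨max ρ ρ', le_max_of_le_left hρ, ?_⟩
    rintro a (ha | ha) z hz v hv
    · refine (H a ha z hz v hv).trans ?_
      gcongr
      exact le_max_left _ _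
    · refine (H' a ha z hz v hv).trans ?_
      gcongr
      exact le_max_right _ _
  · intro x hx
    obtain ⟨ρ, _, δ, hρ, hδ, H⟩ := (hh x hx).exists_ball
    have hC0 : 0 ≤ C := (norm_nonneg _).trans (hC x hx)
    have hE0 : 0 ≤ E := (norm_nonneg _).trans (hE x hx)
    set A := 2 * C + B * (2 * E) with hA
    have hA0 : 0 ≤ A := by positivity
    refine ⟨Metric.ball x (δ / 2) ∩ K, inter_mem
      (mem_nhdsWithin_of_mem_nhds (Metric.ball_mem_nhds x (by positivity))) self_mem_nhdsWithin,
      max ρ (8 * A / δ ^ 2), le_max_of_le_left hρ, ?_⟩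
    rintro a ⟨ha, haK⟩ z hz v hv
    by_cases hzx : z ∈ Metric.ball x δ
    · refine ((H a (Metric.ball_subset_ball (by linarith) ha) v hv).2 z hzx).trans ?_
      gcongr
      exact le_max_left _ _
    · have hfar : δ / 2 ≤ ‖z - a‖ := by
        rw [← dist_eq_norm]
        have h1 : dist a x < δ / 2 := ha
        have h2 : δ ≤ dist z x := not_lt.1 hzx
        linarith [dist_triangle z a x]
      have h1 := (abs_le.1 (hC z hz)).2
      have h2 := (abs_le.1 (hC a haK)).1
      have h3 : -(B * (2 * E)) ≤ ⟪v, z - a⟫ := by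
        have h4 := (abs_le.1 (abs_real_inner_le_norm v (z - a))).1
        have h5 : ‖v‖ * ‖z - a‖ ≤ B * (2 * E) := by
          refine mul_le_mul (hBv a haK v hv) ?_ (norm_nonneg _) hB
          linarith [norm_sub_le z a, hE z hz, hE a haK]
        linarith
      have h6 : A ≤ max ρ (8 * A / δ ^ 2) / 2 * ‖z - a‖ ^ 2 := by
        have h7 : A = (8 * A / δ ^ 2) / 2 * (δ / 2) ^ 2 := by
          field_simp
          ring
        calc A = (8 * A / δ ^ 2) / 2 * (δ / 2) ^ 2 := h7
          _ ≤ max ρ (8 * A / δ ^ 2) / 2 * ‖z - a‖ ^ 2 := by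
            gcongr
            exact le_max_right _ _
      linarith

end UpperC2

/-! ### Differences of a quadratic and a convex function -/

section DC

variable {n : ℕ}

theorem IsStronglyConvexQuadratic.exists_expansion {f : Vec n → ℝ}
    (hf : IsStronglyConvexQuadratic f) :
    ∃ A : Vec n →L[ℝ] Vec n, Continuous (gradient f) ∧ ∀ s z,
      f z = f s + ⟪gradient f s, z - s⟫ + 1 / 2 * ⟪z - s, A (z - s)⟫ := by
  obtain ⟨⟨A, b, c, hA⟩, -⟩ := hf
  set G : Vec n → Vec n := fun s => (1 / 2 : ℝ) • (A s + ContinuousLinearMap.adjoint A s) + b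
    with hG
  have hexp : ∀ s z, f z = f s + ⟪G s, z - s⟫ + 1 / 2 * ⟪z - s, A (z - s)⟫ := by
    intro s z
    simp only [hA, hG, inner_add_left, inner_smul_left, ContinuousLinearMap.adjoint_inner_left,
      map_sub, inner_sub_left, inner_sub_right, conj_trivial]
    rw [real_inner_comm z (A s), real_inner_comm s (A s)]
    ring
  have hgrad : ∀ s, HasGradientAt f (G s) s := by
    intro s
    rw [hasGradientAt_iff_isLittleO]
    have h1 : (fun z => f z - f s - ⟪G s, z - s⟫) =O[𝓝 s] fun z => ‖z - s‖ ^ 2 := by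
      refine Asymptotics.IsBigO.of_bound ‖A‖ (Eventually.of_forall fun z => ?_)
      have h2 : f z - f s - ⟪G s, z - s⟫ = 1 / 2 * ⟪z - s, A (z - s)⟫ := by rw [hexp s z]; ring
      rw [h2, norm_mul, Real.norm_of_nonneg (by positivity : (0 : ℝ) ≤ ‖z - s‖ ^ 2)]
      have h3 := norm_inner_le_norm (𝕜 := ℝ) (z - s) (A (z - s))
      have h4 := A.le_opNorm (z - s)
      have h5 : ‖z - s‖ * ‖A (z - s)‖ ≤ ‖A‖ * ‖z - s‖ ^ 2 := by
        nlinarith [norm_nonneg (z - s)]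
      have h6 : ‖(1 / 2 : ℝ)‖ = 1 / 2 := by norm_num
      rw [h6]
      nlinarith [norm_nonneg (inner ℝ (z - s) (A (z - s)))]
    refine h1.trans_isLittleO ?_
    have := (Asymptotics.isLittleO_pow_id (𝕜 := ℝ) (n := 2) (by norm_num)).comp_tendsto
      (show Tendsto (fun z : Vec n => ‖z - s‖) (𝓝 s) (𝓝 0) by
        have : Tendsto (fun z : Vec n => ‖z - s‖) (𝓝 s) (𝓝 ‖s - s‖) :=
          Continuous.tendsto (by fun_prop) s
        simpa using this)
    simpa [Function.comp_def] using this.norm_right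
  have hge : gradient f = G := funext fun s => (hgrad s).gradient
  refine ⟨A, ?_, ?_⟩
  · rw [hge]
    fun_prop
  · rw [hge]
    exact hexp

/-- At a point near which `g = f - h` with `f` quadratic and `h` convex, every limiting subgradient
`v` of `g` gives the subgradient `∇f - v` of `h`. -/
theorem isSubgradientAt_sub_of_mem_limSubdiff {g : Vec n → EReal} {f h : Vec n → ℝ}
    {D : Set (Vec n)} {x v : Vec n} (hf : IsStronglyConvexQuadratic f) (hh : ConvexOn ℝ univ h)
    (hg : ∀ y ∈ D, g y = ((f y - h y : ℝ) : EReal)) (hx : x ∈ interior D)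
    (hv : v ∈ limSubdiff g x) : IsSubgradientAt h x (gradient f x - v) := by
  obtain ⟨A, hcont, hexp⟩ := hf.exists_expansion
  have hfc : Continuous f := by
    have : f = fun z => f 0 + ⟪gradient f 0, z - 0⟫ + 1 / 2 * ⟪z - 0, A (z - 0)⟫ :=
      funext fun z => hexp 0 z
    rw [this]
    fun_prop
  have hnhds : ∀ a ∈ interior D, ∀ᶠ y in 𝓝 a, g y = ((f y - h y : ℝ) : EReal) := fun a ha =>
    eventually_of_mem (mem_interior_iff_mem_nhds.1 ha) hg
  have key : ∀ a ∈ interior D, ∀ w ∈ regSubdiff g a, HasLowerSlope h a (gradient f a - w) := by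
    intro a ha w hw ε hε
    have h1 := hasLowerSlope_of_mem_regSubdiff (hnhds a ha) hw (ε / 2) (by positivity)
    have hsmall : ∀ᶠ y in 𝓝 a, 1 / 2 * ‖A‖ * ‖y - a‖ < ε / 2 := by
      have : Tendsto (fun z : Vec n => 1 / 2 * ‖A‖ * ‖z - a‖) (𝓝 a)
          (𝓝 (1 / 2 * ‖A‖ * ‖a - a‖)) := Continuous.tendsto (by fun_prop) a
      rw [sub_self, norm_zero, mul_zero] at this
      exact this.eventually (gt_mem_nhds (by positivity))
    have hrefl : Tendsto (fun y : Vec n => a + (a - y)) (𝓝 a) (𝓝 a) := by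
      have : Tendsto (fun y : Vec n => a + (a - y)) (𝓝 a) (𝓝 (a + (a - a))) :=
        Continuous.tendsto (by fun_prop) a
      simpa using this
    -- The upper bound for `h` at the reflected point is a lower bound for `h` by convexity.
    filter_upwards [hrefl.eventually (h1.and hsmall)] with y hy
    obtain ⟨hy1, hy2⟩ := hy
    rw [add_sub_cancel_left] at hy1 hy2
    have h2 := hexp a (a + (a - y))
    rw [add_sub_cancel_left] at h2
    have h3 : ⟪a - y, A (a - y)⟫ ≤ ‖A‖ * ‖a - y‖ * ‖a - y‖ := by
      have h4 := real_inner_le_norm (a - y) (A (a - y))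
      have h5 := A.le_opNorm (a - y)
      nlinarith [norm_nonneg (a - y)]
    have h6 := hh.2 (mem_univ y) (mem_univ (a + (a - y))) (by norm_num : (0 : ℝ) ≤ 1 / 2)
      (by norm_num : (0 : ℝ) ≤ 1 / 2) (by norm_num)
    have h7 : (1 / 2 : ℝ) • y + (1 / 2 : ℝ) • (a + (a - y)) = a := by module
    rw [h7] at h6
    simp only [smul_eq_mul] at h6
    have h8 : ⟪gradient f a - w, y - a⟫ = ⟪w, a - y⟫ - ⟪gradient f a, a - y⟫ := by
      rw [← neg_sub a y, inner_neg_right, inner_sub_left]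
      ring
    rw [h8, norm_sub_rev y a]
    nlinarith [norm_nonneg (a - y)]
  intro z
  have := limSubdiff_le (r := fun y => f y - h y) (hnhds x hx) hv
    (Ψ := fun q => (f q.1 - q.2.2) + ⟪gradient f q.1 - q.2.1, z - q.1⟫) (c := h z)
    (by fun_prop)
    (eventually_of_mem (isOpen_interior.mem_nhds hx) fun a ha w hw => by
      simpa using (key a ha w hw).isSubgradientAt hh z)
  simpa using this

end DC

/-! ### Convergence rates of scalar recursions -/

section Rates

/-- A bound with a constant that holds eventually near each cluster point of a sequence in a compact
set holds eventually with one constant. -/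
theorem exists_eventually_of_mapClusterPt {Z : Type*} [TopologicalSpace Z] {z : ℕ → Z} {K : Set Z}
    (hK : IsCompact K) (hz : ∀ k, z k ∈ K) {p : ℝ → ℕ → Prop}
    (hp : ∀ C C' k, C ≤ C' → p C k → p C' k)
    (h : ∀ a, MapClusterPt a atTop z → ∃ C, ∃ U ∈ 𝓝 a, ∀ᶠ k in atTop, z k ∈ U → p C k) :
    ∃ C, ∀ᶠ k in atTop, p C k := by
  have : ∃ C, ∀ᶠ k in atTop, z k ∈ K → p C k := by
    refine hK.induction_on (p := fun s => ∃ C, ∀ᶠ k in atTop, z k ∈ s → p C k)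
      ⟨0, by simp⟩ ?_ ?_ ?_
    · rintro s t hst ⟨C, hC⟩
      exact ⟨C, hC.mono fun k hk hks => hk (hst hks)⟩
    · rintro s t ⟨C, hC⟩ ⟨C', hC'⟩
      refine ⟨max C C', ?_⟩
      filter_upwards [hC, hC'] with k hk hk'
      rintro (hks | hkt)
      · exact hp _ _ _ (le_max_left _ _) (hk hks)
      · exact hp _ _ _ (le_max_right _ _) (hk' hkt)
    · intro x _
      by_cases hx : MapClusterPt x atTop z
      · obtain ⟨C, U, hU, hC⟩ := h x hx
        exact ⟨U, mem_nhdsWithin_of_mem_nhds hU, C, hC⟩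
      · rw [mapClusterPt_iff_frequently] at hx
        push Not at hx
        obtain ⟨U, hU, hUk⟩ := hx
        exact ⟨U, mem_nhdsWithin_of_mem_nhds hU, 0, hUk.mono fun k hk hkU => absurd hkU hk⟩
  obtain ⟨C, hC⟩ := this
  exact ⟨C, hC.mono fun k hk => hk (hz k)⟩

/-- A sequence whose steps are dominated by the decrease of a nonnegative sequence converges. -/
theorem exists_tendsto_of_step_le {X : Type*} [NormedAddCommGroup X] [CompleteSpace X]
    {x : ℕ → X} {E : ℕ → ℝ} {N : ℕ} (hE : ∀ k, 0 ≤ E k)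
    (h : ∀ k, N ≤ k → ‖x (k + 2) - x (k + 1)‖ + E (k + 1) ≤ E k) :
    ∃ xs, Tendsto x atTop (𝓝 xs) ∧ ∀ k, N ≤ k → ‖x (k + 1) - xs‖ ≤ E k := by
  have hsum : ∀ k, N ≤ k → ∀ l, ‖x (k + 1) - x (k + l + 1)‖ + E (k + l) ≤ E k := by
    intro k hk l
    induction l with
    | zero => simp
    | succ l ih =>
      have h1 := h (k + l) (by omega)
      have h2 : ‖x (k + 1) - x (k + (l + 1) + 1)‖ ≤
          ‖x (k + 1) - x (k + l + 1)‖ + ‖x (k + l + 2) - x (k + l + 1)‖ := by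
        rw [norm_sub_rev (x (k + l + 2))]
        exact norm_sub_le_norm_sub_add_norm_sub _ _ _
      have h3 : k + (l + 1) = k + l + 1 := by ring
      rw [h3] at h2 ⊢
      linarith
  have hsumm : Summable fun l => dist (x (N + l + 1)) (x (N + (l + 1) + 1)) := by
    refine summable_of_sum_range_le (c := E N) (fun _ => dist_nonneg) fun K => ?_
    have : ∑ l ∈ Finset.range K, dist (x (N + l + 1)) (x (N + (l + 1) + 1)) + E (N + K)
        ≤ E N := by
      induction K with
      | zero => simp
      | succ K ih =>
        rw [Finset.sum_range_succ, dist_eq_norm, norm_sub_rev]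
        have h1 := h (N + K) (by omega)
        have h3 : N + (K + 1) = N + K + 1 := by ring
        rw [h3]
        linarith
    linarith [hE (N + K)]
  obtain ⟨xs, hxs⟩ := cauchySeq_tendsto_of_complete (cauchySeq_of_summable_dist hsumm)
  have hx : Tendsto x atTop (𝓝 xs) := by
    rw [← tendsto_add_atTop_iff_nat (N + 1)]
    refine hxs.congr fun l => ?_
    congr 1
    ring
  refine ⟨xs, hx, fun k hk => ?_⟩
  have h1 : Tendsto (fun l => ‖x (k + 1) - x (l + (k + 1))‖) atTop (𝓝 ‖x (k + 1) - xs‖) :=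
    (tendsto_const_nhds.sub ((tendsto_add_atTop_iff_nat (k + 1)).2 hx)).norm
  refine le_of_tendsto' h1 fun l => ?_
  have h2 := hsum k hk l
  have h3 : l + (k + 1) = k + l + 1 := by ring
  rw [h3]
  linarith [hE (k + l)]

/-- Concavity of `t ↦ t ^ (1 - q)`, cleared of denominators. -/
theorem rpow_one_sub_gap {q u b : ℝ} (hq0 : 0 < q) (hq1 : q < 1) (hb : 0 ≤ b) (hu : 0 ≤ u) :
    (1 - q) * (u - b) ≤ u ^ q * (u ^ (1 - q) - b ^ (1 - q)) := by
  have h1 := Real.geom_mean_le_arith_mean2_weighted hq0.le (by linarith : (0 : ℝ) ≤ 1 - q) hu hb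
    (by ring)
  have h2 : u ^ q * u ^ (1 - q) = u := by
    rw [← Real.rpow_add' hu (by norm_num)]
    simp
  nlinarith

/-- The finite length argument: sufficient decrease together with `r (k+1) ^ q ≤ C ‖x (k+1) - x k‖`
gives convergence of `x`, with distances to the limit controlled by `r ^ (1 - q)`. -/
theorem exists_tendsto_of_decrease {X : Type*} [NormedAddCommGroup X] [CompleteSpace X]
    {x : ℕ → X} {r : ℕ → ℝ} {a C q : ℝ} {N : ℕ} (ha : 0 < a) (hC : 0 < C) (hq : 1 / 2 ≤ q)
    (hq1 : q < 1) (hr : ∀ k, 0 ≤ r k) (hr1 : ∀ k, N ≤ k → r k ≤ 1)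
    (hdec : ∀ k, a * ‖x (k + 1) - x k‖ ^ 2 ≤ r k - r (k + 1))
    (hkl : ∀ k, N ≤ k → r (k + 1) ^ q ≤ C * ‖x (k + 1) - x k‖) :
    ∃ xs, Tendsto x atTop (𝓝 xs) ∧
      ∃ A, 0 < A ∧ ∀ k, N ≤ k → ‖x (k + 1) - xs‖ ≤ A * r k ^ (1 - q) := by
  have hq' : 0 < 1 - q := by linarith
  set C₁ := C / (a * (1 - q)) with hC₁
  have hC₁pos : 0 < C₁ := by positivity
  have hanti : ∀ k, r (k + 1) ≤ r k := fun k => by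
    have := hdec k
    have h1 : 0 ≤ a * ‖x (k + 1) - x k‖ ^ 2 := by positivity
    linarith
  have hpow : ∀ k, r (k + 1) ^ (1 - q) ≤ r k ^ (1 - q) := fun k =>
    Real.rpow_le_rpow (hr _) (hanti k) hq'.le
  obtain ⟨xs, hxs, hlen⟩ := exists_tendsto_of_step_le (x := x) (N := N)
    (E := fun k => ‖x (k + 1) - x k‖ + C₁ * r (k + 1) ^ (1 - q))
    (fun k => by have := Real.rpow_nonneg (hr (k + 1)) (1 - q); positivity) (by
      intro k hk
      set Δ := ‖x (k + 1) - x k‖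
      set Δ' := ‖x (k + 2) - x (k + 1)‖
      have hΔ : 0 ≤ Δ := norm_nonneg _
      have hΔ' : 0 ≤ Δ' := norm_nonneg _
      set G := r (k + 1) ^ (1 - q) - r (k + 2) ^ (1 - q) with hG
      have hG0 : 0 ≤ G := sub_nonneg.2 (hpow (k + 1))
      have h1 := rpow_one_sub_gap (by linarith) hq1 (hr (k + 2)) (hr (k + 1))
      have h2 : a * Δ' ^ 2 ≤ r (k + 1) - r (k + 2) := hdec (k + 1)
      have h3 := hkl k hk
      have h4 : (1 - q) * (a * Δ' ^ 2) ≤ C * Δ * G :=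
        (mul_le_mul_of_nonneg_left h2 hq'.le).trans
          (h1.trans (mul_le_mul_of_nonneg_right h3 hG0))
      have h5 : Δ' ^ 2 ≤ C₁ * Δ * G := by
        rw [hC₁, div_mul_eq_mul_div, div_mul_eq_mul_div, le_div_iff₀ (by positivity)]
        linarith
      have h6 : 2 * Δ' ≤ Δ + C₁ * G := by
        refine abs_le_of_sq_le_sq' ?_ (by positivity) |>.2
        nlinarith [sq_nonneg (Δ - C₁ * G)]
      have h7 : C₁ * G = C₁ * r (k + 1) ^ (1 - q) - C₁ * r (k + 2) ^ (1 - q) := by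
        rw [hG]; ring
      show Δ' + (Δ' + C₁ * r (k + 2) ^ (1 - q)) ≤ Δ + C₁ * r (k + 1) ^ (1 - q)
      linarith)
  refine ⟨xs, hxs, Real.sqrt (a⁻¹) + C₁, by positivity, fun k hk => (hlen k hk).trans ?_⟩
  have h1 : ‖x (k + 1) - x k‖ ≤ Real.sqrt (a⁻¹) * r k ^ (1 - q) := by
    have h2 : ‖x (k + 1) - x k‖ ^ 2 ≤ a⁻¹ * r k := by
      rw [inv_mul_eq_div, le_div_iff₀ ha]
      linarith [hdec k, hr (k + 1)]
    have h3 : Real.sqrt (r k) ≤ r k ^ (1 - q) := by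
      rw [Real.sqrt_eq_rpow]
      exact Real.rpow_le_rpow_of_exponent_ge' (hr k) (hr1 k hk) hq'.le (by linarith)
    calc ‖x (k + 1) - x k‖ ≤ Real.sqrt (a⁻¹ * r k) := Real.le_sqrt_of_sq_le h2
      _ = Real.sqrt (a⁻¹) * Real.sqrt (r k) := Real.sqrt_mul (by positivity) _
      _ ≤ _ := by gcongr
  have h4 := mul_le_mul_of_nonneg_left (hpow k) hC₁pos.le
  linarith

theorem le_geometric {r : ℕ → ℝ} {ρ : ℝ} {N : ℕ} (hρ : 0 < ρ)
    (h : ∀ k, N ≤ k → r (k + 1) ≤ ρ * r k) :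
    ∀ k, N ≤ k → r k ≤ (r N / ρ ^ N) * ρ ^ k := by
  intro k hk
  induction k, hk using Nat.le_induction with
  | base =>
    rw [div_mul_cancel₀ _ (by positivity)]
  | succ k hk ih =>
    calc r (k + 1) ≤ ρ * r k := h k hk
      _ ≤ ρ * ((r N / ρ ^ N) * ρ ^ k) := by gcongr
      _ = (r N / ρ ^ N) * ρ ^ (k + 1) := by ring

theorem one_add_rpow_le {t s : ℝ} (ht0 : 0 ≤ t) (ht1 : t ≤ 1) (hs : 1 ≤ s) :
    (1 + t) ^ s ≤ 1 + 2 ^ s * t := by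
  have h1 := (convexOn_rpow hs).2 (show (1 : ℝ) ∈ Ici 0 by simp) (show (2 : ℝ) ∈ Ici 0 by simp)
    (sub_nonneg.2 ht1) ht0 (by ring)
  simp only [smul_eq_mul, Real.one_rpow, mul_one] at h1
  have h2 : 1 - t + t * 2 = 1 + t := by ring
  rw [h2] at h1
  linarith

/-- The recursion `r (k+1) ^ (1+p) ≤ c (r k - r (k+1))` forces the rate `k ^ (-1/p)`. -/
theorem exists_sublinear_bound {r : ℕ → ℝ} {p c : ℝ} {N : ℕ} (hp : 0 < p) (hp1 : p ≤ 1)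
    (hc : 0 < c) (hN : 1 ≤ N)
    (h : ∀ k, N ≤ k → r (k + 1) ^ (1 + p) ≤ c * (r k - r (k + 1))) :
    ∃ A, 0 < A ∧ ∀ k, N ≤ k → r k ≤ A * (k : ℝ) ^ (-(1 / p)) := by
  set s := 1 / p with hs
  have hs1 : 1 ≤ s := by rw [hs, le_div_iff₀ hp]; linarith
  have h2s : (0 : ℝ) < 2 ^ s := by positivity
  set A := max ((2 * c * 2 ^ s) ^ s) (r N * (N : ℝ) ^ s) with hA
  have hA0 : 0 < A := lt_max_of_lt_left (by positivity)
  have hAp : 2 * c * 2 ^ s ≤ A ^ p := by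
    have h1 : ((2 * c * 2 ^ s) ^ s) ^ p = 2 * c * 2 ^ s := by
      rw [← Real.rpow_mul (by positivity), hs, one_div_mul_cancel hp.ne', Real.rpow_one]
    rw [← h1]
    exact Real.rpow_le_rpow (by positivity) (le_max_left _ _) hp.le
  refine ⟨A, hA0, fun k hk => ?_⟩
  induction k, hk using Nat.le_induction with
  | base =>
    have hNpos : (0 : ℝ) < N := by exact_mod_cast hN
    rw [Real.rpow_neg hNpos.le, ← div_eq_mul_inv, le_div_iff₀ (by positivity)]
    exact le_max_right _ _
  | succ k hk ih =>
    by_contra! hlt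
    have hk0 : (0 : ℝ) < k := by exact_mod_cast (hN.trans hk)
    have hk1 : (1 : ℝ) ≤ k := by exact_mod_cast (hN.trans hk)
    push_cast at hlt
    set b := A * ((k : ℝ) + 1) ^ (-s) with hb
    have hb0 : 0 < b := by positivity
    have h1 := h k hk
    have h2 : b ^ (1 + p) ≤ r (k + 1) ^ (1 + p) :=
      Real.rpow_le_rpow hb0.le hlt.le (by linarith)
    have h3 : b ^ p = A ^ p / ((k : ℝ) + 1) := by
      rw [hb, Real.mul_rpow hA0.le (by positivity), ← Real.rpow_mul (by positivity), hs]
      have : -(1 / p) * p = -1 := by field_simp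
      rw [this, Real.rpow_neg_one, div_eq_mul_inv]
    have h4 : b ^ (1 + p) = b * (A ^ p / ((k : ℝ) + 1)) := by
      rw [Real.rpow_add hb0, Real.rpow_one, h3]
    -- The choice of `A` makes the increase forced by the recursion exceed that of `k ^ (-1/p)`.
    have h5 : A * (k : ℝ) ^ (-s) ≤ b * (1 + 2 ^ s * (1 / k)) := by
      have h6 := one_add_rpow_le (t := 1 / (k : ℝ)) (by positivity)
        (by rw [div_le_one hk0]; exact hk1) hs1
      have h7 : (k : ℝ) ^ (-s) = ((k : ℝ) + 1) ^ (-s) * (1 + 1 / (k : ℝ)) ^ s := by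
        have h8 : 1 + 1 / (k : ℝ) = ((k : ℝ) + 1) / k := by field_simp
        rw [h8, Real.div_rpow (by positivity) hk0.le, Real.rpow_neg hk0.le,
          Real.rpow_neg (by positivity)]
        field_simp
      rw [h7, ← mul_assoc]
      exact mul_le_mul_of_nonneg_left h6 hb0.le
    have h9 : c * (2 ^ s * (1 / k)) ≤ A ^ p / ((k : ℝ) + 1) := by
      rw [le_div_iff₀ (by positivity)]
      refine le_trans ?_ hAp
      have h10 : ((k : ℝ) + 1) / k ≤ 2 := by
        rw [div_le_iff₀ hk0]; linarith
      calc c * (2 ^ s * (1 / k)) * ((k : ℝ) + 1) = c * 2 ^ s * (((k : ℝ) + 1) / k) := by ring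
        _ ≤ c * 2 ^ s * 2 := by gcongr
        _ = 2 * c * 2 ^ s := by ring
    have h11 : b * (c * (2 ^ s * (1 / k))) ≤ b * (A ^ p / ((k : ℝ) + 1)) :=
      mul_le_mul_of_nonneg_left h9 hb0.le
    have h12 : c * b < c * r (k + 1) := mul_lt_mul_of_pos_left hlt hc
    have h13 : c * r k ≤ c * (b * (1 + 2 ^ s * (1 / k))) :=
      mul_le_mul_of_nonneg_left (ih.trans h5) hc.le
    nlinarith

/-- The rates of `r` and of the distances of `x` to its limit in the setting of
`exists_tendsto_of_decrease`. -/
theorem rates_of_decrease {X : Type*} [NormedAddCommGroup X] [CompleteSpace X]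
    {x : ℕ → X} {r : ℕ → ℝ} {a C q : ℝ} (ha : 0 < a) (hq : 1 / 2 ≤ q)
    (hq1 : q < 1) (hr : ∀ k, 0 ≤ r k) (hr0 : Tendsto r atTop (𝓝 0))
    (hdec : ∀ k, a * ‖x (k + 1) - x k‖ ^ 2 ≤ r k - r (k + 1))
    (hkl : ∀ᶠ k in atTop, r (k + 1) ^ q ≤ C * ‖x (k + 1) - x k‖) :
    ∃ xs, Tendsto x atTop (𝓝 xs) ∧
      (q = 1 / 2 → ∃ a₁ ρ ρ' : ℝ, 0 < a₁ ∧ ρ ∈ Ioo (0 : ℝ) 1 ∧ ρ' ∈ Ioo (0 : ℝ) 1 ∧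
        ∀ᶠ k : ℕ in atTop, r (k + 1) ≤ ρ * r k ∧ ‖x k - xs‖ ≤ a₁ * ρ' ^ k) ∧
      (1 / 2 < q → ∃ a₂ a₃ : ℝ, 0 < a₂ ∧ 0 < a₃ ∧
        ∀ᶠ k : ℕ in atTop, r k ≤ a₂ * (k : ℝ) ^ (-(1 / (2 * q - 1))) ∧
          ‖x k - xs‖ ≤ a₃ * (k : ℝ) ^ (-((1 - q) / (2 * q - 1)))) := by
  wlog hC : 0 < C generalizing C
  · refine this (C := 1) (hkl.mono fun k hk => hk.trans ?_) one_pos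
    gcongr
    linarith
  have hq' : 0 < 1 - q := by linarith
  obtain ⟨N, hN⟩ := eventually_atTop.1 ((hkl.and (hr0.eventually_le_const one_pos)).and
    (eventually_ge_atTop 1))
  have hN1 : 1 ≤ N := (hN N le_rfl).2
  obtain ⟨xs, hxs, A, hA, hlen⟩ := exists_tendsto_of_decrease ha hC hq hq1 hr
    (fun k hk => (hN k hk).1.2) hdec (fun k hk => (hN k hk).1.1)
  set c := C ^ 2 / a with hc
  have hc0 : 0 < c := by positivity
  have hrec : ∀ k, N ≤ k → r (k + 1) ^ (2 * q) ≤ c * (r k - r (k + 1)) := by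
    intro k hk
    have h1 := (hN k hk).1.1
    have h2 : r (k + 1) ^ (2 * q) = (r (k + 1) ^ q) ^ 2 := by
      rw [← Real.rpow_natCast, ← Real.rpow_mul (hr _), mul_comm]
      simp
    rw [h2]
    calc (r (k + 1) ^ q) ^ 2 ≤ (C * ‖x (k + 1) - x k‖) ^ 2 :=
          pow_le_pow_left₀ (Real.rpow_nonneg (hr _) _) h1 2
      _ = c * (a * ‖x (k + 1) - x k‖ ^ 2) := by rw [hc]; field_simp
      _ ≤ c * (r k - r (k + 1)) := mul_le_mul_of_nonneg_left (hdec k) hc0.le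
  refine ⟨xs, hxs, fun hqe => ?_, fun hql => ?_⟩
  · set ρ := c / (1 + c) with hρ
    have hρ0 : 0 < ρ := by positivity
    have hρ1 : ρ < 1 := by rw [hρ, div_lt_one (by positivity)]; linarith
    have hlin : ∀ k, N ≤ k → r (k + 1) ≤ ρ * r k := by
      intro k hk
      have h1 := hrec k hk
      rw [hqe] at h1
      norm_num at h1
      rw [hρ, div_mul_eq_mul_div, le_div_iff₀ (by positivity)]
      linarith
    have hgeo := le_geometric hρ0 hlin
    set S := r N / ρ ^ N with hS
    have hS0 : 0 ≤ S := div_nonneg (hr _) (by positivity)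
    have hσ0 : 0 < Real.sqrt ρ := Real.sqrt_pos.2 hρ0
    refine ⟨A * Real.sqrt S / Real.sqrt ρ + 1, ρ, Real.sqrt ρ, by positivity, ⟨hρ0, hρ1⟩,
      ⟨hσ0, by rw [Real.sqrt_lt' one_pos]; simpa using hρ1⟩, ?_⟩
    filter_upwards [eventually_ge_atTop (N + 1)] with k hk
    refine ⟨hlin k (by omega), ?_⟩
    obtain ⟨l, rfl⟩ : ∃ l, k = l + 1 := ⟨k - 1, by omega⟩
    have h1 := hlen l (by omega)
    have h2 : r l ^ (1 - q) ≤ Real.sqrt S * Real.sqrt ρ ^ l := by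
      rw [hqe]
      norm_num
      rw [← Real.sqrt_eq_rpow]
      calc Real.sqrt (r l) ≤ Real.sqrt (S * ρ ^ l) := Real.sqrt_le_sqrt (hgeo l (by omega))
        _ = Real.sqrt S * Real.sqrt ρ ^ l := by
          rw [Real.sqrt_mul hS0, Real.sqrt_eq_rpow (ρ ^ l), Real.sqrt_eq_rpow ρ,
            ← Real.rpow_natCast, ← Real.rpow_natCast, ← Real.rpow_mul hρ0.le,
            ← Real.rpow_mul hρ0.le, mul_comm (l : ℝ)]
    calc ‖x (l + 1) - xs‖ ≤ A * (Real.sqrt S * Real.sqrt ρ ^ l) :=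
          h1.trans (mul_le_mul_of_nonneg_left h2 hA.le)
      _ = A * Real.sqrt S / Real.sqrt ρ * Real.sqrt ρ ^ (l + 1) := by
          field_simp
          ring
      _ ≤ _ := by
          gcongr
          linarith
  · have hp : 0 < 2 * q - 1 := by linarith
    obtain ⟨S, hS, hrS⟩ := exists_sublinear_bound (p := 2 * q - 1) hp (by linarith) hc0 hN1
      (by
        intro k hk
        have : 1 + (2 * q - 1) = 2 * q := by ring
        rw [this]
        exact hrec k hk)
    set e := (1 - q) / (2 * q - 1) with he
    have he0 : 0 < e := by positivity
    refine ⟨S, A * S ^ (1 - q) * 2 ^ e, hS, by positivity, ?_⟩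
    filter_upwards [eventually_ge_atTop (N + 1)] with k hk
    refine ⟨hrS k (by omega), ?_⟩
    obtain ⟨l, rfl⟩ : ∃ l, k = l + 1 := ⟨k - 1, by omega⟩
    have hl0 : (0 : ℝ) < l := by
      have : 0 < l := by omega
      exact_mod_cast this
    have hl1 : (1 : ℝ) ≤ l := by
      have : 1 ≤ l := by omega
      exact_mod_cast this
    have h1 := hlen l (by omega)
    have h2 : r l ^ (1 - q) ≤ S ^ (1 - q) * (l : ℝ) ^ (-e) := by
      refine (Real.rpow_le_rpow (hr l) (hrS l (by omega)) hq'.le).trans (le_of_eq ?_)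
      rw [Real.mul_rpow hS.le (by positivity), ← Real.rpow_mul hl0.le, he]
      congr 2
      ring
    have h3 : (l : ℝ) ^ (-e) ≤ 2 ^ e * ((l + 1 : ℕ) : ℝ) ^ (-e) := by
      push_cast
      rw [Real.rpow_neg hl0.le, Real.rpow_neg (by positivity), ← div_eq_mul_inv,
        ← Real.div_rpow (by norm_num) (by positivity), ← Real.inv_rpow hl0.le]
      refine Real.rpow_le_rpow (by positivity) ?_ he0.le
      rw [inv_eq_one_div, div_le_div_iff₀ hl0 (by positivity)]
      linarith
    calc ‖x (l + 1) - xs‖ ≤ A * (S ^ (1 - q) * (2 ^ e * ((l + 1 : ℕ) : ℝ) ^ (-e))) := by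
          refine h1.trans (mul_le_mul_of_nonneg_left (h2.trans ?_) hA.le)
          gcongr
      _ = _ := by ring

end Rates

/-! ### The subproblems -/

theorem inner_vec_eq_sum {m : ℕ} (a b : Vec m) : ⟪a, b⟫ = ∑ i, a i * b i := by
  rw [PiLp.inner_apply]
  exact Finset.sum_congr rfl fun i _ => by simp [mul_comm]

theorem abs_apply_le_norm {m : ℕ} (a : Vec m) (i : Fin m) : |a i| ≤ ‖a‖ := by
  simpa using PiLp.norm_apply_le a i

theorem sum_le_card_mul_norm {m : ℕ} (a : Vec m) : ∑ i, a i ≤ m * ‖a‖ := by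
  calc ∑ i, a i ≤ ∑ _i : Fin m, ‖a‖ :=
        Finset.sum_le_sum fun i _ => (le_abs_self _).trans (abs_apply_le_norm a i)
    _ = m * ‖a‖ := by simp

section Operators

variable {n : ℕ} {Q : Vec n →L[ℝ] Vec n} {μ : ℝ}

theorem mul_sq_le_inner (h : (Q - μ • ContinuousLinearMap.id ℝ (Vec n)).IsPositive) (d : Vec n) :
    μ * ‖d‖ ^ 2 ≤ ⟪d, Q d⟫ := by
  have := h.inner_nonneg_right d
  rw [_root_.sub_apply, _root_.smul_apply, ContinuousLinearMap.id_apply, inner_sub_right,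
    inner_smul_right, real_inner_self_eq_norm_sq] at this
  linarith

theorem inner_le_mul_sq (h : (μ • ContinuousLinearMap.id ℝ (Vec n) - Q).IsPositive) (d : Vec n) :
    ⟪d, Q d⟫ ≤ μ * ‖d‖ ^ 2 := by
  have := h.inner_nonneg_right d
  rw [_root_.sub_apply, _root_.smul_apply, ContinuousLinearMap.id_apply, inner_sub_right,
    inner_smul_right, real_inner_self_eq_norm_sq] at this
  linarith

theorem inner_symm_of_isPositive (h : (Q - μ • ContinuousLinearMap.id ℝ (Vec n)).IsPositive)
    (a b : Vec n) : ⟪Q a, b⟫ = ⟪a, Q b⟫ := by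
  have h1 : ⟪(Q - μ • ContinuousLinearMap.id ℝ (Vec n)) a, b⟫ =
      ⟪a, (Q - μ • ContinuousLinearMap.id ℝ (Vec n)) b⟫ := h.1 a b
  simp only [_root_.sub_apply, _root_.smul_apply, ContinuousLinearMap.id_apply, inner_sub_left,
    inner_sub_right, inner_smul_left, inner_smul_right, conj_trivial] at h1
  linarith

/-- A symmetric operator with `0 ≤ Q ≤ c` has norm at most `c`; by polarization. -/
theorem opNorm_le_of_le {c : ℝ} (hc : 0 < c) (hs : ∀ a b, ⟪Q a, b⟫ = ⟪a, Q b⟫)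
    (h0 : ∀ d, 0 ≤ ⟪d, Q d⟫) (h1 : ∀ d, ⟪d, Q d⟫ ≤ c * ‖d‖ ^ 2) : ‖Q‖ ≤ c := by
  refine ContinuousLinearMap.opNorm_le_bound _ hc.le fun d => ?_
  set e := c⁻¹ • Q d with he
  have h2 := h1 (d + e)
  have h3 := h0 (d - e)
  have h4 : ‖d + e‖ ^ 2 + ‖d - e‖ ^ 2 = 2 * (‖d‖ ^ 2 + ‖e‖ ^ 2) := by
    have := parallelogram_law_with_norm ℝ d e
    nlinarith
  have h5 : ⟪d + e, Q (d + e)⟫ - ⟪d - e, Q (d - e)⟫ = 4 * ⟪e, Q d⟫ := by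
    have := hs d e
    simp only [map_add, map_sub, inner_add_left, inner_add_right, inner_sub_left,
      inner_sub_right]
    rw [real_inner_comm e (Q d)] at *
    linarith
  have h6 : ⟪e, Q d⟫ = c * ‖e‖ ^ 2 := by
    have : Q d = c • e := by rw [he, smul_smul, mul_inv_cancel₀ hc.ne', one_smul]
    rw [this, inner_smul_right, real_inner_self_eq_norm_sq]
  have h7 : c * ‖e‖ ^ 2 ≤ c * ‖d‖ ^ 2 := by
    have : c * (‖d‖ ^ 2 + ‖e‖ ^ 2) * 2 = c * ‖d + e‖ ^ 2 + c * ‖d - e‖ ^ 2 := by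
      rw [← mul_add, h4]; ring
    have h8 : 0 ≤ ‖d - e‖ ^ 2 := by positivity
    have h9 := h1 (d - e)
    have h10 := h0 (d + e)
    nlinarith
  have h8 : ‖e‖ ≤ ‖d‖ := abs_le_of_sq_le_sq' (le_of_mul_le_mul_left h7 hc) (norm_nonneg _) |>.2
  have h9 : ‖Q d‖ = c * ‖e‖ := by
    rw [he, norm_smul, Real.norm_of_nonneg (inv_pos.2 hc).le, ← mul_assoc,
      mul_inv_cancel₀ hc.ne', one_mul]
  rw [h9]
  exact mul_le_mul_of_nonneg_left h8 hc.le

end Operators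

namespace Problem

variable {n m : ℕ} (P : Problem n m)

theorem G_apply (x s : Vec n) (V : Mat n m) (L : Vec m) (i : Fin m) :
    P.G x s V L i = P.g i s + ⟪V i, x - s⟫ + 1 / 2 * ‖x - s‖ ^ 2 * L i := rfl

theorem G_self (s : Vec n) (V : Mat n m) (L : Vec m) (i : Fin m) : P.G s s V L i = P.g i s := by
  simp [G_apply]

theorem G_expansion (a z s : Vec n) (V : Mat n m) (L : Vec m) (i : Fin m) :
    P.G z s V L i = P.G a s V L i + ⟪V i + L i • (a - s), z - a⟫ + L i / 2 * ‖z - a‖ ^ 2 := by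
  have h1 : z - s = (a - s) + (z - a) := by abel
  rw [G_apply, G_apply, h1, norm_add_sq_real, inner_add_left, inner_add_right, inner_smul_left]
  simp only [conj_trivial]
  ring

theorem hasFDerivAt_inner_sub (c a s : Vec n) :
    HasFDerivAt (fun x : Vec n => ⟪c, x - s⟫) (innerSL ℝ c) a :=
  ((innerSL ℝ c).hasFDerivAt.comp a ((hasFDerivAt_id a).sub_const s)).congr_fderiv
    (ContinuousLinearMap.comp_id _)

theorem fderiv_G_apply (a s : Vec n) (V : Mat n m) (L : Vec m) (d : Vec n) (i : Fin m) :
    fderiv ℝ (fun x => P.G x s V L) a d i = ⟪V i + L i • (a - s), d⟫ := by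
  have key : ∀ i, HasFDerivAt (fun x => P.G x s V L i)
      (innerSL ℝ (V i + L i • (a - s))) a := by
    intro i
    have h1 : HasFDerivAt (fun x : Vec n => ‖x - s‖ ^ 2) (2 • innerSL ℝ (a - s)) a := by
      simpa using ((hasFDerivAt_id a).sub_const s).norm_sq
    have h2 := hasFDerivAt_inner_sub (V i) a s
    have h3 := (h2.const_add (P.g i s)).add ((h1.const_mul (1 / 2)).mul_const (L i))
    refine h3.congr_fderiv ?_
    ext d
    simp only [one_div, _root_.add_apply, _root_.smul_apply,
      innerSL_apply_apply, inner_add_left, inner_smul_left, conj_trivial, smul_eq_mul, nsmul_eq_mul,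
      Nat.cast_ofNat]
    ring
  have hF : HasFDerivAt (fun x => P.G x s V L)
      (((PiLp.continuousLinearEquiv 2 ℝ fun _ : Fin m => ℝ).symm :
        (Fin m → ℝ) →L[ℝ] Vec m).comp
        (ContinuousLinearMap.pi fun i => innerSL ℝ (V i + L i • (a - s)))) a :=
    hasFDerivWithinAt_univ.1 (hasFDerivWithinAt_euclidean.2 fun i =>
      ((key i).congr_fderiv rfl).hasFDerivWithinAt)
  rw [hF.fderiv]
  rfl

theorem nabla_G (a s : Vec n) (V : Mat n m) (L lam : Vec m) :
    nabla (fun x => P.G x s V L) a lam = ∑ i, lam i • (V i + L i • (a - s)) := by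
  refine ext_inner_right ℝ fun d => ?_
  rw [nabla, ContinuousLinearMap.adjoint_inner_left, inner_vec_eq_sum, sum_inner]
  refine Finset.sum_congr rfl fun i _ => ?_
  rw [P.fderiv_G_apply, inner_smul_left]
  rfl

variable {P} in
theorem model_expansion {s ξ : Vec n} {Q : Vec n →L[ℝ] Vec n}
    (hs : ∀ a b, ⟪Q a, b⟫ = ⟪a, Q b⟫) (a z : Vec n) :
    P.model s ξ Q z = P.model s ξ Q a + ⟪ξ + Q (a - s), z - a⟫ + 1 / 2 * ⟪z - a, Q (z - a)⟫ := by
  have h1 : z - s = (a - s) + (z - a) := by abel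
  have h2 := hs (a - s) (z - a)
  have h3 := real_inner_comm (z - a) (Q (a - s))
  rw [model, model, h1, map_add, inner_add_left, inner_add_right, inner_add_left, inner_add_right,
    inner_add_right]
  linarith

variable {P} in
theorem gradient_model {s ξ : Vec n} {Q : Vec n →L[ℝ] Vec n}
    (hs : ∀ a b, ⟪Q a, b⟫ = ⟪a, Q b⟫) (a : Vec n) :
    gradient (P.model s ξ Q) a = ξ + Q (a - s) := by
  refine HasGradientAt.gradient ?_
  rw [hasGradientAt_iff_hasFDerivAt]
  have h0 : HasFDerivAt (fun x : Vec n => x - s) (ContinuousLinearMap.id ℝ (Vec n)) a :=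
    (hasFDerivAt_id a).sub_const s
  have h2 := hasFDerivAt_inner_sub ξ a s
  have h1 := h0.inner ℝ (Q.hasFDerivAt.comp a h0)
  refine ((h2.const_add (P.g0 s).toReal).add (h1.const_mul (1 / 2))).congr_fderiv ?_
  ext d
  have h3 := hs (a - s) d
  have h4 := real_inner_comm d (Q (a - s))
  simp [inner_sub_left, inner_sub_right] at h3 h4 ⊢
  linarith

theorem convex_subFeasible {s : Vec n} {V : Mat n m} {L : Vec m} (hL : ∀ i, 0 ≤ L i) :
    Convex ℝ (P.subFeasible s V L) := by
  intro x hx y hy a b ha hb hab i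
  -- Expanding around the convex combination makes the linear terms cancel.
  have h1 := P.G_expansion (a • x + b • y) x s V L i
  have h2 := P.G_expansion (a • x + b • y) y s V L i
  set w := a • x + b • y
  set p := V i + L i • (w - s)
  have hb' : b = 1 - a := by linarith
  have e : a * ⟪p, x - w⟫ + b * ⟪p, y - w⟫ = 0 := by
    rw [← inner_smul_right, ← inner_smul_right, ← inner_add_right]
    have : a • (x - w) + b • (y - w) = 0 := by
      simp only [w, hb']
      module
    rw [this, inner_zero_right]
  have h3 : P.G x s V L i ≤ 0 := hx i
  have h4 : P.G y s V L i ≤ 0 := hy i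
  have h5 : 0 ≤ L i / 2 * ‖x - w‖ ^ 2 := by have := hL i; positivity
  have h6 : 0 ≤ L i / 2 * ‖y - w‖ ^ 2 := by have := hL i; positivity
  have h7 : P.G w s V L i = a * P.G w s V L i + b * P.G w s V L i := by
    rw [← add_mul, hab, one_mul]
  have h8 : a * (P.G w s V L i + ⟪p, x - w⟫) ≤ 0 :=
    mul_nonpos_of_nonneg_of_nonpos ha (by linarith)
  have h9 : b * (P.G w s V L i + ⟪p, y - w⟫) ≤ 0 :=
    mul_nonpos_of_nonneg_of_nonpos hb (by linarith)
  linarith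

theorem subObj_self (s ξ : Vec n) (Q : Vec n →L[ℝ] Vec n) :
    P.subObj s ξ Q s = (P.g0 s).toReal + P.φ s := by
  simp [subObj, model]

variable {P} in
/-- Sublevel sets of the model objective are bounded by strong convexity. -/
theorem norm_sub_le_of_subObj_le {s ξ w y : Vec n} {Q : Vec n →L[ℝ] Vec n} {μ : ℝ} (hμ : 0 < μ)
    (hQ : ∀ d, μ * ‖d‖ ^ 2 ≤ ⟪d, Q d⟫) (hw : IsSubgradientAt P.φ s w)
    (h : P.subObj s ξ Q y ≤ P.subObj s ξ Q s) : ‖y - s‖ ≤ 2 * (‖ξ‖ + ‖w‖) / μ := by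
  rw [subObj_self, subObj, model] at h
  have h1 := hQ (y - s)
  have h2 := hw y
  have h3 := (abs_le.1 (abs_real_inner_le_norm ξ (y - s))).1
  have h4 := (abs_le.1 (abs_real_inner_le_norm w (y - s))).1
  rw [le_div_iff₀ hμ]
  by_cases h0 : ‖y - s‖ = 0
  · rw [h0, zero_mul]
    positivity
  · have hpos : 0 < ‖y - s‖ := lt_of_le_of_ne (norm_nonneg _) (Ne.symm h0)
    have h5 : ‖y - s‖ * (‖y - s‖ * μ) ≤ ‖y - s‖ * (2 * (‖ξ‖ + ‖w‖)) := by nlinarith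
    exact le_of_mul_le_mul_left h5 hpos

/-- The Lagrangian gradient appearing in the optimality conditions of a subproblem. -/
def lagrangeGrad (s ξ : Vec n) (V : Mat n m) (Q : Vec n →L[ℝ] Vec n) (L : Vec m)
    (x v : Vec n) (lam : Vec m) : Vec n :=
  ξ + Q (x - s) + v + ∑ i, lam i • (V i + L i • (x - s))

variable {P} in
theorem residS_eq {s ξ : Vec n} {V : Mat n m} {Q : Vec n →L[ℝ] Vec n} {L : Vec m} {x v : Vec n}
    {lam : Vec m} (hs : ∀ a b, ⟪Q a, b⟫ = ⟪a, Q b⟫) :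
    P.residS s ξ V Q L x v lam = ‖lagrangeGrad s ξ V Q L x v lam‖ := by
  rw [residS, gradient_model hs, nabla_G, lagrangeGrad]

variable {P} in
/-- Strong convexity of the Lagrangian of a subproblem. -/
theorem lagrangian_growth {s ξ : Vec n} {V : Mat n m} {Q : Vec n →L[ℝ] Vec n} {L : Vec m}
    {x v : Vec n} {lam : Vec m} {μ : ℝ} (hs : ∀ a b, ⟪Q a, b⟫ = ⟪a, Q b⟫)
    (hQ : ∀ d, μ * ‖d‖ ^ 2 ≤ ⟪d, Q d⟫) (hL : ∀ i, 0 ≤ L i) (hlam : ∀ i, 0 ≤ lam i)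
    (hv : IsSubgradientAt P.φ x v) (z : Vec n) :
    P.subObj s ξ Q x + ⟪lam, P.G x s V L⟫ + ⟪lagrangeGrad s ξ V Q L x v lam, z - x⟫
      + μ / 2 * ‖z - x‖ ^ 2 ≤ P.subObj s ξ Q z + ⟪lam, P.G z s V L⟫ := by
  have h1 := model_expansion (P := P) (ξ := ξ) (s := s) hs x z
  have h2 := hv z
  have h3 := hQ (z - x)
  have h4 : ⟪lam, P.G x s V L⟫ + ⟪∑ i, lam i • (V i + L i • (x - s)), z - x⟫
      ≤ ⟪lam, P.G z s V L⟫ := by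
    rw [inner_vec_eq_sum lam (P.G x s V L), inner_vec_eq_sum lam (P.G z s V L), sum_inner,
      ← Finset.sum_add_distrib]
    refine Finset.sum_le_sum fun i _ => ?_
    rw [inner_smul_left, P.G_expansion x z]
    simp only [conj_trivial]
    have h5 : 0 ≤ lam i * (L i / 2 * ‖z - x‖ ^ 2) := by
      have := hL i
      have := hlam i
      positivity
    linarith
  rw [subObj, subObj, lagrangeGrad, inner_add_left, inner_add_left]
  linarith

theorem G_le_residC {s x : Vec n} {V : Mat n m} {L lam : Vec m} (i : Fin m) :
    P.G x s V L i ≤ P.residC s V L x lam := by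
  have h1 := norm_le_pi_norm (fun i => max 0 (P.G x s V L i) : Fin m → ℝ) i
  have h2 : P.G x s V L i ≤ ‖max 0 (P.G x s V L i)‖ :=
    (le_max_right _ _).trans (le_abs_self _)
  rw [residC]
  linarith [le_max_left 0 (-⟪lam, P.G x s V L⟫)]

theorem neg_inner_le_residC {s x : Vec n} {V : Mat n m} {L lam : Vec m} :
    -⟪lam, P.G x s V L⟫ ≤ P.residC s V L x lam := by
  rw [residC]
  have h1 := norm_nonneg (fun i => max 0 (P.G x s V L i) : Fin m → ℝ)
  linarith [le_max_right 0 (-⟪lam, P.G x s V L⟫)]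

/-- `x` is optimal for a subproblem, with subgradient `v` of `φ` and multiplier `lam`. -/
structure IsKKT (s ξ : Vec n) (V : Mat n m) (Q : Vec n →L[ℝ] Vec n) (L : Vec m)
    (x v : Vec n) (lam : Vec m) : Prop where
  subgradient : IsSubgradientAt P.φ x v
  feasible : ∀ i, P.G x s V L i ≤ 0
  nonneg : ∀ i, 0 ≤ lam i
  complementarity : ∀ i, lam i * P.G x s V L i = 0
  stationarity : lagrangeGrad s ξ V Q L x v lam = 0

variable {P} in
theorem mem_normalCone_nonposOrthant {w lam : Vec m} (h : lam ∈ normalCone (nonposOrthant m) w) :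
    (∀ i, w i ≤ 0) ∧ (∀ i, 0 ≤ lam i) ∧ ∀ i, lam i * w i = 0 := by
  obtain ⟨hw, hz⟩ := h
  have hw' : ∀ i, w i ≤ 0 := hw
  have hpos : ∀ i, 0 ≤ lam i := by
    intro i
    have h1 := hz (w - EuclideanSpace.single i 1) (fun j => by
      have := hw' j
      simp only [PiLp.sub_apply, PiLp.single_apply]
      split_ifs <;> linarith)
    simp only [sub_sub_cancel_left, inner_neg_right, EuclideanSpace.inner_single_right] at h1
    simpa using h1
  have hle : ∀ i, lam i * w i ≤ 0 := fun i => mul_nonpos_of_nonneg_of_nonpos (hpos i) (hw' i)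
  refine ⟨hw', hpos, fun i => ?_⟩
  have h1 := hz 0 (fun j => by simp)
  rw [zero_sub, inner_neg_right, inner_vec_eq_sum] at h1
  have h2 : ∑ i, lam i * w i = 0 :=
    le_antisymm (Finset.sum_nonpos fun i _ => hle i) (by linarith)
  exact (Finset.sum_eq_zero_iff_of_nonpos fun i _ => hle i).1 h2 i (Finset.mem_univ i)

variable {P} in
/-- The inexact solution `y` is as close to the exact solution `x` as it is to the centre `s`, and
its objective value is optimal up to a quadratic term. -/
theorem IsKKT.inexact_estimates {s ξ y x v vy : Vec n} {V : Mat n m} {Q : Vec n →L[ℝ] Vec n}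
    {L lam lamy : Vec m} {μ βC βS Λ : ℝ} (hμ : 0 < μ) (hβC : 0 < βC)
    (hs : ∀ a b, ⟪Q a, b⟫ = ⟪a, Q b⟫)
    (hQ : ∀ d, μ * ‖d‖ ^ 2 ≤ ⟪d, Q d⟫) (hL : ∀ i, 0 ≤ L i) (hx : P.IsKKT s ξ V Q L x v lam)
    (hΛ : ∑ i, lam i ≤ Λ) (hvy : IsSubgradientAt P.φ y vy) (hlamy : ∀ i, 0 ≤ lamy i)
    (hC : P.residC s V L y lamy ≤ βC / 2 * ‖y - s‖ ^ 2)
    (hS : P.residS s ξ V Q L y vy lamy ≤ βS * ‖y - s‖) :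
    ‖x - y‖ ≤ max 1 ((βS + (1 + Λ) * (βC / 2)) / μ) * ‖y - s‖ ∧
      P.subObj s ξ Q y ≤ P.subObj s ξ Q x + βS * ‖y - s‖ * ‖x - y‖ + βC / 2 * ‖y - s‖ ^ 2 := by
  have hsq : 0 ≤ βC / 2 * ‖y - s‖ ^ 2 := by positivity
  have hlow : P.subObj s ξ Q y + μ / 2 * ‖x - y‖ ^ 2 ≤
      P.subObj s ξ Q x + βS * ‖y - s‖ * ‖x - y‖ + βC / 2 * ‖y - s‖ ^ 2 := by
    have h1 := lagrangian_growth (s := s) (ξ := ξ) (V := V) hs hQ hL hlamy hvy x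
    have h2 : ⟪lamy, P.G x s V L⟫ ≤ 0 := by
      rw [inner_vec_eq_sum]
      exact Finset.sum_nonpos fun i _ =>
        mul_nonpos_of_nonneg_of_nonpos (hlamy i) (hx.feasible i)
    have h3 := P.neg_inner_le_residC.trans hC
    rw [residS_eq hs] at hS
    have h4 := (abs_le.1 (abs_real_inner_le_norm (lagrangeGrad s ξ V Q L y vy lamy) (x - y))).1
    have h5 := mul_le_mul_of_nonneg_right hS (norm_nonneg (x - y))
    linarith
  have hup : P.subObj s ξ Q x + μ / 2 * ‖x - y‖ ^ 2 ≤
      P.subObj s ξ Q y + Λ * (βC / 2 * ‖y - s‖ ^ 2) := by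
    have h1 := lagrangian_growth (s := s) (ξ := ξ) (V := V) hs hQ hL hx.nonneg hx.subgradient y
    rw [hx.stationarity, inner_zero_left, inner_vec_eq_sum, inner_vec_eq_sum,
      Finset.sum_eq_zero fun i _ => hx.complementarity i, norm_sub_rev y x] at h1
    have h2 : ∑ i, lam i * P.G y s V L i ≤ Λ * (βC / 2 * ‖y - s‖ ^ 2) := by
      calc ∑ i, lam i * P.G y s V L i ≤ ∑ i, lam i * (βC / 2 * ‖y - s‖ ^ 2) :=
            Finset.sum_le_sum fun i _ =>
              mul_le_mul_of_nonneg_left ((P.G_le_residC i).trans hC) (hx.nonneg i)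
        _ = (∑ i, lam i) * (βC / 2 * ‖y - s‖ ^ 2) := by rw [Finset.sum_mul]
        _ ≤ _ := mul_le_mul_of_nonneg_right hΛ hsq
    linarith
  refine ⟨?_, by nlinarith [sq_nonneg ‖x - y‖]⟩
  set t := ‖x - y‖
  set r := ‖y - s‖
  have ht : 0 ≤ t := norm_nonneg _
  have hr : 0 ≤ r := norm_nonneg _
  have hΛ0 : 0 ≤ Λ := (Finset.sum_nonneg fun i _ => hx.nonneg i).trans hΛ
  rcases le_or_gt t r with htr | htr
  · exact htr.trans (le_mul_of_one_le_left hr (le_max_left _ _))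
  · have htpos : 0 < t := hr.trans_lt htr
    refine le_trans ?_ (mul_le_mul_of_nonneg_right (le_max_right _ _) hr)
    rw [div_mul_eq_mul_div, le_div_iff₀ hμ]
    have hA : 0 ≤ (1 + Λ) * (βC / 2) := by positivity
    have h1 : μ * t ^ 2 ≤ βS * r * t + (1 + Λ) * (βC / 2) * r ^ 2 := by linarith
    have h2 : (1 + Λ) * (βC / 2) * r ^ 2 ≤ (1 + Λ) * (βC / 2) * (r * t) :=
      mul_le_mul_of_nonneg_left (by nlinarith) hA
    have h3 : t * (t * μ) ≤ t * ((βS + (1 + Λ) * (βC / 2)) * r) := by linarith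
    exact le_of_mul_le_mul_left h3 htpos

end Problem

/-! ### Boundedness of the iterates and of the inner loops -/

theorem LocLipschitzAt.coe_toReal {X : Type*} [NormedAddCommGroup X] [InnerProductSpace ℝ X]
    {h : X → EReal} {x : X} (hx : LocLipschitzAt h x) : ((h x).toReal : EReal) = h x := by
  obtain ⟨δ, hδ, K, r, hr, -⟩ := hx
  rw [hr x (Metric.mem_ball_self hδ), EReal.toReal_coe]

theorem LocLipschitzAt.continuousAt_toReal {X : Type*} [NormedAddCommGroup X]
    [InnerProductSpace ℝ X] {h : X → EReal} {x : X} (hx : LocLipschitzAt h x) :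
    ContinuousAt (fun y => (h y).toReal) x := by
  obtain ⟨δ, hδ, K, r, hr, hK⟩ := hx
  refine (hK.continuousOn.continuousAt (Metric.ball_mem_nhds x hδ)).congr ?_
  filter_upwards [Metric.ball_mem_nhds x hδ] with y hy
  rw [hr y hy, EReal.toReal_coe]

namespace Problem.Standing

variable {n m : ℕ} {P : Problem n m} (hP : P.Standing)
include hP

theorem continuous_g (i : Fin m) : Continuous (P.g i) :=
  continuous_iff_continuousAt.2 fun x => by
    simpa using (hP.g_lipschitz i x).continuousAt_toReal

theorem isClosed_feasible : IsClosed P.feasible := by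
  have : P.feasible = ⋂ i, {x | P.g i x ≤ 0} := by
    ext x
    simp [feasible]
  rw [this]
  exact isClosed_iInter fun i => isClosed_le (hP.continuous_g i) continuous_const

theorem F_eq {x : Vec n} (hx : x ∈ P.feasible) :
    P.F x = (((P.g0 x).toReal + P.φ x : ℝ) : EReal) := by
  rw [F, if_pos hx, add_zero, EReal.coe_add,
    (hP.g0_lipschitz x (hP.feasible_subset hx)).coe_toReal]

theorem continuousOn_g0 : ContinuousOn (fun x => (P.g0 x).toReal) P.O := fun x hx =>
  (hP.g0_lipschitz x hx).continuousAt_toReal.continuousWithinAt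

theorem exists_descent_constant_g (K : Set (Vec n)) (hK : IsCompact K) :
    ∃ ρ : ℝ, 0 ≤ ρ ∧ ∀ i, ∀ a ∈ K, ∀ z ∈ K, ∀ v ∈ limSubdiff (fun x => (P.g i x : EReal)) a,
      P.g i z ≤ P.g i a + ⟪v, z - a⟫ + ρ / 2 * ‖z - a‖ ^ 2 := by
  have h1 : ∀ i, ∃ ρ : ℝ, 0 ≤ ρ ∧ ∀ a ∈ K, ∀ z ∈ K,
      ∀ v ∈ limSubdiff (fun x => (P.g i x : EReal)) a,
      P.g i z ≤ P.g i a + ⟪v, z - a⟫ + ρ / 2 * ‖z - a‖ ^ 2 := fun i => by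
    simpa using exists_descent_constant hK (fun x _ => hP.g_upperC2 i x)
      (by simpa using (hP.continuous_g i).continuousOn)
  choose ρ hρ0 hρ using h1
  refine ⟨∑ i, ρ i, Finset.sum_nonneg fun i _ => hρ0 i, fun i a ha z hz v hv =>
    (hρ i a ha z hz v hv).trans ?_⟩
  gcongr
  exact Finset.single_le_sum (fun j _ => hρ0 j) (Finset.mem_univ i)

end Problem.Standing

namespace Run

variable {n m : ℕ} {R : Run n m} {P : Problem n m} {p : Params}

theorem IsGenerated.feasible (hR : R.IsGenerated P p) (k : ℕ) : R.x k ∈ P.feasible := by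
  cases k with
  | zero => exact hR.start
  | succ k =>
    rw [hR.next k]
    exact (hR.accept k).1

theorem IsGenerated.μ_ge (hR : R.IsGenerated P p) (hp : p.Valid) (k : ℕ) :
    ∀ j ≤ R.J k, p.μmin ≤ R.μ k j := by
  intro j
  induction j with
  | zero => exact fun _ => (hR.μ_init k).1
  | succ j ih =>
    intro hj
    have h1 := ih (by omega)
    by_cases hy : R.y k j ∈ P.feasible
    · rw [(hR.update_μ k j (by omega) hy).2]
      nlinarith [hp.τ_gt, hp.μmin_pos]
    · rw [(hR.update_L k j (by omega) hy).2]
      exact h1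

theorem IsGenerated.L_ge (hR : R.IsGenerated P p) (hp : p.Valid) (k : ℕ) :
    ∀ j ≤ R.J k, ∀ i, p.Lmin ≤ R.L k j i := by
  intro j
  induction j with
  | zero => exact fun _ i => (hR.L_init k i).1
  | succ j ih =>
    intro hj i
    have h1 := ih (by omega) i
    by_cases hy : R.y k j ∈ P.feasible
    · rw [(hR.update_μ k j (by omega) hy).1]
      exact h1
    · rw [(hR.update_L k j (by omega) hy).1, PiLp.smul_apply, smul_eq_mul]
      nlinarith [hp.τ_gt, hp.Lmin_pos]

theorem IsGenerated.L_nonneg (hR : R.IsGenerated P p) (hp : p.Valid) {k j : ℕ}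
    (hj : j ≤ R.J k) (i : Fin m) : 0 ≤ R.L k j i :=
  hp.Lmin_pos.le.trans (hR.L_ge hp k j hj i)

theorem IsGenerated.Q_ge (hR : R.IsGenerated P p) (hp : p.Valid) {k j : ℕ} (hj : j ≤ R.J k)
    (d : Vec n) : p.μmin * ‖d‖ ^ 2 ≤ ⟪d, R.Q k j d⟫ :=
  (mul_le_mul_of_nonneg_right (hR.μ_ge hp k j hj) (by positivity)).trans
    (mul_sq_le_inner (hR.Q_lower k j hj) d)

theorem IsGenerated.x_mem_subFeasible (hR : R.IsGenerated P p) (k : ℕ) (V : Mat n m) (L : Vec m) :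
    R.x k ∈ P.subFeasible (R.x k) V L := fun i => by
  rw [P.G_self]
  exact hR.feasible k i

/-- The iterates, the trial points and the exact solutions lie in one ball, and the subgradients of
`g₀` that are used are bounded. -/
theorem IsGenerated.exists_bound (hR : R.IsGenerated P p) (hP : P.Standing) (hp : p.Valid)
    {xb : ℕ → ℕ → Vec n} (hxb : R.IsExactSolution P xb)
    (hbdd : Bornology.IsBounded (range R.x)) :
    ∃ B : ℝ, 0 ≤ B ∧ ∀ k, ‖R.x k‖ ≤ B ∧ ‖R.ξ k‖ ≤ B ∧
      ∀ j ≤ R.J k, ‖R.y k j‖ ≤ B ∧ ‖xb k j‖ ≤ B := by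
  obtain ⟨B₀, hB₀⟩ := hbdd.exists_norm_le
  have hx : ∀ k, ‖R.x k‖ ≤ B₀ := fun k => hB₀ _ (mem_range_self k)
  have hK : IsCompact (P.feasible ∩ Metric.closedBall 0 B₀) :=
    (isCompact_closedBall _ _).inter_left hP.isClosed_feasible
  obtain ⟨B₁, hB₁, hξ⟩ := exists_bound_limSubdiff hK
    (fun x hx => hP.g0_upperC2 x (hP.feasible_subset hx.1))
  obtain ⟨B₂, hB₂, hw⟩ := exists_bound_isSubgradientAt hP.φ_convex B₀
  have hξ' : ∀ k, ‖R.ξ k‖ ≤ B₁ := fun k =>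
    hξ (R.x k) ⟨hR.feasible k, by simpa using hx k⟩ _ (hR.ξ_mem k)
  have hB₀' : 0 ≤ B₀ := (norm_nonneg _).trans (hx 0)
  have hdist : 0 ≤ 2 * (B₁ + B₂) / p.μmin := by have := hp.μmin_pos; positivity
  have key : ∀ k, ∀ j ≤ R.J k, ∀ y, P.subObj (R.x k) (R.ξ k) (R.Q k j) y ≤
      P.subObj (R.x k) (R.ξ k) (R.Q k j) (R.x k) → ‖y‖ ≤ B₀ + 2 * (B₁ + B₂) / p.μmin := by
    intro k j hj y hy
    obtain ⟨w, hw'⟩ := exists_isSubgradientAt hP.φ_convex (R.x k)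
    have h1 := Problem.norm_sub_le_of_subObj_le hp.μmin_pos (hR.Q_ge hp hj) hw' hy
    have h2 : 2 * (‖R.ξ k‖ + ‖w‖) / p.μmin ≤ 2 * (B₁ + B₂) / p.μmin := by
      have := hp.μmin_pos
      gcongr
      · exact hξ' k
      · exact hw _ _ (hx k) hw'
    have h3 := norm_add_le (R.x k) (y - R.x k)
    rw [add_sub_cancel] at h3
    linarith [hx k]
  refine ⟨B₀ + 2 * (B₁ + B₂) / p.μmin + B₁, by positivity, fun k => ⟨?_, ?_, fun j hj => ⟨?_, ?_⟩⟩⟩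
  · linarith [hx k]
  · linarith [hξ' k]
  · linarith [key k j hj _ (hR.inexact_obj k j hj)]
  · linarith [key k j hj _ ((hxb k j hj).2 (hR.x_mem_subFeasible k _ _))]

/-- Along the inner loops the coefficients `L` stay bounded: trial points are feasible as soon as
`L` dominates the curvature of the constraints. -/
theorem IsGenerated.exists_L_bound (hR : R.IsGenerated P p) (hP : P.Standing) (hp : p.Valid)
    {B : ℝ} (hB : ∀ k, ‖R.x k‖ ≤ B ∧ ∀ j ≤ R.J k, ‖R.y k j‖ ≤ B) :
    ∃ C : ℝ, 0 ≤ C ∧ ∀ k, ∀ j ≤ R.J k, ∀ i, R.L k j i ≤ C := by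
  obtain ⟨ρ, hρ0, hρ⟩ := hP.exists_descent_constant_g _ (isCompact_closedBall (0 : Vec n) B)
  have hτ0 : 0 < p.τ := one_pos.trans hp.τ_gt
  have hL0 := hp.Lmin_pos
  have hβ := hp.βC_pos
  set T := max 1 (p.τ * (ρ + p.βC) / p.Lmin) with hT
  have hT1 : 1 ≤ T := le_max_left _ _
  have key : ∀ k, ∀ j ≤ R.J k, ∃ t : ℝ, 1 ≤ t ∧ t ≤ T ∧ ∀ i, R.L k j i = t * R.L k 0 i := by
    intro k j
    induction j with
    | zero => exact fun _ => ⟨1, le_rfl, hT1, fun i => (one_mul _).symm⟩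
    | succ j ih =>
      intro hj
      obtain ⟨t, ht1, htT, ht⟩ := ih (by omega)
      by_cases hy : R.y k j ∈ P.feasible
      · rw [(hR.update_μ k j (by omega) hy).1]
        exact ⟨t, ht1, htT, ht⟩
      · refine ⟨p.τ * t, by nlinarith [hp.τ_gt], ?_, fun i => ?_⟩
        · obtain ⟨i, hi⟩ : ∃ i, 0 < P.g i (R.y k j) := by
            by_contra! hcon
            exact hy hcon
          have h1 := hρ i (R.x k) (by simpa using (hB k).1) (R.y k j)
            (by simpa using (hB k).2 j (by omega)) _ (hR.V_mem k i)
          have h2 := (P.G_le_residC i).trans (hR.inexact_C k j (by omega))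
          rw [P.G_apply] at h2
          have h3 : 0 < (ρ + p.βC - R.L k j i) * ‖R.y k j - R.x k‖ ^ 2 := by linarith
          have h4 : R.L k j i < ρ + p.βC := by
            have := pos_of_mul_pos_left h3 (by positivity)
            linarith
          have h5 : t * p.Lmin ≤ ρ + p.βC := by
            have h6 := (hR.L_init k i).1
            have h7 := mul_le_mul_of_nonneg_left h6 (by linarith : (0 : ℝ) ≤ t)
            rw [ht i] at h4
            linarith
          refine le_trans ?_ (le_max_right _ _)
          rw [le_div_iff₀ hL0]
          nlinarith
        · rw [(hR.update_L k j (by omega) hy).1, PiLp.smul_apply, smul_eq_mul, ht i, mul_assoc]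
  have hLmax : 0 < p.Lmax := hL0.trans_le hp.Lmin_le
  refine ⟨T * p.Lmax, by positivity, fun k j hj i => ?_⟩
  obtain ⟨t, ht1, htT, ht⟩ := key k j hj
  rw [ht i]
  have h1 := (hR.L_init k i).1
  exact mul_le_mul htT (hR.L_init k i).2 (hL0.le.trans h1) (by linarith)

/-- The descent inequality for `g₀` holds with one constant at all feasible trial points. -/
theorem IsGenerated.exists_descent (hR : R.IsGenerated P p) (hP : P.Standing)
    {B : ℝ} (hB : ∀ k, ‖R.x k‖ ≤ B ∧ ∀ j ≤ R.J k, ‖R.y k j‖ ≤ B) :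
    ∃ ρ : ℝ, 0 ≤ ρ ∧ ∀ k, ∀ j ≤ R.J k, R.y k j ∈ P.feasible →
      (P.g0 (R.y k j)).toReal ≤ (P.g0 (R.x k)).toReal + ⟪R.ξ k, R.y k j - R.x k⟫
        + ρ / 2 * ‖R.y k j - R.x k‖ ^ 2 := by
  have hK : IsCompact (P.feasible ∩ Metric.closedBall 0 B) :=
    (isCompact_closedBall _ _).inter_left hP.isClosed_feasible
  obtain ⟨ρ, hρ0, hρ⟩ := exists_descent_constant hK
    (fun x hx => hP.g0_upperC2 x (hP.feasible_subset hx.1))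
    (hP.continuousOn_g0.mono fun x hx => hP.feasible_subset hx.1)
  exact ⟨ρ, hρ0, fun k j hj hy => hρ _ ⟨hR.feasible k, by simpa using (hB k).1⟩ _
    ⟨hy, by simpa using (hB k).2 j hj⟩ _ (hR.ξ_mem k)⟩

/-- Along the inner loops the coefficients `μ` stay bounded: feasible trial points are accepted as
soon as `μ` dominates the curvature of `g₀`. -/
theorem IsGenerated.exists_μ_bound (hR : R.IsGenerated P p) (hP : P.Standing) (hp : p.Valid)
    {B : ℝ} (hB : ∀ k, ‖R.x k‖ ≤ B ∧ ∀ j ≤ R.J k, ‖R.y k j‖ ≤ B) :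
    ∃ C : ℝ, 0 ≤ C ∧ ∀ k, ∀ j ≤ R.J k, R.μ k j ≤ C := by
  obtain ⟨ρ, hρ0, hρ⟩ := hR.exists_descent hP hB
  have hτ0 : 0 < p.τ := one_pos.trans hp.τ_gt
  have hα := hp.α_pos
  refine ⟨max p.μmax (p.τ * (ρ + p.α)), le_max_of_le_right (by positivity), fun k j => ?_⟩
  induction j with
  | zero => exact fun _ => le_max_of_le_left (hR.μ_init k).2
  | succ j ih =>
    intro hj
    have hj' : j ≤ R.J k := by omega
    have h1 := ih hj'
    by_cases hy : R.y k j ∈ P.feasible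
    · rw [(hR.update_μ k j (by omega) hy).2]
      refine le_max_of_le_right (mul_le_mul_of_nonneg_left ?_ hτ0.le)
      by_contra! hlt
      refine hR.not_accept k j (by omega) ⟨hy, ?_⟩
      rw [hP.F_eq hy, hP.F_eq (hR.feasible k), ← EReal.coe_sub, EReal.coe_le_coe_iff]
      have h2 := hρ k j hj' hy
      have h3 := hR.inexact_obj k j hj'
      rw [P.subObj_self, Problem.subObj, Problem.model] at h3
      have h4 := mul_sq_le_inner (hR.Q_lower k j hj') (R.y k j - R.x k)
      have h5 := mul_le_mul_of_nonneg_right hlt.le (sq_nonneg ‖R.y k j - R.x k‖)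
      linarith
    · rw [(hR.update_L k j (by omega) hy).2]
      exact h1

theorem IsGenerated.Q_symm (hR : R.IsGenerated P p) {k j : ℕ} (hj : j ≤ R.J k) (a b : Vec n) :
    ⟪R.Q k j a, b⟫ = ⟪a, R.Q k j b⟫ := inner_symm_of_isPositive (hR.Q_lower k j hj) a b

theorem IsGenerated.exists_V_bound (hR : R.IsGenerated P p) (hP : P.Standing)
    {B : ℝ} (hB : ∀ k, ‖R.x k‖ ≤ B) : ∃ C : ℝ, 0 ≤ C ∧ ∀ k, ‖R.V k‖ ≤ C := by
  have h1 : ∀ i, ∃ C : ℝ, 0 ≤ C ∧ ∀ k, ‖R.V k i‖ ≤ C := fun i => by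
    obtain ⟨C, hC0, hC⟩ := exists_bound_limSubdiff (isCompact_closedBall (0 : Vec n) B)
      (fun x _ => hP.g_upperC2 i x)
    exact ⟨C, hC0, fun k => hC (R.x k) (by simpa using hB k) _ (hR.V_mem k i)⟩
  choose C hC0 hC using h1
  refine ⟨Real.sqrt (∑ i, C i ^ 2), Real.sqrt_nonneg _, fun k => ?_⟩
  rw [PiLp.norm_eq_of_L2]
  exact Real.sqrt_le_sqrt (Finset.sum_le_sum fun i _ =>
    pow_le_pow_left₀ (norm_nonneg _) (hC i k) 2)

theorem IsGenerated.exists_Q_bound (hR : R.IsGenerated P p) (hp : p.Valid)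
    {C : ℝ} (hC0 : 0 ≤ C) (hC : ∀ k, ∀ j ≤ R.J k, R.μ k j ≤ C) :
    ∃ C' : ℝ, 0 < C' ∧ ∀ k, ∀ j ≤ R.J k, ‖R.Q k j‖ ≤ C' := by
  have hM := hp.M_pos
  have hμ := hp.μmin_pos
  refine ⟨C + p.M, by positivity, fun k j hj => opNorm_le_of_le (by positivity)
    (hR.Q_symm hj) (fun d => ?_) (fun d => ?_)⟩
  · exact le_trans (by positivity) (hR.Q_ge hp hj d)
  · refine (inner_le_mul_sq (hR.Q_upper k j hj) d).trans ?_
    gcongr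
    exact hC k j hj

theorem IsGenerated.u_mem_paramSet (hR : R.IsGenerated P p) (hp : p.Valid) (k : ℕ) :
    R.u k ∈ paramSet n m := by
  refine ⟨fun i => hR.L_nonneg hp le_rfl i, ?_⟩
  rw [ContinuousLinearMap.isPositive_iff]
  refine ⟨fun a b => hR.Q_symm le_rfl a b, fun d => ?_⟩
  rw [real_inner_comm]
  have := hp.μmin_pos
  exact le_trans (by positivity) (hR.Q_ge hp le_rfl d)

/-- The optimality condition of the final subproblem of an outer iteration, in terms of the normal
cone to the feasible set. -/
theorem IsGenerated.exists_neg_mem_normalCone (hR : R.IsGenerated P p) (hP : P.Standing)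
    (hp : p.Valid) {xb : ℕ → ℕ → Vec n} (hxb : R.IsExactSolution P xb) (k : ℕ) :
    ∃ v, IsSubgradientAt P.φ (xb k (R.J k)) v ∧
      -(R.ξ k + R.Q k (R.J k) (xb k (R.J k) - R.x k) + v) ∈
        normalCone (P.S (R.u k)) (xb k (R.J k)) := by
  have hfeas := (hxb k (R.J k) le_rfl).1
  have hmin := (hxb k (R.J k) le_rfl).2
  have hconv := P.convex_subFeasible (s := R.x k) (V := R.V k)
    (hR.L_nonneg hp (le_refl (R.J k)))
  set x := xb k (R.J k)
  set Q := R.Q k (R.J k)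
  have h1 := le_add_inner_of_isMinOn (f := P.model (R.x k) (R.ξ k) Q) (c := 1 / 2 * ‖Q‖)
    (a := R.ξ k + Q (x - R.x k)) hP.φ_convex hconv hfeas (fun d => by
      have h2 := Problem.model_expansion (P := P) (ξ := R.ξ k) (s := R.x k)
        (hR.Q_symm (le_refl (R.J k))) x (x + d)
      rw [add_sub_cancel_left] at h2
      have h3 := real_inner_le_norm d (Q d)
      have h4 := Q.le_opNorm d
      have h5 : ⟪d, Q d⟫ ≤ ‖Q‖ * ‖d‖ ^ 2 := by nlinarith [norm_nonneg d]
      rw [h2]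
      linarith) (fun z hz => hmin hz)
  obtain ⟨v, hv, hv'⟩ := exists_subgradient_of_minimizer hP.φ_convex hconv hfeas h1
  refine ⟨v, hv, hfeas, fun z hz => ?_⟩
  have := hv' z hz
  rw [inner_neg_left]
  linarith

/-- By the partial bounded multiplier property and compactness, the exact solutions of the final
subproblems eventually have uniformly bounded multipliers. -/
theorem IsGenerated.exists_multipliers (hR : R.IsGenerated P p) (hP : P.Standing)
    (hp : p.Valid) {xb : ℕ → ℕ → Vec n} (hxb : R.IsExactSolution P xb)
    (hBMP : R.BMPAtClusterPoints P xb)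
    {B : ℝ} (hB : ∀ k, ‖R.x k‖ ≤ B ∧ ‖R.ξ k‖ ≤ B ∧ ‖xb k (R.J k)‖ ≤ B)
    {C : ℝ} (hL : ∀ k i, R.L k (R.J k) i ≤ C) (hV : ∀ k, ‖R.V k‖ ≤ C)
    (hQ : ∀ k, ‖R.Q k (R.J k)‖ ≤ C) :
    ∃ Λ : ℝ, ∀ᶠ k in atTop, ∃ v lam, ‖lam‖ ≤ Λ ∧
      P.IsKKT (R.x k) (R.ξ k) (R.V k) (R.Q k (R.J k)) (R.L k (R.J k)) (xb k (R.J k)) v lam := by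
  obtain ⟨B₂, hB₂, hw⟩ := exists_bound_isSubgradientAt hP.φ_convex B
  have hC0 : 0 ≤ C := (norm_nonneg _).trans (hV 0)
  set E := max (max B C) (Real.sqrt (∑ _i : Fin m, C ^ 2)) with hE
  have hBE : B ≤ E := (le_max_left _ _).trans (le_max_left _ _)
  have hCE : C ≤ E := (le_max_right _ _).trans (le_max_left _ _)
  have hLn : ∀ k, ‖R.L k (R.J k)‖ ≤ E := fun k => by
    refine le_trans ?_ (le_max_right _ _)
    rw [EuclideanSpace.norm_eq]
    refine Real.sqrt_le_sqrt (Finset.sum_le_sum fun i _ => ?_)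
    refine pow_le_pow_left₀ (norm_nonneg _) ?_ 2
    rw [Real.norm_of_nonneg (hR.L_nonneg hp le_rfl i)]
    exact hL k i
  have hmem : ∀ k, (R.u k, xb k (R.J k)) ∈
      Metric.closedBall (0 : ParamSpace n m × Vec n) E := fun k => by
    rw [mem_closedBall_zero_iff]
    simp only [Prod.norm_def, Run.u, max_le_iff]
    exact ⟨⟨(hB k).1.trans hBE, hLn k, (hV k).trans hCE, (hB k).2.1.trans hBE,
      (hQ k).trans hCE⟩, (hB k).2.2.trans hBE⟩
  refine exists_eventually_of_mapClusterPt (isCompact_closedBall _ _) hmem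
    (p := fun Λ k => ∃ v lam, ‖lam‖ ≤ Λ ∧ P.IsKKT (R.x k) (R.ξ k) (R.V k) (R.Q k (R.J k))
      (R.L k (R.J k)) (xb k (R.J k)) v lam) ?_ ?_
  · rintro Λ Λ' k hΛ ⟨v, lam, hlam, h⟩
    exact ⟨v, lam, hlam.trans hΛ, h⟩
  · rintro ⟨us, xs⟩ hcl
    obtain ⟨-, -, κ, hκ, U, hU, W, hW, hbmp⟩ := hBMP us xs hcl
    refine ⟨κ * (B + C * (B + B) + B₂), U ×ˢ W, prod_mem_nhds hU hW,
      Eventually.of_forall fun k hk => ?_⟩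
    obtain ⟨v, hv, hN⟩ := hR.exists_neg_mem_normalCone hP hp hxb k
    obtain ⟨lam, ⟨hlam, hst⟩, hnorm⟩ := hbmp (R.u k) ⟨hk.1, hR.u_mem_paramSet hp k⟩
      (xb k (R.J k)) ⟨hk.2, (hxb k _ le_rfl).1⟩ _ hN
    obtain ⟨h1, h2, h3⟩ := Problem.mem_normalCone_nonposOrthant hlam
    refine ⟨v, lam, ?_, hv, h1, h2, h3, ?_⟩
    · rw [mem_closedBall_zero_iff, norm_neg] at hnorm
      refine hnorm.trans (mul_le_mul_of_nonneg_left ?_ hκ.le)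
      have h4 : ‖R.Q k (R.J k) (xb k (R.J k) - R.x k)‖ ≤ C * (B + B) :=
        (ContinuousLinearMap.le_opNorm _ _).trans (mul_le_mul (hQ k)
          ((norm_sub_le _ _).trans (add_le_add (hB k).2.2 (hB k).1)) (norm_nonneg _) hC0)
      exact (norm_add₃_le).trans (add_le_add_three (hB k).2.1 h4 (hw _ _ (hB k).2.2 hv))
    · have h5 : nabla (fun x => P.G x (R.x k) (R.V k) (R.L k (R.J k))) (xb k (R.J k)) lam =
          -(R.ξ k + R.Q k (R.J k) (xb k (R.J k) - R.x k) + v) := hst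
      rw [P.nabla_G] at h5
      rw [Problem.lagrangeGrad, h5, add_neg_cancel]

end Run

/-! ### Subgradients of the potential function -/

section Potential

theorem mem_regSubdiff_of_quadratic_minorant {X : Type*} [NormedAddCommGroup X]
    [InnerProductSpace ℝ X] {h : X → EReal} {x w : X} {r K : ℝ} (hr : h x = r)
    (hle : ∀ x', ((r + (⟪w, x' - x⟫ - K * ‖x' - x‖ ^ 2) : ℝ) : EReal) ≤ h x') :
    w ∈ regSubdiff h x := by
  refine ⟨by rw [hr]; exact EReal.coe_ne_top r, by rw [hr]; exact EReal.coe_ne_bot r,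
    fun ε hε => ?_⟩
  have hsmall : ∀ᶠ x' in 𝓝 x, K * ‖x' - x‖ < ε := by
    have : Tendsto (fun z : X => K * ‖z - x‖) (𝓝 x) (𝓝 (K * ‖x - x‖)) :=
      Continuous.tendsto (by fun_prop) x
    rw [sub_self, norm_zero, mul_zero] at this
    exact this.eventually (gt_mem_nhds hε)
  filter_upwards [hsmall] with x' hx'
  refine le_trans ?_ (hle x')
  rw [hr, ← EReal.coe_add, EReal.coe_le_coe_iff]
  nlinarith [norm_nonneg (x' - x)]

variable {n m : ℕ}

/-- The common form of the functions `T₀` and `Tᵢ` (without the proximal term):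
`⟪v,x⟫ + f(s) - ⟪∇f(s),s⟫ + h*(-v + ∇f(s))`. -/
noncomputable def tilt (f h : Vec n → ℝ) (x s v : Vec n) : ℝ :=
  ⟪v, x⟫ + f s - ⟪gradient f s, s⟫ + conj h (-v + gradient f s)

theorem tilt_eq {f h : Vec n → ℝ} {s v : Vec n} (hs : IsSubgradientAt h s (gradient f s - v))
    (x : Vec n) : tilt f h x s v = f s - h s + ⟪v, x - s⟫ := by
  have e : -v + gradient f s = gradient f s - v := by abel
  rw [tilt, e, conj_eq_of_isSubgradientAt hs, inner_sub_right, inner_sub_right,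
    real_inner_comm s v, real_inner_comm s (gradient f s)]
  ring

/-- The Fenchel–Young inequality bounds `tilt` below by an expression in which the dependence on the
base point is of second order only. -/
theorem exists_le_tilt {f h : Vec n → ℝ} (hf : IsStronglyConvexQuadratic f)
    (hh : ∃ σ : ℝ, 0 < σ ∧ StrongConvexOn univ σ h) :
    ∃ K : ℝ, 0 ≤ K ∧ ∀ s s' x' v', f s - h s + ⟪v', x' - s⟫ - K * ‖s' - s‖ ^ 2
      ≤ tilt f h x' s' v' := by
  obtain ⟨A, -, hexp⟩ := hf.exists_expansion
  obtain ⟨σ, hσ, hh⟩ := hh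
  refine ⟨1 / 2 * ‖A‖, by positivity, fun s s' x' v' => ?_⟩
  have h1 := inner_sub_le_conj hσ hh s (-v' + gradient f s')
  have h2 := hexp s' s
  have h3 : ⟪s - s', A (s - s')⟫ ≤ ‖A‖ * ‖s' - s‖ ^ 2 := by
    rw [norm_sub_rev s' s]
    nlinarith [real_inner_le_norm (s - s') (A (s - s')), A.le_opNorm (s - s'),
      norm_nonneg (s - s')]
  rw [inner_add_right, inner_neg_right, real_inner_comm v' s,
    real_inner_comm (gradient f s') s] at h1
  rw [inner_sub_right] at h2
  rw [tilt, inner_sub_right]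
  linarith

theorem norm_mkZ_le (x s : Vec n) (V : Mat n m) (L : Vec m) (ξ : Vec n) :
    ‖mkZ x s V L ξ‖ ≤ ‖x‖ + (‖s‖ + (‖V‖ + (‖L‖ + ‖ξ‖))) := by
  have key : ∀ {A B : Type} [NormedAddCommGroup A] [NormedAddCommGroup B] (a : A) (b : B),
      ‖WithLp.toLp 2 (a, b)‖ ≤ ‖a‖ + ‖b‖ := by
    intro A B _ _ a b
    refine abs_le_of_sq_le_sq' ?_ (by positivity) |>.2
    rw [WithLp.prod_norm_sq_eq_of_L2]
    show ‖a‖ ^ 2 + ‖b‖ ^ 2 ≤ (‖a‖ + ‖b‖) ^ 2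
    nlinarith [norm_nonneg a, norm_nonneg b]
  refine (key _ _).trans (add_le_add le_rfl ((key _ _).trans (add_le_add le_rfl
    ((key _ _).trans (add_le_add le_rfl (key _ _))))))

theorem norm_components_le (z : ZSpace n m) :
    ‖z.fst‖ ≤ ‖z‖ ∧ ‖z.snd.fst‖ ≤ ‖z‖ ∧ ‖z.snd.snd.fst‖ ≤ ‖z‖ ∧ ‖z.snd.snd.snd.fst‖ ≤ ‖z‖ ∧
      ‖z.snd.snd.snd.snd‖ ≤ ‖z‖ := by
  have key : ∀ {A B : Type} [NormedAddCommGroup A] [NormedAddCommGroup B] (a : WithLp 2 (A × B)),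
      ‖a.fst‖ ≤ ‖a‖ ∧ ‖a.snd‖ ≤ ‖a‖ := by
    intro A B _ _ a
    have h := WithLp.prod_norm_sq_eq_of_L2 a
    constructor
    · refine abs_le_of_sq_le_sq' ?_ (by positivity) |>.2
      nlinarith [sq_nonneg ‖a.snd‖]
    · refine abs_le_of_sq_le_sq' ?_ (by positivity) |>.2
      nlinarith [sq_nonneg ‖a.fst‖]
  have h1 := (key z).2
  have h2 := (key z.snd).2.trans h1
  have h3 := (key z.snd.snd).2.trans h2
  exact ⟨(key z).1, (key z.snd).1.trans h1, (key z.snd.snd).1.trans h2,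
    (key z.snd.snd.snd).1.trans h3, (key z.snd.snd.snd).2.trans h3⟩

theorem inner_mkZ (x s : Vec n) (V : Mat n m) (L : Vec m) (ξ : Vec n) (z : ZSpace n m) :
    ⟪mkZ x s V L ξ, z⟫ = ⟪x, z.fst⟫ + (⟪s, z.snd.fst⟫ + (∑ i, ⟪V i, z.snd.snd.fst i⟫ +
      (∑ i, L i * z.snd.snd.snd.fst i + ⟪ξ, z.snd.snd.snd.snd⟫))) := by
  rw [← inner_vec_eq_sum, ← PiLp.inner_apply, WithLp.prod_inner_apply, WithLp.prod_inner_apply,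
    WithLp.prod_inner_apply, WithLp.prod_inner_apply]
  rfl

/-- The second-order expansion from below of one constraint component of the potential function. -/
theorem component_minorant {e dx ds v dv : Vec n} {l dl N K : ℝ} (hl : 0 ≤ l + dl)
    (hx : ‖dx‖ ≤ N) (hs : ‖ds‖ ≤ N) (hv : ‖dv‖ ≤ N) (hdl : |dl| ≤ N) (hK : 0 ≤ K) :
    ⟪v, e⟫ + 1 / 2 * ‖e‖ ^ 2 * l + ⟪v + l • e, dx⟫ - l * ⟪e, ds⟫ + ⟪e, dv⟫
        + 1 / 2 * ‖e‖ ^ 2 * dl - (K + 1 + 2 * ‖e‖) * N ^ 2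
      ≤ ⟪v + dv, e + dx⟫ - K * ‖ds‖ ^ 2 + 1 / 2 * ‖e + (dx - ds)‖ ^ 2 * (l + dl) := by
  have hN : 0 ≤ N := (norm_nonneg _).trans hx
  have h1 : -(N ^ 2) ≤ ⟪dv, dx⟫ := by
    have h2 := (abs_le.1 (abs_real_inner_le_norm dv dx)).1
    have h3 : ‖dv‖ * ‖dx‖ ≤ N * N := mul_le_mul hv hx (norm_nonneg _) hN
    nlinarith
  have h2 : K * ‖ds‖ ^ 2 ≤ K * N ^ 2 := by gcongr
  have h3 : -(2 * ‖e‖ * N ^ 2) ≤ dl * ⟪e, dx - ds⟫ := by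
    have h4 : |dl * ⟪e, dx - ds⟫| ≤ N * (‖e‖ * (N + N)) := by
      rw [abs_mul]
      refine mul_le_mul hdl ((abs_real_inner_le_norm _ _).trans ?_) (abs_nonneg _) hN
      exact mul_le_mul_of_nonneg_left ((norm_sub_le _ _).trans (add_le_add hx hs)) (norm_nonneg _)
    have := (abs_le.1 h4).1
    nlinarith
  have h4 : 0 ≤ 1 / 2 * ‖dx - ds‖ ^ 2 * (l + dl) := by positivity
  rw [norm_add_sq_real]
  rw [inner_sub_right] at *
  simp only [inner_add_left, inner_add_right, inner_smul_left, conj_trivial]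
  rw [real_inner_comm dv e] at *
  nlinarith

namespace Decomposition

variable {d : Decomposition n m} {P : Problem n m} {D : Set (Vec n)}

theorem T_apply (x s : Vec n) (V : Mat n m) (L : Vec m) (i : Fin m) :
    d.T x s V L i = tilt (d.f i) (d.h i) x s (V i) + 1 / 2 * ‖x - s‖ ^ 2 * L i := rfl

theorem T0_eq_tilt (x s ξ : Vec n) : d.T0 x s ξ = tilt d.f0 d.h0 x s ξ := rfl

theorem convexOn_of_exists {h : Vec n → ℝ} (hh : ∃ σ : ℝ, 0 < σ ∧ StrongConvexOn univ σ h) :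
    ConvexOn ℝ univ h := by
  obtain ⟨σ, hσ, hh⟩ := hh
  exact strongConvexOn_zero.1 (hh.mono hσ.le)

/-- At base points `s ∈ D` and at subgradients, `T₀` is the linearization of `g₀`. -/
theorem IsDecompositionOn.T0_eq (hd : d.IsDecompositionOn P D) {s ξ : Vec n} (hs : s ∈ D)
    (hξ : IsSubgradientAt d.h0 s (gradient d.f0 s - ξ)) (x : Vec n) :
    d.T0 x s ξ = (P.g0 s).toReal + ⟪ξ, x - s⟫ := by
  rw [T0_eq_tilt, tilt_eq hξ, hd.g0_eq s hs, EReal.toReal_coe]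

/-- At base points `s ∈ D` and at subgradients, `T` is the constraint mapping of the subproblem. -/
theorem IsDecompositionOn.T_eq (hd : d.IsDecompositionOn P D) {s : Vec n} {V : Mat n m}
    (hs : s ∈ D) (hV : ∀ i, IsSubgradientAt (d.h i) s (gradient (d.f i) s - V i)) (x : Vec n)
    (L : Vec m) (i : Fin m) : d.T x s V L i = P.G x s V L i := by
  rw [T_apply, tilt_eq (hV i), P.G_apply, hd.g_eq i s hs]

theorem Phi_mkZ {φ : Vec n → ℝ} {x s : Vec n} {V : Mat n m} {L : Vec m} {ξ : Vec n}
    (hL : ∀ i, 0 ≤ L i) (hT : ∀ i, d.T x s V L i ≤ 0) :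
    d.Phi φ (mkZ x s V L ξ) = ((φ x + d.T0 x s ξ : ℝ) : EReal) :=
  if_pos ⟨hL, hT⟩

theorem IsDecompositionOn.Phi_eq (hd : d.IsDecompositionOn P D) {x s : Vec n} {V : Mat n m}
    {L : Vec m} {ξ : Vec n} (hs : s ∈ D)
    (hξ : IsSubgradientAt d.h0 s (gradient d.f0 s - ξ))
    (hV : ∀ i, IsSubgradientAt (d.h i) s (gradient (d.f i) s - V i))
    (hL : ∀ i, 0 ≤ L i) (hG : ∀ i, P.G x s V L i ≤ 0) :
    d.Phi P.φ (mkZ x s V L ξ) = ((P.φ x + ((P.g0 s).toReal + ⟪ξ, x - s⟫) : ℝ) : EReal) := by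
  rw [Phi_mkZ hL (fun i => by rw [hd.T_eq hs hV]; exact hG i), hd.T0_eq hs hξ]

/-- A multiplier for the subproblem yields a regular subgradient of the potential function, because
`Φ` dominates its Lagrangian `φ + T₀ + ⟪lam, T⟫` with equality at the point itself. -/
theorem IsDecompositionOn.mem_regSubdiff_Phi (hd : d.IsDecompositionOn P D) {x s : Vec n}
    {V : Mat n m} {L : Vec m} {ξ : Vec n} (hs : s ∈ D)
    (hξ : IsSubgradientAt d.h0 s (gradient d.f0 s - ξ))
    (hV : ∀ i, IsSubgradientAt (d.h i) s (gradient (d.f i) s - V i))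
    (hL : ∀ i, 0 ≤ L i) {Q : Vec n →L[ℝ] Vec n} {v : Vec n} {lam : Vec m}
    (hkkt : P.IsKKT s ξ V Q L x v lam) :
    mkZ (-Q (x - s)) (-((∑ i, lam i * L i) • (x - s)))
      (WithLp.toLp 2 fun i => lam i • (x - s)) ((1 / 2 * ‖x - s‖ ^ 2) • lam) (x - s) ∈
        regSubdiff (d.Phi P.φ) (mkZ x s V L ξ) := by
  obtain ⟨K₀, hK₀, hle₀⟩ := exists_le_tilt hd.f0_quad hd.h0_strong
  choose K hK hle using fun i => exists_le_tilt (hd.f_quad i) (hd.h_strong i)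
  set e := x - s with he
  refine mem_regSubdiff_of_quadratic_minorant (K := (K₀ + 1) + ∑ i, lam i * (K i + 1 + 2 * ‖e‖))
    (hd.Phi_eq hs hξ hV hL hkkt.feasible) fun z => ?_
  by_cases hz : (∀ i, 0 ≤ z.snd.snd.snd.fst i) ∧
      d.T z.fst z.snd.fst z.snd.snd.fst z.snd.snd.snd.fst ∈ nonposOrthant m
  swap
  · rw [Phi, if_neg hz]
    exact le_top
  rw [Phi, if_pos hz, EReal.coe_le_coe_iff, inner_mkZ]
  obtain ⟨hc1, hc2, hc3, hc4, hc5⟩ := norm_components_le (z - mkZ x s V L ξ)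
  obtain ⟨hzL, hzT⟩ := hz
  set N := ‖z - mkZ x s V L ξ‖
  set dx := (z - mkZ x s V L ξ).fst
  set ds := (z - mkZ x s V L ξ).snd.fst
  set dV := (z - mkZ x s V L ξ).snd.snd.fst
  set dL := (z - mkZ x s V L ξ).snd.snd.snd.fst
  set dξ := (z - mkZ x s V L ξ).snd.snd.snd.snd
  have ex : z.fst = x + dx := (add_sub_cancel x z.fst).symm
  have es : z.snd.fst = s + ds := (add_sub_cancel s z.snd.fst).symm
  have eV : ∀ i, z.snd.snd.fst i = V i + dV i := fun i => (add_sub_cancel (V i) _).symm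
  have eL : ∀ i, z.snd.snd.snd.fst i = L i + dL i := fun i => (add_sub_cancel (L i) _).symm
  have eξ : z.snd.snd.snd.snd = ξ + dξ := (add_sub_cancel ξ _).symm
  have hN : 0 ≤ N := norm_nonneg _
  have e1 : z.fst - s = e + dx := by rw [ex, he]; abel
  have e2 : z.snd.fst - s = ds := by rw [es]; abel
  have e3 : z.fst - z.snd.fst = e + (dx - ds) := by rw [ex, es, he]; abel
  have hφ := hkkt.subgradient z.fst
  have h0 := hle₀ s z.snd.fst z.fst z.snd.snd.snd.snd
  rw [e1, e2, eξ] at h0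
  have h0' : ⟪ξ, e⟫ + ⟪ξ, dx⟫ + ⟪e, dξ⟫ - (K₀ + 1) * N ^ 2
      ≤ ⟪ξ + dξ, e + dx⟫ - K₀ * ‖ds‖ ^ 2 := by
    have h1 := (abs_le.1 (abs_real_inner_le_norm dξ dx)).1
    have h2 : ‖dξ‖ * ‖dx‖ ≤ N * N := mul_le_mul hc5 hc1 (norm_nonneg _) hN
    have h3 : K₀ * ‖ds‖ ^ 2 ≤ K₀ * N ^ 2 := by gcongr
    simp only [inner_add_left, inner_add_right]
    rw [real_inner_comm dξ e]
    nlinarith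
  have hcomp : ∀ i, lam i * (⟪V i + L i • e, dx⟫ - L i * ⟪e, ds⟫ + ⟪e, dV i⟫
      + 1 / 2 * ‖e‖ ^ 2 * dL i - (K i + 1 + 2 * ‖e‖) * N ^ 2) ≤ 0 := by
    intro i
    have h1 := hle i s z.snd.fst z.fst (z.snd.snd.fst i)
    have h2 : d.T z.fst z.snd.fst z.snd.snd.fst z.snd.snd.snd.fst i ≤ 0 := hzT i
    rw [T_apply, e3, eL i] at h2
    rw [e1, e2, eV i] at h1
    have h3 := component_minorant (e := e) (v := V i) (l := L i)
      (by rw [← eL i]; exact hzL i) hc1 hc2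
      ((PiLp.norm_apply_le dV i).trans hc3) ((abs_apply_le_norm dL i).trans hc4) (hK i)
    have h4 := hkkt.complementarity i
    rw [P.G_apply, hd.g_eq i s hs] at h4
    rw [eV i] at h2
    have h5 : ⟪V i + L i • e, dx⟫ - L i * ⟪e, ds⟫ + ⟪e, dV i⟫
      + 1 / 2 * ‖e‖ ^ 2 * dL i - (K i + 1 + 2 * ‖e‖) * N ^ 2 ≤
      -(d.f i s - d.h i s + ⟪V i, e⟫ + 1 / 2 * ‖e‖ ^ 2 * L i) := by linarith
    have h6 := mul_le_mul_of_nonneg_left h5 (hkkt.nonneg i)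
    linarith
  have hsum := Finset.sum_nonpos fun i (_ : i ∈ Finset.univ) => hcomp i
  have hexpand : ∑ i, lam i * (⟪V i + L i • e, dx⟫ - L i * ⟪e, ds⟫ + ⟪e, dV i⟫
      + 1 / 2 * ‖e‖ ^ 2 * dL i - (K i + 1 + 2 * ‖e‖) * N ^ 2) =
      ⟪∑ i, lam i • (V i + L i • e), dx⟫ - (∑ i, lam i * L i) * ⟪e, ds⟫
      + ∑ i, ⟪lam i • e, dV i⟫ + ∑ i, ((1 / 2 * ‖e‖ ^ 2) • lam) i * dL i
      - (∑ i, lam i * (K i + 1 + 2 * ‖e‖)) * N ^ 2 := by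
    rw [sum_inner, Finset.sum_mul, Finset.sum_mul, ← Finset.sum_sub_distrib,
      ← Finset.sum_add_distrib, ← Finset.sum_add_distrib, ← Finset.sum_sub_distrib]
    refine Finset.sum_congr rfl fun i _ => ?_
    rw [inner_smul_left, inner_smul_left, PiLp.smul_apply]
    simp only [conj_trivial, smul_eq_mul]
    ring
  rw [hexpand] at hsum
  have hst := hkkt.stationarity
  rw [Problem.lagrangeGrad] at hst
  have hst' : ⟪ξ, dx⟫ + ⟪Q e, dx⟫ + ⟪v, dx⟫ + ⟪∑ i, lam i • (V i + L i • e), dx⟫ = 0 := by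
    rw [← inner_add_left, ← inner_add_left, ← inner_add_left, hst, inner_zero_left]
  have e4 : z.fst - x = dx := by rw [ex]; abel
  rw [e4] at hφ
  have hg0 : (P.g0 s).toReal = d.f0 s - d.h0 s := by rw [hd.g0_eq s hs, EReal.toReal_coe]
  rw [T0_eq_tilt, eξ, hg0, inner_neg_left, inner_neg_left, inner_smul_left]
  simp only [conj_trivial]
  linarith

/-- The subgradient of `mem_regSubdiff_Phi` is bounded by a multiple of `‖x - s‖`. -/
theorem norm_subgradient_le {Q : Vec n →L[ℝ] Vec n} {lam L : Vec m} {e : Vec n} {C : ℝ}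
    (hQ : ‖Q‖ ≤ C) (hlam : ‖lam‖ ≤ C) (hlam0 : ∀ i, 0 ≤ lam i) (hL : ∀ i, L i ≤ C)
    (he : ‖e‖ ≤ C) (hC : 0 ≤ C) (hL0 : ∀ i, 0 ≤ L i) :
    ‖mkZ (-Q e) (-((∑ i, lam i * L i) • e))
      (WithLp.toLp 2 fun i => lam i • e : Mat n m) ((1 / 2 * ‖e‖ ^ 2) • lam) e‖ ≤
      (C + (m * C * C + (C + (C * C + 1)))) * ‖e‖ := by
  refine (norm_mkZ_le _ _ _ _ _).trans ?_
  have h1 : ‖-Q e‖ ≤ C * ‖e‖ := by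
    rw [norm_neg]
    exact (Q.le_opNorm e).trans (mul_le_mul_of_nonneg_right hQ (norm_nonneg _))
  have h2 : ‖-((∑ i, lam i * L i) • e)‖ ≤ m * C * C * ‖e‖ := by
    rw [norm_neg, norm_smul, Real.norm_of_nonneg
      (Finset.sum_nonneg fun i _ => mul_nonneg (hlam0 i) (hL0 i))]
    refine mul_le_mul_of_nonneg_right ?_ (norm_nonneg _)
    calc ∑ i, lam i * L i ≤ ∑ i, lam i * C :=
          Finset.sum_le_sum fun i _ => mul_le_mul_of_nonneg_left (hL i) (hlam0 i)
      _ = (∑ i, lam i) * C := by rw [Finset.sum_mul]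
      _ ≤ m * C * C := by
        refine mul_le_mul_of_nonneg_right ((sum_le_card_mul_norm lam).trans ?_) hC
        gcongr
  have h3 : ‖(WithLp.toLp 2 fun i => lam i • e : Mat n m)‖ ≤ C * ‖e‖ := by
    have : ‖(WithLp.toLp 2 fun i => lam i • e : Mat n m)‖ = ‖lam‖ * ‖e‖ := by
      rw [PiLp.norm_eq_of_L2, EuclideanSpace.norm_eq]
      simp only [norm_smul, mul_pow]
      rw [← Finset.sum_mul, Real.sqrt_mul (by positivity), Real.sqrt_sq (norm_nonneg _)]
    rw [this]
    gcongr
  have h4 : ‖(1 / 2 * ‖e‖ ^ 2) • lam‖ ≤ C * C * ‖e‖ := by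
    rw [norm_smul, Real.norm_of_nonneg (by positivity)]
    have h5 : ‖e‖ ^ 2 ≤ C * ‖e‖ := by nlinarith [norm_nonneg e]
    calc 1 / 2 * ‖e‖ ^ 2 * ‖lam‖ ≤ (C * ‖e‖) * C :=
          mul_le_mul (by nlinarith [sq_nonneg ‖e‖]) hlam (norm_nonneg _) (by positivity)
      _ = C * C * ‖e‖ := by ring
  linarith

end Decomposition

end Potential

/-! ### The Kurdyka–Łojasiewicz inequality along the iterates -/

/-- The KL property of exponent `q` at `xb`, in the form `(h(x) - h(x̄)) ^ q ≤ C ‖w‖` for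
subgradients `w` at `x`. -/
theorem HasKLExponent.exists_le {X : Type*} [NormedAddCommGroup X] [InnerProductSpace ℝ X]
    {h : X → EReal} {q : ℝ} {xb : X} (hKL : HasKLExponent h q xb) {ϖ : ℝ}
    (hϖ : h xb = ϖ) :
    ∃ C : ℝ, ∃ U ∈ 𝓝 xb, ∃ ω : EReal, (ϖ : EReal) < ω ∧ ∀ x ∈ U, ∀ t : ℝ, h x = t → ϖ < t →
      (t : EReal) < ω → ∀ w ∈ limSubdiff h x, (t - ϖ) ^ q ≤ C * ‖w‖ := by
  obtain ⟨-, δ, η, c, hδ, hη, -, hineq⟩ := hKL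
  refine ⟨c * (1 - q), Metric.closedBall xb δ, Metric.closedBall_mem_nhds xb hδ, ϖ + η, ?_, ?_⟩
  · simpa using EReal.add_lt_add_left_coe hη ϖ
  intro x hx t ht hϖt htω w hw
  have h1 := hineq x hx (by rw [hϖ, ht]; exact_mod_cast hϖt) (by rw [hϖ, ht]; exact htω)
  rw [ht, hϖ, ← EReal.coe_sub, EReal.toReal_coe] at h1
  have hpos : 0 < t - ϖ := sub_pos.2 hϖt
  have hder : deriv (fun t : ℝ => c * t ^ (1 - q)) (t - ϖ) =
      c * ((1 - q) * (t - ϖ) ^ (1 - q - 1)) :=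
    ((Real.hasDerivAt_rpow_const (Or.inl hpos.ne')).const_mul c).deriv
  rw [hder] at h1
  have h2 : Metric.infEDist 0 (limSubdiff h x) ≤ ENNReal.ofReal ‖w‖ := by
    refine (Metric.infEDist_le_edist_of_mem hw).trans ?_
    rw [edist_dist, dist_zero_left]
  have h3 := h1.trans (mul_le_mul_right h2 _)
  rw [← ENNReal.ofReal_mul' (norm_nonneg _), ← ENNReal.ofReal_one,
    ENNReal.ofReal_le_ofReal_iff'] at h3
  have h4 : 1 ≤ c * ((1 - q) * (t - ϖ) ^ (1 - q - 1)) * ‖w‖ := by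
    rcases h3 with h3 | h3
    · exact h3
    · exact absurd h3 (by norm_num)
  have h5 : (t - ϖ) ^ (1 - q - 1) = ((t - ϖ) ^ q)⁻¹ := by
    rw [← Real.rpow_neg hpos.le]
    congr 1
    ring
  have h6 : 0 < (t - ϖ) ^ q := Real.rpow_pos_of_pos hpos q
  rw [h5] at h4
  calc (t - ϖ) ^ q = (t - ϖ) ^ q * 1 := (mul_one _).symm
    _ ≤ (t - ϖ) ^ q * (c * ((1 - q) * ((t - ϖ) ^ q)⁻¹) * ‖w‖) :=
        mul_le_mul_of_nonneg_left h4 h6.le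
    _ = c * (1 - q) * ‖w‖ := by field_simp

namespace Run

variable {n m : ℕ} {R : Run n m} {P : Problem n m} {p : Params}

/-- The value of the potential function at `zᵏ`. -/
noncomputable def potential (R : Run n m) (P : Problem n m) (xb : ℕ → ℕ → Vec n) (k : ℕ) : ℝ :=
  P.φ (xb k (R.J k)) + ((P.g0 (R.x k)).toReal + ⟪R.ξ k, xb k (R.J k) - R.x k⟫)

/-- The value of the objective function at `xᵏ`. -/
noncomputable def objective (R : Run n m) (P : Problem n m) (k : ℕ) : ℝ :=
  (P.g0 (R.x k)).toReal + P.φ (R.x k)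

theorem IsGenerated.F_eq_objective (hR : R.IsGenerated P p) (hP : P.Standing) (k : ℕ) :
    P.F (R.x k) = (R.objective P k : EReal) := hP.F_eq (hR.feasible k)

theorem IsGenerated.decrease (hR : R.IsGenerated P p) (hP : P.Standing) (k : ℕ) :
    p.α / 2 * ‖R.x (k + 1) - R.x k‖ ^ 2 ≤ R.objective P k - R.objective P (k + 1) := by
  have h1 := (hR.accept k).2
  rw [← hR.next k, hR.F_eq_objective hP, hR.F_eq_objective hP, ← EReal.coe_sub,
    EReal.coe_le_coe_iff] at h1
  linarith

theorem IsGenerated.tendsto_objective (hR : R.IsGenerated P p) (hP : P.Standing) (hp : p.Valid) :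
    ∃ ϖ, Tendsto (R.objective P) atTop (𝓝 ϖ) ∧ ∀ k, ϖ ≤ R.objective P k := by
  have hanti : Antitone (R.objective P) := antitone_nat_of_succ_le fun k => by
    have := hR.decrease hP k
    have := hp.α_pos
    have : 0 ≤ p.α / 2 * ‖R.x (k + 1) - R.x k‖ ^ 2 := by positivity
    linarith
  obtain ⟨c, hc⟩ := hP.bddBelow
  have hbdd : BddBelow (range (R.objective P)) := ⟨c, by
    rintro _ ⟨k, rfl⟩
    have := hc _ (hR.feasible k)
    rw [hR.F_eq_objective hP] at this
    exact_mod_cast this⟩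
  exact ⟨_, tendsto_atTop_ciInf hanti hbdd, fun k => ciInf_le hbdd k⟩

theorem IsGenerated.tendsto_step (hR : R.IsGenerated P p) (hP : P.Standing) (hp : p.Valid) :
    Tendsto (fun k => ‖R.x (k + 1) - R.x k‖) atTop (𝓝 0) := by
  obtain ⟨ϖ, hϖ, -⟩ := hR.tendsto_objective hP hp
  have hα := hp.α_pos
  have h1 : Tendsto (fun k => 2 / p.α * (R.objective P k - R.objective P (k + 1))) atTop
      (𝓝 0) := by
    have := (hϖ.sub ((tendsto_add_atTop_iff_nat 1).2 hϖ)).const_mul (2 / p.α)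
    simpa using this
  have h2 : Tendsto (fun k => ‖R.x (k + 1) - R.x k‖ ^ 2) atTop (𝓝 0) := by
    refine squeeze_zero (fun k => by positivity) (fun k => ?_) h1
    rw [div_mul_eq_mul_div, le_div_iff₀ hα]
    linarith [hR.decrease hP k]
  have h3 := h2.sqrt
  simpa [Real.sqrt_sq] using h3

theorem IsGenerated.potential_le (hR : R.IsGenerated P p) (hp : p.Valid)
    {xb : ℕ → ℕ → Vec n} (hxb : R.IsExactSolution P xb) (k : ℕ) :
    R.potential P xb k ≤ R.objective P k := by
  have h1 := (hxb k (R.J k) le_rfl).2 (hR.x_mem_subFeasible k _ _)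
  have h2 := hR.Q_ge hp (le_refl (R.J k)) (xb k (R.J k) - R.x k)
  have hμ := hp.μmin_pos
  have h3 : 0 ≤ p.μmin * ‖xb k (R.J k) - R.x k‖ ^ 2 := by positivity
  have h4 : P.subObj (R.x k) (R.ξ k) (R.Q k (R.J k)) (xb k (R.J k)) ≤
      P.subObj (R.x k) (R.ξ k) (R.Q k (R.J k)) (R.x k) := h1
  rw [P.subObj_self, Problem.subObj, Problem.model] at h4
  rw [potential, objective]
  linarith

/-- The estimates that relate an outer iteration to the potential function: eventually the exact
subproblem solutions have bounded multipliers, lie within a multiple of the step length from `xᵏ`,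
and the new objective value exceeds the potential at most by a multiple of the squared step. -/
theorem IsGenerated.exists_step_estimates (hR : R.IsGenerated P p) (hP : P.Standing)
    (hp : p.Valid) {xb : ℕ → ℕ → Vec n} (hxb : R.IsExactSolution P xb)
    (hbdd : Bornology.IsBounded (range R.x)) (hBMP : R.BMPAtClusterPoints P xb) :
    ∃ C : ℝ, 0 ≤ C ∧ (∀ k, ‖R.z xb k‖ ≤ C ∧ ‖xb k (R.J k) - R.x k‖ ≤ C ∧
        ‖R.Q k (R.J k)‖ ≤ C ∧ ∀ i, R.L k (R.J k) i ≤ C) ∧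
      ∀ᶠ k in atTop, ‖xb k (R.J k) - R.x k‖ ≤ C * ‖R.x (k + 1) - R.x k‖ ∧
        R.objective P (k + 1) ≤ R.potential P xb k + C * ‖R.x (k + 1) - R.x k‖ ^ 2 ∧
        ∃ v lam, ‖lam‖ ≤ C ∧ P.IsKKT (R.x k) (R.ξ k) (R.V k) (R.Q k (R.J k)) (R.L k (R.J k))
          (xb k (R.J k)) v lam := by
  obtain ⟨B, hB0, hB⟩ := hR.exists_bound hP hp hxb hbdd
  have hB' : ∀ k, ‖R.x k‖ ≤ B ∧ ∀ j ≤ R.J k, ‖R.y k j‖ ≤ B := fun k =>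
    ⟨(hB k).1, fun j hj => ((hB k).2.2 j hj).1⟩
  obtain ⟨CL, hCL0, hCL⟩ := hR.exists_L_bound hP hp hB'
  obtain ⟨Cμ, hCμ0, hCμ⟩ := hR.exists_μ_bound hP hp hB'
  obtain ⟨ρ, hρ0, hρ⟩ := hR.exists_descent hP hB'
  obtain ⟨CV, hCV0, hCV⟩ := hR.exists_V_bound hP (fun k => (hB k).1)
  obtain ⟨CQ, hCQ0, hCQ⟩ := hR.exists_Q_bound hp hCμ0 hCμ
  have hLn : ∀ k, ‖R.L k (R.J k)‖ ≤ m * CL := fun k => by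
    have h1 : ‖R.L k (R.J k)‖ ≤ ∑ i, ‖R.L k (R.J k) i‖ := by
      rw [EuclideanSpace.norm_eq]
      refine Real.sqrt_le_iff.2 ⟨Finset.sum_nonneg fun _ _ => norm_nonneg _, ?_⟩
      exact Finset.sum_sq_le_sq_sum_of_nonneg fun _ _ => norm_nonneg _
    refine h1.trans ?_
    calc ∑ i, ‖R.L k (R.J k) i‖ ≤ ∑ _i : Fin m, CL := Finset.sum_le_sum fun i _ => by
          rw [Real.norm_of_nonneg (hR.L_nonneg hp le_rfl i)]
          exact hCL k _ le_rfl i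
      _ = m * CL := by simp
  obtain ⟨Λ, hΛ⟩ := hR.exists_multipliers hP hp hxb hBMP
    (fun k => ⟨(hB k).1, (hB k).2.1, ((hB k).2.2 _ le_rfl).2⟩) (C := CL + CV + CQ)
    (fun k i => by linarith [hCL k _ le_rfl i]) (fun k => by linarith [hCV k])
    (fun k => by linarith [hCQ k _ le_rfl])
  set Λ' := max Λ 0 with hΛ'
  have hΛ0 : 0 ≤ Λ' := le_max_right _ _
  have hβS := hp.βS_pos
  have hβC := hp.βC_pos
  set A := max 1 ((p.βS + (1 + m * Λ') * (p.βC / 2)) / p.μmin) with hA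
  have hA1 : 1 ≤ A := le_max_left _ _
  set E := p.βS * A + p.βC / 2 + CQ * (A + 1) ^ 2 + ρ / 2 with hE
  have hE0 : 0 ≤ E := by positivity
  have hm : (0 : ℝ) ≤ m * CL := by positivity
  set C := (B + (B + (CV + (m * CL + B)))) + CQ + CL + Λ' + (A + 1) + E with hC
  refine ⟨C, by positivity, fun k => ⟨?_, ?_, ?_, fun i => ?_⟩, ?_⟩
  · refine (norm_mkZ_le _ _ _ _ _).trans ?_
    linarith [(hB k).1, (hB k).2.1, ((hB k).2.2 _ le_rfl).2, hCV k, hLn k]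
  · refine (norm_sub_le _ _).trans ?_
    linarith [(hB k).1, ((hB k).2.2 _ le_rfl).2]
  · linarith [hCQ k _ le_rfl]
  · linarith [hCL k _ le_rfl i]
  filter_upwards [hΛ] with k hk
  obtain ⟨v, lam, hlam, hkkt⟩ := hk
  have hlam' : ‖lam‖ ≤ Λ' := hlam.trans (le_max_left _ _)
  have hsum : ∑ i, lam i ≤ m * Λ' := (sum_le_card_mul_norm lam).trans (by gcongr)
  have hy := hR.inexact_C k (R.J k) le_rfl
  have hS := hR.inexact_S k (R.J k) le_rfl
  have hvy := isSubgradientAt_of_mem_limSubdiff hP.φ_convex (hR.v_mem k (R.J k) le_rfl)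
  obtain ⟨h1, h2⟩ := hkkt.inexact_estimates hp.μmin_pos hβC (hR.Q_symm le_rfl)
    (hR.Q_ge hp le_rfl) (fun i => hR.L_nonneg hp le_rfl i) hsum hvy
    (hR.lam_nonneg k (R.J k) le_rfl) hy hS
  have h3 := hρ k (R.J k) le_rfl (hR.accept k).1
  have h4 := hR.Q_ge hp (le_refl (R.J k)) (R.y k (R.J k) - R.x k)
  have h5 : ⟪xb k (R.J k) - R.x k, R.Q k (R.J k) (xb k (R.J k) - R.x k)⟫ ≤
      CQ * ‖xb k (R.J k) - R.x k‖ ^ 2 := by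
    have h6 := real_inner_le_norm (xb k (R.J k) - R.x k)
      (R.Q k (R.J k) (xb k (R.J k) - R.x k))
    have h7 := (R.Q k (R.J k)).le_opNorm (xb k (R.J k) - R.x k)
    have h8 := mul_le_mul_of_nonneg_right (hCQ k (R.J k) le_rfl)
      (norm_nonneg (xb k (R.J k) - R.x k))
    nlinarith [norm_nonneg (xb k (R.J k) - R.x k)]
  rw [← hR.next k] at h1 h2 h3 h4
  set x := R.x k
  set y := R.x (k + 1) with hydef
  set xs := xb k (R.J k)
  have h6 : ‖xs - x‖ ≤ (A + 1) * ‖y - x‖ := by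
    have : xs - x = (xs - y) + (y - x) := by abel
    rw [this]
    refine (norm_add_le _ _).trans ?_
    linarith
  have hμ := hp.μmin_pos
  have hr : 0 ≤ ‖y - x‖ := norm_nonneg _
  refine ⟨h6.trans (mul_le_mul_of_nonneg_right (by linarith) hr), ?_, v, lam, by linarith, hkkt⟩
  have h7 : ‖xs - x‖ ^ 2 ≤ (A + 1) ^ 2 * ‖y - x‖ ^ 2 := by
    rw [← mul_pow]
    exact pow_le_pow_left₀ (norm_nonneg _) h6 2
  have h8 : p.βS * ‖y - x‖ * ‖xs - y‖ ≤ p.βS * A * ‖y - x‖ ^ 2 := by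
    calc p.βS * ‖y - x‖ * ‖xs - y‖ ≤ p.βS * ‖y - x‖ * (A * ‖y - x‖) := by gcongr
      _ = _ := by ring
  have h9 : 0 ≤ p.μmin * ‖y - x‖ ^ 2 := by positivity
  have h10 : CQ * ‖xs - x‖ ^ 2 ≤ CQ * ((A + 1) ^ 2 * ‖y - x‖ ^ 2) := by gcongr
  have h11 : E * ‖y - x‖ ^ 2 ≤ C * ‖y - x‖ ^ 2 := by
    refine mul_le_mul_of_nonneg_right ?_ (by positivity)
    linarith
  have h12 : E * ‖y - x‖ ^ 2 = p.βS * A * ‖y - x‖ ^ 2 + p.βC / 2 * ‖y - x‖ ^ 2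
      + CQ * ((A + 1) ^ 2 * ‖y - x‖ ^ 2) + ρ / 2 * ‖y - x‖ ^ 2 := by rw [hE]; ring
  have h13 : 0 ≤ CQ * ((A + 1) ^ 2 * ‖y - x‖ ^ 2) := by positivity
  rw [Problem.subObj, Problem.subObj, Problem.model, Problem.model] at h2
  rw [objective, potential, ← hydef]
  linarith

section Decomposition

variable {D : Set (Vec n)} {d : Decomposition n m} {xb : ℕ → ℕ → Vec n}

theorem IsGenerated.isSubgradientAt_h0 (hR : R.IsGenerated P p) (hd : d.IsDecompositionOn P D)
    (hDx : ∀ k, R.x k ∈ interior D) (k : ℕ) :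
    IsSubgradientAt d.h0 (R.x k) (gradient d.f0 (R.x k) - R.ξ k) :=
  isSubgradientAt_sub_of_mem_limSubdiff hd.f0_quad (Decomposition.convexOn_of_exists hd.h0_strong)
    hd.g0_eq (hDx k) (hR.ξ_mem k)

theorem IsGenerated.isSubgradientAt_h (hR : R.IsGenerated P p) (hd : d.IsDecompositionOn P D)
    (hDx : ∀ k, R.x k ∈ interior D) (k : ℕ) (i : Fin m) :
    IsSubgradientAt (d.h i) (R.x k) (gradient (d.f i) (R.x k) - R.V k i) :=
  isSubgradientAt_sub_of_mem_limSubdiff (hd.f_quad i)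
    (Decomposition.convexOn_of_exists (hd.h_strong i))
    (fun y hy => by rw [hd.g_eq i y hy]) (hDx k) (hR.V_mem k i)

theorem IsGenerated.Phi_z (hR : R.IsGenerated P p) (hp : p.Valid) (hxb : R.IsExactSolution P xb)
    (hd : d.IsDecompositionOn P D) (hDx : ∀ k, R.x k ∈ interior D) (k : ℕ) :
    d.Phi P.φ (R.z xb k) = (R.potential P xb k : EReal) :=
  hd.Phi_eq (interior_subset (hDx k)) (hR.isSubgradientAt_h0 hd hDx k)
    (hR.isSubgradientAt_h hd hDx k) (fun i => hR.L_nonneg hp le_rfl i) (hxb k _ le_rfl).1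

/-- The graph of the subdifferential of a finite convex function is closed. -/
theorem isSubgradientAt_of_tendsto {h : Vec n → ℝ} (hh : Continuous h) {a v : ℕ → Vec n}
    {a' v' : Vec n} (ha : Tendsto a atTop (𝓝 a')) (hv : Tendsto v atTop (𝓝 v'))
    (hav : ∀ l, IsSubgradientAt h (a l) (v l)) : IsSubgradientAt h a' v' := fun z =>
  le_of_tendsto' (((hh.tendsto a').comp ha).add (hv.inner (tendsto_const_nhds.sub ha)))
    fun l => hav l z

/-- The potential function takes the value `lim F(xᵏ)` at every cluster point of `zᵏ`. -/
theorem IsGenerated.Phi_clusterPt (hR : R.IsGenerated P p) (hP : P.Standing) (hp : p.Valid)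
    (hd : d.IsDecompositionOn P D) (hDcompact : IsCompact D) (hDO : D ⊆ P.O)
    (hDx : ∀ k, R.x k ∈ interior D)
    (hdist : Tendsto (fun k => ‖xb k (R.J k) - R.x k‖) atTop (𝓝 0)) {ϖ : ℝ}
    (hϖ : Tendsto (R.objective P) atTop (𝓝 ϖ)) {z : ZSpace n m}
    (hz : MapClusterPt z atTop (R.z xb)) : d.Phi P.φ z = (ϖ : EReal) := by
  obtain ⟨ψ, hψ, hψz⟩ := hz.tendsto_subseq
  have hxb' : Tendsto (fun l => xb (ψ l) (R.J (ψ l))) atTop (𝓝 z.fst) :=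
    ((by fun_prop : Continuous fun z : ZSpace n m => z.fst).tendsto z).comp hψz
  have hs : Tendsto (fun l => R.x (ψ l)) atTop (𝓝 z.snd.fst) :=
    ((by fun_prop : Continuous fun z : ZSpace n m => z.snd.fst).tendsto z).comp hψz
  have hV : Tendsto (fun l => R.V (ψ l)) atTop (𝓝 z.snd.snd.fst) :=
    ((by fun_prop : Continuous fun z : ZSpace n m => z.snd.snd.fst).tendsto z).comp hψz
  have hL : Tendsto (fun l => R.L (ψ l) (R.J (ψ l))) atTop (𝓝 z.snd.snd.snd.fst) :=
    ((by fun_prop : Continuous fun z : ZSpace n m => z.snd.snd.snd.fst).tendsto z).comp hψz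
  have hξ : Tendsto (fun l => R.ξ (ψ l)) atTop (𝓝 z.snd.snd.snd.snd) :=
    ((by fun_prop : Continuous fun z : ZSpace n m => z.snd.snd.snd.snd).tendsto z).comp hψz
  have hxs : z.fst = z.snd.fst := by
    have h1 : Tendsto (fun l => ‖xb (ψ l) (R.J (ψ l)) - R.x (ψ l)‖) atTop
        (𝓝 ‖z.fst - z.snd.fst‖) := (hxb'.sub hs).norm
    have h2 := tendsto_nhds_unique h1 (hdist.comp hψ.tendsto_atTop)
    exact sub_eq_zero.1 (norm_eq_zero.1 h2)
  set s := z.snd.fst with hsdef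
  have hsD : s ∈ D := hDcompact.isClosed.mem_of_tendsto hs
    (Eventually.of_forall fun l => interior_subset (hDx _))
  have hsub : ∀ {f h : Vec n → ℝ} {v : ℕ → Vec n} {v' : Vec n}, IsStronglyConvexQuadratic f →
      (∃ σ : ℝ, 0 < σ ∧ StrongConvexOn univ σ h) → Tendsto (fun l => v (ψ l)) atTop (𝓝 v') →
      (∀ k, IsSubgradientAt h (R.x k) (gradient f (R.x k) - v k)) →
      IsSubgradientAt h s (gradient f s - v') := by
    intro f h v v' hf hh hv hsg
    obtain ⟨A, hc, -⟩ := hf.exists_expansion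
    exact isSubgradientAt_of_tendsto (continuous_of_convexOn
      (Decomposition.convexOn_of_exists hh)) hs (((hc.tendsto s).comp hs).sub hv)
      fun l => hsg (ψ l)
  have hξs := hsub hd.f0_quad hd.h0_strong hξ (hR.isSubgradientAt_h0 hd hDx)
  have hVs : ∀ i, IsSubgradientAt (d.h i) s (gradient (d.f i) s - z.snd.snd.fst i) := fun i =>
    hsub (hd.f_quad i) (hd.h_strong i) (v := fun k => R.V k i)
      (((by fun_prop : Continuous fun V : Mat n m => V i).tendsto _).comp hV)
      (fun k => hR.isSubgradientAt_h hd hDx k i)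
  have hLnn : ∀ i, 0 ≤ z.snd.snd.snd.fst i := fun i =>
    ge_of_tendsto' (((by fun_prop : Continuous fun L : Vec m => L i).tendsto _).comp hL)
      fun l => hR.L_nonneg hp le_rfl i
  have hsΓ : s ∈ P.feasible := hP.isClosed_feasible.mem_of_tendsto hs
    (Eventually.of_forall fun l => hR.feasible _)
  have hez : z = mkZ s s z.snd.snd.fst z.snd.snd.snd.fst z.snd.snd.snd.snd := by
    conv_lhs => rw [show z = mkZ z.fst z.snd.fst z.snd.snd.fst z.snd.snd.snd.fst
      z.snd.snd.snd.snd from rfl]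
    rw [hxs]
  rw [hez, hd.Phi_eq hsD hξs hVs hLnn (fun i => by rw [P.G_self]; exact hsΓ i), sub_self,
    inner_zero_right, add_zero, EReal.coe_eq_coe_iff]
  have h1 : Tendsto (fun l => R.objective P (ψ l)) atTop (𝓝 ((P.g0 s).toReal + P.φ s)) :=
    Tendsto.add
      (((hP.g0_lipschitz s (hDO hsD)).continuousAt_toReal.tendsto).comp hs)
      (((continuous_of_convexOn hP.φ_convex).tendsto s).comp hs)
  have h2 := tendsto_nhds_unique h1 (hϖ.comp hψ.tendsto_atTop)
  linarith

/-- The KL property turns the estimates of an outer iteration into the recursion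
`(F(xᵏ⁺¹) - ϖ) ^ q ≤ C ‖xᵏ⁺¹ - xᵏ‖`. -/
theorem IsGenerated.exists_kl_recursion (hR : R.IsGenerated P p) (hP : P.Standing)
    (hp : p.Valid) (hxb : R.IsExactSolution P xb)
    (hbdd : Bornology.IsBounded (range R.x)) (hBMP : R.BMPAtClusterPoints P xb)
    (hDcompact : IsCompact D) (hDO : D ⊆ P.O) (hDx : ∀ k, R.x k ∈ interior D)
    (hd : d.IsDecompositionOn P D) {q : ℝ} (hq : 1 / 2 ≤ q) (hq1 : q < 1)
    (hKL : ∀ z : ZSpace n m, MapClusterPt z atTop (R.z xb) → HasKLExponent (d.Phi P.φ) q z)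
    {ϖ : ℝ} (hϖ : Tendsto (R.objective P) atTop (𝓝 ϖ)) (hϖle : ∀ k, ϖ ≤ R.objective P k) :
    ∃ C : ℝ, ∀ᶠ k in atTop,
      (R.objective P (k + 1) - ϖ) ^ q ≤ C * ‖R.x (k + 1) - R.x k‖ := by
  obtain ⟨C, hC0, hCb, hCe⟩ := hR.exists_step_estimates hP hp hxb hbdd hBMP
  have hstep := hR.tendsto_step hP hp
  have hdist : Tendsto (fun k => ‖xb k (R.J k) - R.x k‖) atTop (𝓝 0) := by
    have h1 : Tendsto (fun k => C * ‖R.x (k + 1) - R.x k‖) atTop (𝓝 0) := by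
      simpa using hstep.const_mul C
    exact tendsto_of_tendsto_of_tendsto_of_le_of_le' tendsto_const_nhds h1
      (Eventually.of_forall fun _ => norm_nonneg _) (hCe.mono fun k hk => hk.1)
  set A := C + (m * C * C + (C + (C * C + 1))) with hA
  have hA0 : 0 ≤ A := by positivity
  have hpot : ∃ C' : ℝ, ∀ᶠ k in atTop, ϖ < R.potential P xb k →
      (R.potential P xb k - ϖ) ^ q ≤ C' * ‖R.x (k + 1) - R.x k‖ := by
    refine exists_eventually_of_mapClusterPt (isCompact_closedBall (0 : ZSpace n m) C)
      (z := R.z xb) (fun k => by simpa using (hCb k).1)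
      (p := fun C' k => ϖ < R.potential P xb k →
        (R.potential P xb k - ϖ) ^ q ≤ C' * ‖R.x (k + 1) - R.x k‖) ?_ ?_
    · intro C₁ C₂ k h12 h hlt
      exact (h hlt).trans (mul_le_mul_of_nonneg_right h12 (norm_nonneg _))
    · intro z hz
      have hΦz := hR.Phi_clusterPt hP hp hd hDcompact hDO hDx hdist hϖ hz
      obtain ⟨K, U, hU, ω, hω, hKU⟩ := (hKL z hz).exists_le hΦz
      refine ⟨max K 0 * (A * C), U, hU, ?_⟩
      have hlt : ∀ᶠ k in atTop, (R.objective P k : EReal) < ω :=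
        ((continuous_coe_real_ereal.tendsto ϖ).comp hϖ).eventually (gt_mem_nhds hω)
      filter_upwards [hlt, hCe] with k hk he hzU hpos
      obtain ⟨he1, -, v, lam, hlam, hkkt⟩ := he
      have hw := hd.mem_regSubdiff_Phi (interior_subset (hDx k))
        (hR.isSubgradientAt_h0 hd hDx k) (hR.isSubgradientAt_h hd hDx k)
        (fun i => hR.L_nonneg hp le_rfl i) hkkt
      have h1 := hKU _ hzU _ (hR.Phi_z hp hxb hd hDx k) hpos
        (lt_of_le_of_lt (EReal.coe_le_coe_iff.2 (hR.potential_le hp hxb k)) hk) _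
        (regSubdiff_subset_limSubdiff _ _ hw)
      have h2 := Decomposition.norm_subgradient_le (hCb k).2.2.1 hlam hkkt.nonneg
        (hCb k).2.2.2 (hCb k).2.1 hC0 (fun i => hR.L_nonneg hp (le_refl (R.J k)) i)
      refine h1.trans ((mul_le_mul_of_nonneg_right (le_max_left K 0) (norm_nonneg _)).trans ?_)
      rw [mul_assoc, mul_assoc]
      refine mul_le_mul_of_nonneg_left (h2.trans ?_) (le_max_right _ _)
      exact mul_le_mul_of_nonneg_left he1 hA0
  obtain ⟨C', hC'⟩ := hpot
  refine ⟨max C' 0 + C ^ q, ?_⟩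
  have hq0 : 0 < q := by linarith
  filter_upwards [hC', hCe, hstep.eventually_le_const one_pos] with k hk hk' hk1
  have h2 := hk'.2.1
  set Δ := ‖R.x (k + 1) - R.x k‖
  set t := max (R.potential P xb k - ϖ) 0 with ht
  have hΔ : 0 ≤ Δ := norm_nonneg _
  have ht0 : 0 ≤ t := le_max_right _ _
  have h1 : t ^ q ≤ max C' 0 * Δ := by
    rcases lt_or_ge ϖ (R.potential P xb k) with h | h
    · rw [ht, max_eq_left (by linarith)]
      exact (hk h).trans (mul_le_mul_of_nonneg_right (le_max_left _ _) hΔ)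
    · rw [ht, max_eq_right (by linarith), Real.zero_rpow hq0.ne']
      positivity
  have h3 : R.objective P (k + 1) - ϖ ≤ t + C * Δ ^ 2 := by
    linarith [le_max_left (R.potential P xb k - ϖ) 0]
  -- The quadratic error is harmless because `2 q ≥ 1` and the steps are eventually at most `1`.
  have h4 : (C * Δ ^ 2) ^ q ≤ C ^ q * Δ := by
    rw [Real.mul_rpow hC0 (by positivity)]
    refine mul_le_mul_of_nonneg_left ?_ (Real.rpow_nonneg hC0 _)
    rw [← Real.rpow_natCast, ← Real.rpow_mul hΔ]
    calc Δ ^ (((2 : ℕ) : ℝ) * q) ≤ Δ ^ (1 : ℝ) :=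
          Real.rpow_le_rpow_of_exponent_ge' hΔ hk1 zero_le_one (by push_cast; linarith)
      _ = Δ := Real.rpow_one Δ
  calc (R.objective P (k + 1) - ϖ) ^ q ≤ (t + C * Δ ^ 2) ^ q :=
        Real.rpow_le_rpow (sub_nonneg.2 (hϖle _)) h3 hq0.le
    _ ≤ t ^ q + (C * Δ ^ 2) ^ q :=
        Real.rpow_add_le_add_rpow ht0 (by positivity) hq0.le hq1.le
    _ ≤ (max C' 0 + C ^ q) * Δ := by rw [add_mul]; exact add_le_add h1 h4

end Decomposition

end Run

end MBA

theorem theorem4p3 {n m : ℕ} (P : MBA.Problem n m) (p : MBA.Params) (R : MBA.Run n m)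
    (xb : ℕ → ℕ → MBA.Vec n) (D : Set (MBA.Vec n)) (d : MBA.Decomposition n m) (q : ℝ)
    (hP : P.Standing) (hp : p.Valid) (hR : R.IsGenerated P p)
    (hxb : R.IsExactSolution P xb)
    (hsubreg : R.SubproblemsSubregular P xb)
    (hbdd : Bornology.IsBounded (Set.range R.x))
    (hBMP : R.BMPAtClusterPoints P xb)
    (hDcompact : IsCompact D) (hDconvex : Convex ℝ D) (hDO : D ⊆ P.O)
    (hDx : ∀ k, R.x k ∈ interior D)
    (hd : d.IsDecompositionOn P D)
    (hq : 1 / 2 ≤ q) (hq1 : q < 1)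
    (hKL : ∀ z : MBA.ZSpace n m, MapClusterPt z atTop (R.z xb) →
      MBA.HasKLExponent (d.Phi P.φ) q z) :
    ∃ (ϖ : ℝ) (xs : MBA.Vec n),
      Tendsto (fun k => P.F (R.x k)) atTop (𝓝 (ϖ : EReal)) ∧
      Tendsto R.x atTop (𝓝 xs) ∧
      (q = 1 / 2 →
        ∃ a₁ r r' : ℝ, 0 < a₁ ∧ r ∈ Ioo (0 : ℝ) 1 ∧ r' ∈ Ioo (0 : ℝ) 1 ∧
          ∀ᶠ k : ℕ in atTop,
            P.F (R.x (k + 1)) - (ϖ : EReal) ≤ (r : EReal) * (P.F (R.x k) - (ϖ : EReal)) ∧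
            ‖R.x k - xs‖ ≤ a₁ * r' ^ k) ∧
      (1 / 2 < q →
        ∃ a₂ a₃ : ℝ, 0 < a₂ ∧ 0 < a₃ ∧
          ∀ᶠ k : ℕ in atTop,
            P.F (R.x k) - (ϖ : EReal) ≤ ((a₂ * (k : ℝ) ^ (-(1 / (2 * q - 1))) : ℝ) : EReal) ∧
            ‖R.x k - xs‖ ≤ a₃ * (k : ℝ) ^ (-((1 - q) / (2 * q - 1)))) := by
  obtain ⟨ϖ, hϖ, hϖle⟩ := hR.tendsto_objective hP hp
  obtain ⟨C, hC⟩ := hR.exists_kl_recursion hP hp hxb hbdd hBMP hDcompact hDO hDx hd hq hq1 hKL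
    hϖ hϖle
  have hr0 : Tendsto (fun k => R.objective P k - ϖ) atTop (𝓝 0) := by
    simpa using hϖ.sub_const ϖ
  have hα := hp.α_pos
  obtain ⟨xs, hxs, hlin, hsub⟩ := MBA.rates_of_decrease (x := R.x)
    (r := fun k => R.objective P k - ϖ) (a := p.α / 2) (by positivity) hq hq1
    (fun k => sub_nonneg.2 (hϖle k)) hr0
    (fun k => by simpa using hR.decrease hP k) hC
  refine ⟨ϖ, xs, ?_, hxs, fun hqe => ?_, fun hql => ?_⟩
  · simp only [hR.F_eq_objective hP]
    exact (continuous_coe_real_ereal.tendsto ϖ).comp hϖ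
  · obtain ⟨a₁, r, r', ha₁, hr, hr', h⟩ := hlin hqe
    refine ⟨a₁, r, r', ha₁, hr, hr', h.mono fun k hk => ⟨?_, hk.2⟩⟩
    rw [hR.F_eq_objective hP, hR.F_eq_objective hP, ← EReal.coe_sub, ← EReal.coe_sub,
      ← EReal.coe_mul, EReal.coe_le_coe_iff]
    exact hk.1
  · obtain ⟨a₂, a₃, ha₂, ha₃, h⟩ := hsub hql
    refine ⟨a₂, a₃, ha₂, ha₃, h.mono fun k hk => ⟨?_, hk.2⟩⟩
    rw [hR.F_eq_objective hP, ← EReal.coe_sub, EReal.coe_le_coe_iff]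
    exact hk.1
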